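/- Let $S$ be a subsemifield of the tropical semifield $\mathbb{T}=(\mathbb{R}\cup\{-\infty\},\max,+)$, not equal to the Boolean semifield $\{0_S,1_S\}$; write $t^a\in\mathbb T$ for $a\in\mathbb{R}$ and $\Gamma=\{\gamma\in\mathbb{R}: t^\gamma\in S\}$. Let $M\cong\mathbb{Z}^n$ and $N_{\mathbb{R}}=\operatorname{Hom}(M,\mathbb{R})$. A congruence $P$ on $S[M]$ is prime if it is proper and $S[M]/P$ is cancellative and totally ordered by $a\ge b\Leftrightarrow a+b=a$; $\kappa(P)$ is the semifield of fractions of $S[M]/P$, $|f|_P\in\kappa(P)$ is the image of $f$, and $f\le_P g$ means $|f|_P\le|g|_P$. In a totally ordered semifield, nonzero points are open and the sets $\{x<b\}$, $b\neq0$, are a neighbourhood basis of $0$. Give $S[M]$ the finest topology making $S\to S[M]$ continuous. $\operatorname{Cont}_S S[M]$ is the set of primes $P$ on $S[M]$ such that $S[M]/P$ is infinite and $S[M]\to\kappa(P)$ is continuous. A flag of polyhedra $\mathcal{P}_\bullet=(\mathcal{P}_0\le\dots\le\mathcal{P}_k)$ is a sequence of non-empty polyhedra in $N_{\mathbb{R}}$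 containing no line (not necessarily rational), each a face of the next, with $\dim\mathcal{P}_i=i$. A $\Gamma$-rational polyhedron is a set $\{x\in N_{\mathbb R}:\langle x,u_i\rangle\le\gamma_i,\ 1\le i\le q\}$ with $u_i\in M$, $\gamma_i\in\Gamma$; a $\Gamma$-rational polytope is a bounded one. A $\Gamma$-rational polyhedral (polytopal) set is a finite union of $\Gamma$-rational polyhedra (polytopes); these sets form lattices under $\cap$ and $\cup$. Two flags are $\Gamma$-locally equivalent if the same $\Gamma$-rational polyhedra meet the relative interiors of all their members. Let $c(\mathcal{P})\subseteq\mathbb{R}_{\ge0}\times N_{\mathbb{R}}$ be the closed cone over $\{1\}\times\mathcal{P}$. If all $c(\mathcal{P}_i)$ are simplicial, let $P_{\mathcal{P}_\bullet}$ be the congruence $f\sim g\Leftrightarrow\Phi(f)=\Phi(g)$, where $w_i=(r_i,\xi_i)\in c(\mathcal{P}_i)\setminus c(\mathcal{P}_{i-1})$ are arbitrary (with $c(\mathcal{P}_{-1})=\{0\}$), $\Phi(f)$ is the lexicographic maximum of the vectors $(r_i\gamma+\langle\xi_i,u\rangle)_{0\le i\le k}$ over the terms $t^\gamma\chi^u$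 of $f\neq 0$, and $\Phi(0)=-\infty$. For a prime $P$, let $\mathcal{F}_P$ be the collection of $\Gamma$-rational polyhedral sets containing $\{x\in N_{\mathbb R}: f_0(x)\ge f_i(x),\ 1\le i\le m\}$ for some $f_0,\dots,f_m\in S[M]$ with $|f_0|_P\ge|f_i|_P$ for all $i$, where $f(x)=\max_u(\log f_u+\langle x,u\rangle)$ for $f=\sum_u f_u\chi^u$. Theorem. There are bijections between the following sets: (1) $\operatorname{Cont}_S S[M]$; (2) the set of flags of polyhedra in $N_{\mathbb{R}}$ modulo $\Gamma$-local equivalence; (3) the set of prime filters on the lattice of $\Gamma$-rational polyhedral sets that contain a polytope; (4) the set of prime filters on the lattice of $\Gamma$-rational polytopal sets. They are given as follows. Every flag $\mathcal{P}_\bullet$ is $\Gamma$-locally equivalent to some flag $\mathcal{P}'_\bullet$ with all $c(\mathcal{P}'_i)$ simplicial, and (2)$\to$(1) sends the class of $\mathcal{P}_\bullet$ to $P_{\mathcal{P}'_\bullet}$ for any such $\mathcal{P}'_\bullet$ (independently of the choices of $\mathcal{P}'_\bullet$ and of the $w_i$). The map (1)$\to$(3) is $P\mapsto\mathcal{F}_P$.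 The map (3)$\to$(4) is $\mathcal{F}\mapsto\{U\in\mathcal{F}:U\text{ is a }\Gamma\text{-rational polytopal set}\}$. Moreover, $P\mapsto{\le_P}$ is a bijection from $\operatorname{Cont}_S S[M]$ to the set of Chan–Maclagan preorders on the terms $t^\gamma\chi^u$ ($\gamma\in\Gamma$, $u\in M$), that is, those that compare terms by their weights $\gamma+\langle\xi,u\rangle$ for some $\xi\in N_{\mathbb{R}}$ and break ties by a translation-invariant total preorder on $M$, applied to the exponents $u$. -/

import Mathlib

noncomputable section

namespace TropCont

/-! ### Idempotent semirings, prime congruences, the continuous spectrum -/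

/-- The canonical order of an additively idempotent semiring: `a ≤ b` iff `b + a = b`. -/
def CanLE {A : Type*} [CommSemiring A] (a b : A) : Prop := b + a = b

/-- A congruence `P` on `A` is prime if it is proper and `A / P` is totally ordered (for its
canonical order) and cancellative. -/
structure IsPrimeCon {A : Type*} [CommSemiring A] (P : RingCon A) : Prop where
  ne_top : P ≠ ⊤
  total : ∀ a b : P.Quotient, CanLE a b ∨ CanLE b a
  cancel : ∀ a b c : P.Quotient, a ≠ 0 → a * b = a * c → b = c

/-- The relation `f ≤_P g`, that is `|f|_P ≤ |g|_P` in `A / P`. -/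
def PLE {A : Type*} [CommSemiring A] (P : RingCon A) (f g : A) : Prop :=
  CanLE (f : P.Quotient) (g : P.Quotient)

/-- The multiplicatively cancellable elements of a semiring. -/
def cancellable (A : Type*) [CommSemiring A] : Submonoid A where
  carrier := {a | IsRegular a}
  mul_mem' := fun ha hb => ha.mul hb
  one_mem' := isRegular_one

/-- The residue semifield `κ(P)`: the total semiring of fractions of `A / P`. -/
abbrev Kappa {A : Type*} [CommSemiring A] (P : RingCon A) : Type _ :=
  Localization (cancellable P.Quotient)

/-- The canonical map `A → A / P → κ(P)`, `f ↦ |f|_P`. -/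
def toKappa {A : Type*} [CommSemiring A] (P : RingCon A) : A → Kappa P :=
  fun f => algebraMap P.Quotient (Kappa P) (f : P.Quotient)

/-- The canonical topology of a totally ordered semifield: every nonzero element is an open
point, and the sets `{x | x < b}` with `b ≠ 0` form a basis of neighbourhoods of `0`. -/
def semifieldTopology (K : Type*) [CommSemiring K] : TopologicalSpace K :=
  TopologicalSpace.generateFrom
    ({U | ∃ a : K, a ≠ 0 ∧ U = {a}} ∪
      {U | ∃ b : K, b ≠ 0 ∧ U = {x | CanLE x b ∧ x ≠ b}})

/-- The topology of an `S`-algebra over a totally ordered semifield `S`: the finest one for which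
the structure map is continuous. -/
def algebraTopology (S A : Type*) [CommSemiring S] [CommSemiring A] [Algebra S A] :
    TopologicalSpace A :=
  TopologicalSpace.coinduced (algebraMap S A) (semifieldTopology S)

/-- `Cont_S A`: the prime congruences `P` on `A` with `A / P` infinite for which
`A → κ(P)` is continuous. -/
def ContSpec (S A : Type*) [CommSemiring S] [CommSemiring A] [Algebra S A] : Set (RingCon A) :=
  {P | IsPrimeCon P ∧ Infinite P.Quotient ∧
    @Continuous A (Kappa P) (algebraTopology S A) (semifieldTopology (Kappa P)) (toKappa P)}

/-! ### The tropical semifield -/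

/-- The tropical semifield `ℝ ∪ {-∞}` with maximum as addition and addition as multiplication.
Mathlib's `Tropical` takes minima, so the order of `ℝ` is reversed; `⊤` stands for `-∞`. -/
abbrev Trop : Type := Tropical (WithTop ℝᵒᵈ)

/-- `t^a`, the real number `a` as an element of the tropical semifield. -/
def texp (a : ℝ) : Trop := Tropical.trop ((OrderDual.toDual a : ℝᵒᵈ) : WithTop ℝᵒᵈ)

/-- `log (t^a) = a`. It is applied to nonzero elements only. -/
def tlog (x : Trop) : ℝ := OrderDual.ofDual ((Tropical.untrop x).untopD (OrderDual.toDual 0))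

/-- A subsemifield of the tropical semifield which is not the Boolean semifield `{0, 1}`. -/
structure IsSubsemifield (S : Subsemiring Trop) : Prop where
  inv : ∀ x ∈ S, x ≠ 0 → ∃ y ∈ S, x * y = 1
  ne_bool : ∃ x ∈ S, x ≠ 0 ∧ x ≠ 1

/-- `Γ = log (S \ {0})`. -/
def valueGroup (S : Subsemiring Trop) : Set ℝ := {γ | texp γ ∈ S}

/-! ### Polyhedra in `N_ℝ = Hom(M, ℝ)` -/

/-- `N_ℝ = Hom(M, ℝ)`, a real vector space; `⟨x, u⟩ = x u`. -/
abbrev NR (M : Type*) [AddCommGroup M] : Type _ := M →+ ℝ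

/-- The topology of `N_ℝ`: pointwise convergence (for `M` finitely generated, the usual topology
of a finite-dimensional real vector space). -/
instance instTopologicalSpaceNR (M : Type*) [AddCommGroup M] : TopologicalSpace (NR M) :=
  TopologicalSpace.induced (fun x : NR M => (x : M → ℝ)) inferInstance

variable {M : Type*} [AddCommGroup M]

/-- A polyhedron: a finite intersection of closed affine half-spaces. -/
def IsPolyhedron (P : Set (NR M)) : Prop :=
  ∃ I : Finset ((NR M →ₗ[ℝ] ℝ) × ℝ), P = {x | ∀ p ∈ I, p.1 x ≤ p.2}

/-- A subset is bounded if each `u ∈ M` is bounded on it. -/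
def IsBoundedSet (P : Set (NR M)) : Prop := ∀ u : M, ∃ B : ℝ, ∀ x ∈ P, |x u| ≤ B

/-- A polytope is a bounded polyhedron. -/
def IsPolytope (P : Set (NR M)) : Prop := IsPolyhedron P ∧ IsBoundedSet P

/-- For polyhedra: strongly convex means that it contains no line. -/
def ContainsNoLine (P : Set (NR M)) : Prop :=
  ∀ x v : NR M, (∀ t : ℝ, x + t • v ∈ P) → v = 0

/-- `F` is a face of `P`. -/
def IsFaceOf (F P : Set (NR M)) : Prop :=
  ∃ (l : NR M →ₗ[ℝ] ℝ) (c : ℝ), (∀ x ∈ P, l x ≤ c) ∧ F = {x ∈ P | l x = c}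

/-- A flag `P_0 ≤ P_1 ≤ ⋯ ≤ P_k` of non-empty strongly convex polyhedra in `N_ℝ`, each a face of
the next, with `dim P_i = i`. -/
structure PolyFlag (M : Type*) [AddCommGroup M] where
  length : ℕ
  cell : Fin (length + 1) → Set (NR M)
  polyhedron : ∀ i, IsPolyhedron (cell i)
  nonempty : ∀ i, (cell i).Nonempty
  noLine : ∀ i, ContainsNoLine (cell i)
  face : ∀ j : Fin length, IsFaceOf (cell j.castSucc) (cell j.succ)
  dim : ∀ i, Module.finrank ℝ (vectorSpan ℝ (cell i)) = (i : ℕ)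

/-- A `Γ`-rational polyhedron. -/
def IsRatPolyhedron (Γ : Set ℝ) (Q : Set (NR M)) : Prop :=
  ∃ I : Finset (M × ℝ), (∀ p ∈ I, p.2 ∈ Γ) ∧ Q = {x | ∀ p ∈ I, x p.1 ≤ p.2}

/-- A `Γ`-rational polytope. -/
def IsRatPolytope (Γ : Set ℝ) (Q : Set (NR M)) : Prop := IsRatPolyhedron Γ Q ∧ IsBoundedSet Q

/-- A `Γ`-rational polyhedral set: a finite union of `Γ`-rational polyhedra. -/
def IsRatPolyhedralSet (Γ : Set ℝ) (U : Set (NR M)) : Prop :=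
  ∃ C : Set (Set (NR M)), C.Finite ∧ (∀ Q ∈ C, IsRatPolyhedron Γ Q) ∧ U = ⋃₀ C

/-- A `Γ`-rational polytopal set: a finite union of `Γ`-rational polytopes. -/
def IsRatPolytopalSet (Γ : Set ℝ) (U : Set (NR M)) : Prop :=
  ∃ C : Set (Set (NR M)), C.Finite ∧ (∀ Q ∈ C, IsRatPolytope Γ Q) ∧ U = ⋃₀ C

/-- A `Γ`-rational neighbourhood of a flag: a `Γ`-rational polyhedron that meets the relative
interior of each member of the flag. -/
def IsRatNhd (Γ : Set ℝ) (F : PolyFlag M) (Q : Set (NR M)) : Prop :=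
  IsRatPolyhedron Γ Q ∧ ∀ i, (Q ∩ intrinsicInterior ℝ (F.cell i)).Nonempty

/-- `Γ`-local equivalence of flags: the same `Γ`-rational neighbourhoods. -/
def LocEquiv (Γ : Set ℝ) (F F' : PolyFlag M) : Prop :=
  ∀ Q : Set (NR M), IsRatNhd Γ F Q ↔ IsRatNhd Γ F' Q

/-- Local equivalence is an equivalence relation. -/
def flagSetoid (Γ : Set ℝ) (M : Type*) [AddCommGroup M] : Setoid (PolyFlag M) where
  r := LocEquiv Γ
  iseqv :=
    ⟨fun _ _ => Iff.rfl, fun h Q => (h Q).symm, fun h h' Q => (h Q).trans (h' Q)⟩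

/-! ### The prime congruence of a flag -/

/-- The closed cone `c(P)` over `P` in `ℝ≥0 × N_ℝ ⊆ ℝ × N_ℝ`. -/
def coneOver (P : Set (NR M)) : Set (ℝ × NR M) :=
  closure {w | ∃ r : ℝ, 0 ≤ r ∧ ∃ x ∈ P, w = (r, r • x)}

/-- The flag of cones `c(P_•)` is simplicial. -/
def PolyFlag.IsSimplicial (F : PolyFlag M) : Prop :=
  ∀ i, ∃ C : PointedCone ℝ (ℝ × NR M),
    C.IsSimplicial ∧ (C : Set (ℝ × NR M)) = coneOver (F.cell i)

/-- The cone `C_{i-1}` of the flag `C_• = c(P_•)`, where `C_{-1} = {0}`. -/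
def PolyFlag.prevCone (F : PolyFlag M) : Fin (F.length + 1) → Set (ℝ × NR M) :=
  Fin.cons {0} fun j : Fin F.length => coneOver (F.cell j.castSucc)

/-- A choice of points `w_i ∈ C_i \ C_{i-1}`, where `C_• = c(P_•)`. -/
def PolyFlag.IsAdapted (F : PolyFlag M) (w : Fin (F.length + 1) → ℝ × NR M) : Prop :=
  ∀ i, w i ∈ coneOver (F.cell i) \ F.prevCone i

/-- The value `Φ(f)` of a polynomial `f`, for the matrix with rows `w_0, …, w_{m-1}`: the
lexicographic maximum over the terms `aχ^u` of `f` of the vectors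
`(⟨w_0, (log a, u)⟩, …, ⟨w_{m-1}, (log a, u)⟩)`, and `-∞` for `f = 0`. -/
def matrixValue {S : Subsemiring Trop} {m : ℕ} (w : Fin m → ℝ × NR M)
    (f : AddMonoidAlgebra S M) : WithBot (Lex (Fin m → ℝ)) :=
  f.coeff.support.sup fun u =>
    ((toLex fun i => (w i).1 * tlog (f.coeff u : Trop) + (w i).2 u : Lex (Fin m → ℝ)) :
      WithBot (Lex (Fin m → ℝ)))

/-- `P` is the prime congruence `P_w` defined by the matrix with rows `w`. -/
def IsDefinedBy {S : Subsemiring Trop} (P : RingCon (AddMonoidAlgebra S M)) {m : ℕ}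
    (w : Fin m → ℝ × NR M) : Prop :=
  ∀ f g, P f g ↔ matrixValue w f = matrixValue w g

/-- `P` is the prime congruence defined by the flag `F` (for `c(F)` simplicial): it is `P_w` for
any choice of adapted points. -/
def IsPrimeOfFlag {S : Subsemiring Trop} (F : PolyFlag M)
    (P : RingCon (AddMonoidAlgebra S M)) : Prop :=
  (∃ w, F.IsAdapted w) ∧ ∀ w, F.IsAdapted w → IsDefinedBy P w

/-! ### Lattices of sets and filters -/

/-- The lattice of `Γ`-rational polyhedral sets; join is union and meet is intersection. -/
def polyhedralLattice (Γ : Set ℝ) (M : Type*) [AddCommGroup M] : Sublattice (Set (NR M)) where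
  carrier := {U | IsRatPolyhedralSet Γ U}
  supClosed' := by
    rintro _ ⟨C, hC, hC', rfl⟩ _ ⟨D, hD, hD', rfl⟩
    exact ⟨C ∪ D, hC.union hD, fun Q hQ => hQ.elim (hC' Q) (hD' Q), (Set.sUnion_union C D).symm⟩
  infClosed' := by
    classical
    rintro _ ⟨C, hC, hC', rfl⟩ _ ⟨D, hD, hD', rfl⟩
    refine ⟨Set.image2 (· ∩ ·) C D, hC.image2 _ hD, ?_, ?_⟩
    · rintro _ ⟨Q, hQ, R, hR, rfl⟩
      obtain ⟨I, hI, rfl⟩ := hC' Q hQ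
      obtain ⟨J, hJ, rfl⟩ := hD' R hR
      refine ⟨I ∪ J, fun p hp => (Finset.mem_union.1 hp).elim (hI p) (hJ p), ?_⟩
      ext x
      simp only [Set.mem_inter_iff, Set.mem_ofPred_eq, Finset.mem_union]
      exact ⟨fun h p hp => hp.elim (h.1 p) (h.2 p),
        fun h => ⟨fun p hp => h p (Or.inl hp), fun p hp => h p (Or.inr hp)⟩⟩
    · ext x
      simp only [Set.inf_eq_inter, Set.mem_inter_iff, Set.mem_sUnion, Set.mem_image2]
      constructor
      · rintro ⟨⟨Q, hQ, hx⟩, ⟨R, hR, hx'⟩⟩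
        exact ⟨_, ⟨Q, hQ, R, hR, rfl⟩, hx, hx'⟩
      · rintro ⟨_, ⟨Q, hQ, R, hR, rfl⟩, hx, hx'⟩
        exact ⟨⟨Q, hQ, hx⟩, ⟨R, hR, hx'⟩⟩

/-- The lattice of `Γ`-rational polytopal sets; join is union and meet is intersection. -/
def polytopalLattice (Γ : Set ℝ) (M : Type*) [AddCommGroup M] : Sublattice (Set (NR M)) where
  carrier := {U | IsRatPolytopalSet Γ U}
  supClosed' := by
    rintro _ ⟨C, hC, hC', rfl⟩ _ ⟨D, hD, hD', rfl⟩
    exact ⟨C ∪ D, hC.union hD, fun Q hQ => hQ.elim (hC' Q) (hD' Q), (Set.sUnion_union C D).symm⟩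
  infClosed' := by
    classical
    rintro _ ⟨C, hC, hC', rfl⟩ _ ⟨D, hD, hD', rfl⟩
    refine ⟨Set.image2 (· ∩ ·) C D, hC.image2 _ hD, ?_, ?_⟩
    · rintro _ ⟨Q, hQ, R, hR, rfl⟩
      obtain ⟨⟨I, hI, rfl⟩, hb⟩ := hC' Q hQ
      obtain ⟨⟨J, hJ, rfl⟩, -⟩ := hD' R hR
      refine ⟨⟨I ∪ J, fun p hp => (Finset.mem_union.1 hp).elim (hI p) (hJ p), ?_⟩, fun u => ?_⟩
      · ext x
        simp only [Set.mem_inter_iff, Set.mem_ofPred_eq, Finset.mem_union]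
        exact ⟨fun h p hp => hp.elim (h.1 p) (h.2 p),
          fun h => ⟨fun p hp => h p (Or.inl hp), fun p hp => h p (Or.inr hp)⟩⟩
      · obtain ⟨B, hB⟩ := hb u
        exact ⟨B, fun x hx => hB x hx.1⟩
    · ext x
      simp only [Set.inf_eq_inter, Set.mem_inter_iff, Set.mem_sUnion, Set.mem_image2]
      constructor
      · rintro ⟨⟨Q, hQ, hx⟩, ⟨R, hR, hx'⟩⟩
        exact ⟨_, ⟨Q, hQ, R, hR, rfl⟩, hx, hx'⟩
      · rintro ⟨_, ⟨Q, hQ, R, hR, rfl⟩, hx, hx'⟩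
        exact ⟨⟨Q, hQ, hx⟩, ⟨R, hR, hx'⟩⟩

/-- Prime filters on the lattice of `Γ`-rational polyhedral sets that contain a polytope. -/
abbrev PolyhedralPrimeFilter (Γ : Set ℝ) (M : Type*) [AddCommGroup M] : Type _ :=
  {F : Order.PFilter (polyhedralLattice Γ M) //
    F.IsPrime ∧ ∃ U ∈ F, IsPolytope (U : Set (NR M))}

/-- Prime filters on the lattice of `Γ`-rational polytopal sets. -/
abbrev PolytopalPrimeFilter (Γ : Set ℝ) (M : Type*) [AddCommGroup M] : Type _ :=
  {F : Order.PFilter (polytopalLattice Γ M) // F.IsPrime}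

/-- The value `f(x) = max_u (log f_u + ⟨x, u⟩)` of a polynomial at `x ∈ N_ℝ`, as an element of the
tropical semifield. -/
def evalAt {S : Subsemiring Trop} (f : AddMonoidAlgebra S M) (x : NR M) : Trop :=
  f.coeff.sum fun u a => (a : Trop) * texp (x u)

/-- The rational set `R(f_0, f_1, …, f_n)`, where `fs = {f_1, …, f_n}`. -/
def ratSet {S : Subsemiring Trop} (f₀ : AddMonoidAlgebra S M)
    (fs : Finset (AddMonoidAlgebra S M)) : Set (NR M) :=
  {x | ∀ f ∈ fs, CanLE (evalAt f x) (evalAt f₀ x)}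

/-- The collection `F_P` of the `Γ`-rational polyhedral sets `U` that contain some
`R(f_0, …, f_n)` with `|f_i|_P ≤ |f_0|_P` for `1 ≤ i ≤ n`. -/
def filterOfPrime {S : Subsemiring Trop} (P : RingCon (AddMonoidAlgebra S M)) :
    Set (polyhedralLattice (valueGroup S) M) :=
  {U | ∃ (f₀ : AddMonoidAlgebra S M) (fs : Finset (AddMonoidAlgebra S M)),
    (∀ f ∈ fs, PLE P f f₀) ∧ ratSet f₀ fs ⊆ (U : Set (NR M))}

/-! ### Chan–Maclagan preorders -/

/-- A relation on the terms `t^γ χ^u` (`γ ∈ Γ`, `u ∈ M`) is a Chan–Maclagan preorder if there are a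
weight vector `ξ ∈ N_ℝ` and a term preorder on `M` (a translation invariant total preorder) such
that terms are compared by their weights `γ + ⟨ξ, u⟩` first, ties being broken by the term
preorder. -/
def IsChanMaclagan {Γ : Set ℝ} (r : Γ × M → Γ × M → Prop) : Prop :=
  ∃ (ξ : NR M) (le : M → M → Prop),
    (∀ u v, le u v ∨ le v u) ∧ (∀ u v w, le u v → le v w → le u w) ∧
    (∀ u v w, le u v → le (u + w) (v + w)) ∧
    ∀ a b : Γ × M, r a b ↔
      ((a.1 : ℝ) + ξ a.2 < b.1 + ξ b.2 ∨ ((a.1 : ℝ) + ξ a.2 = b.1 + ξ b.2 ∧ le a.2 b.2))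

/-- The term `t^γ χ^u` of `S[M]`. -/
def termOf {S : Subsemiring Trop} (a : valueGroup S × M) : AddMonoidAlgebra S M :=
  AddMonoidAlgebra.single a.2 (⟨texp a.1, a.1.2⟩ : S)

end TropCont

end

open TropCont

/-!
All the sets in question are in bijection with the set of *term cones* (`IsTermCone`): sets `N` of
terms `t^γ χ^u`, encoded as pairs `(γ, u) ∈ Γ × M ⊆ ℝ × M`, that are the nonpositive cone of a
translation-invariant total preorder on `Γ × M` which restricts to the usual order of `Γ` and in
which every term is bounded by a constant.

Term cones are lexicographic (`IsTermCone.eq_lexCone`): there are `ξ₀ ∈ N_ℝ` and linearly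
independent `ξ₁, …, ξ_k ∈ N_ℝ` such that a term `(γ, u)` lies in `N` iff the vector
`(γ + ξ₀ u, ξ₁ u, …, ξ_k u)` is lexicographically nonpositive. The weight `ξ₀` exists because a
totally preordered group with an order unit has a monotone functional
(`exists_functional_of_orderUnit`), and the preorder on the terms of weight zero is treated by
induction on the rank (`exists_lex_functionals`). Replacing the lexicographic comparison by the
value of `ξ₀ + ε ξ₁ + ε² ξ₂ + ⋯` for small `ε > 0`, one finds a single point of `N_ℝ` at which
finitely many given terms compare with `1` as they do in `N` (`IsTermCone.exists_point`).

* A prime `P` on `S[M]` compares polynomials through their terms (`IsPrimeCon.ple_iff`), so it is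
  determined by the terms that are `≤ 1` modulo `P`. Continuity of `S[M] → κ(P)` says that every
  term strictly bounds all small constants, which is what makes these terms a term cone. Conversely,
  a lexicographic description of a term cone gives a homomorphism from `S[M]` to the tropical
  semifield of a lexicographically ordered `ℝᵐ`, whose kernel is the prime (`contSpecEquivCone`).
* A Chan–Maclagan preorder is determined by the terms `≤ 1` (`preorderEquivCone`).
* A prime filter is determined by the half-spaces `{x | γ + ⟨x, u⟩ ≤ 0}` in it, since a polyhedral
  set is a finite union of finite intersections of half-spaces; that each term cone gives a prime
  filter follows from `IsTermCone.exists_point` (`filterEquivCone`). Passing to polytopal members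
  loses nothing, because a filter that contains a polytope is the upward closure of its polytopal
  members (`polyhedralFilterEquivPolytopal`).
* A flag gives the lexicographic cone of any adapted points `w_i ∈ c(P_i) \ c(P_{i-1})`. This is
  independent of the choice, as two choices differ by a triangular matrix with positive diagonal
  (`PolyFlag.IsAdapted.exists_eq_smul_add`). A polyhedron cut out by terms is a neighbourhood of the
  flag iff all these terms belong to the cone (`isRatNhd_iff`), so locally equivalent flags are
  those with the same cone. Every term cone occurs, already for the flag of the orthants at `ξ₀`
  spanned by `ξ₁, …, ξ_i`, whose cones are simplicial (`exists_isSimplicial_flagCone_eq`, `flagEquivCone`).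
-/

open TropCont
namespace TropCont
open Filter Topology

/-! ### Lexicographic order on real vectors -/

/-- A real vector is lexicographically nonpositive if its first nonzero entry, if any, is
negative. -/
def LexNonpos {m : ℕ} (v : Fin m → ℝ) : Prop := ∀ i, (∀ j < i, v j = 0) → v i ≤ 0

theorem toLex_le_toLex_iff_lexNonpos {m : ℕ} (v w : Fin m → ℝ) :
    (toLex v : Lex (Fin m → ℝ)) ≤ toLex w ↔ LexNonpos (v - w) := by
  constructor
  · intro h i hi
    have := Pi.apply_le_of_toLex h (i := i) fun j hj => sub_eq_zero.1 (hi j hj)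
    exact sub_nonpos.2 this
  · intro h
    by_contra hlt
    rw [not_le] at hlt
    obtain ⟨i, hi, hi'⟩ := hlt
    have := h i fun j hj => sub_eq_zero.2 (hi j hj).symm
    exact absurd hi' (not_lt.2 (sub_nonpos.1 this))

theorem LexNonpos.total {m : ℕ} (v : Fin m → ℝ) : LexNonpos v ∨ LexNonpos (-v) := by
  rcases le_total (toLex v : Lex (Fin m → ℝ)) (toLex 0) with h | h
  · left; simpa using (toLex_le_toLex_iff_lexNonpos _ _).1 h
  · right; simpa using (toLex_le_toLex_iff_lexNonpos _ _).1 h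

theorem LexNonpos.add {m : ℕ} {v w : Fin m → ℝ} (hv : LexNonpos v) (hw : LexNonpos w) :
    LexNonpos (v + w) := by
  have h1 : (toLex v : Lex (Fin m → ℝ)) ≤ toLex 0 :=
    (toLex_le_toLex_iff_lexNonpos _ _).2 (by simpa using hv)
  have h2 : (toLex 0 : Lex (Fin m → ℝ)) ≤ toLex (-w) :=
    (toLex_le_toLex_iff_lexNonpos _ _).2 (by simpa using hw)
  simpa using (toLex_le_toLex_iff_lexNonpos _ _).1 (h1.trans h2)

theorem LexNonpos.zero {m : ℕ} : LexNonpos (0 : Fin m → ℝ) := fun _ _ => le_rfl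

theorem LexNonpos.eq_zero {m : ℕ} {v : Fin m → ℝ} (h : LexNonpos v) (h' : LexNonpos (-v)) :
    v = 0 := by
  have h1 : (toLex v : Lex (Fin m → ℝ)) ≤ toLex 0 :=
    (toLex_le_toLex_iff_lexNonpos _ _).2 (by simpa using h)
  have h2 : (toLex 0 : Lex (Fin m → ℝ)) ≤ toLex v :=
    (toLex_le_toLex_iff_lexNonpos _ _).2 (by simpa using h')
  exact toLex.injective (le_antisymm h1 h2)

theorem lexNonpos_cons {m : ℕ} (a : ℝ) (v : Fin m → ℝ) :
    LexNonpos (Fin.cons a v : Fin (m + 1) → ℝ) ↔ a < 0 ∨ a = 0 ∧ LexNonpos v := by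
  constructor
  · intro h
    have h0 : a ≤ 0 := h 0 (fun j hj => absurd hj (Fin.not_lt_zero j))
    rcases h0.lt_or_eq with h0 | h0
    · exact Or.inl h0
    · refine Or.inr ⟨h0, fun i hi => h i.succ fun j hj => ?_⟩
      induction j using Fin.cases with
      | zero => exact h0
      | succ j => exact hi j (Fin.succ_lt_succ_iff.1 hj)
  · rintro (h | ⟨rfl, h⟩) i hi
    · induction i using Fin.cases with
      | zero => exact h.le
      | succ i => exact absurd (hi 0 (Fin.succ_pos i)) h.ne
    · induction i using Fin.cases with
      | zero => exact le_rfl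
      | succ i => exact h i fun j hj => hi j.succ (Fin.succ_lt_succ_iff.2 hj)

/-- If the first nonzero entry of `v` is negative, then the polynomial with coefficients `v` is
negative at all small positive reals. -/
theorem eventually_sum_pow_neg {m : ℕ} {v : Fin m → ℝ} (h : ¬ LexNonpos (-v)) :
    ∀ᶠ ε : ℝ in 𝓝[>] 0, ∑ i : Fin m, ε ^ (i : ℕ) * v i < 0 := by
  induction m with
  | zero => exact absurd (fun i => i.elim0) h
  | succ m ih =>
    obtain ⟨a, v, rfl⟩ : ∃ a w, v = Fin.cons a w := ⟨v 0, Fin.tail v, (Fin.cons_self_tail v).symm⟩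
    have hneg : (-(Fin.cons a v : Fin (m + 1) → ℝ)) = Fin.cons (-a) (-v) := by
      ext i; induction i using Fin.cases <;> simp
    rw [hneg, lexNonpos_cons] at h
    push Not at h
    have hsum : ∀ ε : ℝ, ∑ i : Fin (m + 1), ε ^ (i : ℕ) * (Fin.cons a v : Fin (m + 1) → ℝ) i =
        a + ε * ∑ i : Fin m, ε ^ (i : ℕ) * v i := by
      intro ε
      rw [Fin.sum_univ_succ, Finset.mul_sum]
      simp [pow_succ', mul_assoc]
    simp only [hsum]
    rcases (by linarith [h.1] : a ≤ 0).lt_or_eq with ha | rfl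
    · have : Tendsto (fun ε : ℝ => a + ε * ∑ i : Fin m, ε ^ (i : ℕ) * v i) (𝓝 0) (𝓝 a) := by
        have : Continuous (fun ε : ℝ => a + ε * ∑ i : Fin m, ε ^ (i : ℕ) * v i) := by fun_prop
        simpa using this.tendsto 0
      exact (this.eventually_lt_const ha).filter_mono nhdsWithin_le_nhds
    · filter_upwards [ih (h.2 (by simp)), self_mem_nhdsWithin] with ε hε h0
      simpa using mul_neg_of_pos_of_neg h0 hε

/-- At small positive reals, the sign of the polynomial with coefficients `v` is the lexicographic
sign of `v`. -/
theorem eventually_sum_pow_nonpos_iff {m : ℕ} (v : Fin m → ℝ) :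
    ∀ᶠ ε : ℝ in 𝓝[>] 0, (∑ i : Fin m, ε ^ (i : ℕ) * v i ≤ 0 ↔ LexNonpos v) := by
  by_cases h : LexNonpos v
  · by_cases h' : LexNonpos (-v)
    · exact .of_forall fun ε => by simp [h.eq_zero h', LexNonpos.zero]
    · filter_upwards [eventually_sum_pow_neg h'] with ε hε
      simp [h, hε.le]
  · have := eventually_sum_pow_neg (v := -v) (by simpa using h)
    filter_upwards [this] with ε hε
    simp only [Pi.neg_apply, mul_neg, Finset.sum_neg_distrib, neg_lt_zero] at hε
    simp [h, hε]

/-! ### Additive functionals on preordered groups -/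

section Functional
variable {G : Type*} [AddCommGroup G] {N : Set G}

theorem nsmul_mem_of_add_mem (hadd : ∀ a ∈ N, ∀ b ∈ N, a + b ∈ N) (h0 : 0 ∈ N) {a : G}
    (ha : a ∈ N) (n : ℕ) : n • a ∈ N := by
  induction n with
  | zero => simpa using h0
  | succ n ih => rw [succ_nsmul]; exact hadd _ ih _ ha

/-- A group with a total preorder and an order unit `e > 0` has a monotone additive functional
with value `1` at `e`. Here `N` is the set of elements `≤ 0`. The functional sends `a` to the limit
of `f (n • a) / n`, where `f a` is the least integer `p` with `a ≤ p • e`: this `f` is subadditive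
and differs from an additive function by a bounded amount. -/
theorem exists_functional_of_orderUnit (hadd : ∀ a ∈ N, ∀ b ∈ N, a + b ∈ N)
    (htot : ∀ a, a ∈ N ∨ -a ∈ N) {e : G} (he : e ∉ N) (hunit : ∀ a, ∃ m : ℕ, a - m • e ∈ N) :
    ∃ φ : G →+ ℝ, φ e = 1 ∧ ∀ a ∈ N, φ a ≤ 0 := by
  have h0 : (0 : G) ∈ N := by simpa using htot 0
  have hne : -e ∈ N := (htot e).resolve_left he
  have hz : ∀ p : ℤ, p • e ∈ N ↔ p ≤ 0 := by
    intro p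
    constructor
    · intro hp
      by_contra hlt
      obtain ⟨k, rfl⟩ : ∃ k : ℕ, p = k + 1 := ⟨(p - 1).toNat, by omega⟩
      apply he
      have := hadd _ hp _ (nsmul_mem_of_add_mem hadd h0 hne k)
      convert this using 1
      rw [add_smul, natCast_zsmul]; simp
    · intro hp
      obtain ⟨k, rfl⟩ : ∃ k : ℕ, p = -k := ⟨(-p).toNat, by omega⟩
      simpa using nsmul_mem_of_add_mem hadd h0 hne k
  have hleast : ∀ a, ∃ p : ℤ, ∀ q : ℤ, a - q • e ∈ N ↔ p ≤ q := by
    intro a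
    obtain ⟨m, hm⟩ := hunit a
    obtain ⟨m', hm'⟩ := hunit (-a)
    obtain ⟨p, hp, hp'⟩ := Int.exists_least_of_bdd (P := fun q : ℤ => a - q • e ∈ N)
      ⟨-m', fun q hq => by
        have := hadd _ hq _ hm'
        have h2 : a - q • e + (-a - m' • e) = (-q - m' : ℤ) • e := by
          rw [sub_smul, neg_smul, natCast_zsmul]; abel
        rw [h2, hz] at this
        linarith⟩ ⟨m, by simpa using hm⟩
    refine ⟨p, fun q => ⟨hp' q, fun hq => ?_⟩⟩
    have := hadd _ hp _ ((hz (p - q)).2 (by omega))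
    rw [sub_smul] at this
    simpa using this
  choose f hf using hleast
  have hfa : ∀ a, a - f a • e ∈ N := fun a => (hf a _).2 le_rfl
  have hsub : ∀ a b, f (a + b) ≤ f a + f b := fun a b => by
    rw [← hf]
    have := hadd _ (hfa a) _ (hfa b)
    convert this using 1
    rw [add_smul]; abel
  have hsup : ∀ a b, f a + f b - 1 ≤ f (a + b) := by
    intro a b
    by_contra hlt
    have h1 : a - (f a - 1) • e ∉ N := by rw [hf]; omega
    have h2 : b - (f b - 1) • e ∉ N := by rw [hf]; omega
    have h3 : a + b - (f a + f b - 2) • e ∈ N := by rw [hf]; omega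
    have h4 := (htot _).resolve_left h1
    apply h2
    have := hadd _ h3 _ h4
    convert this using 1
    simp only [sub_smul, add_smul]
    rw [show (2 : ℤ) • e = (1 : ℤ) • e + (1 : ℤ) • e by rw [← add_smul]; norm_num]
    abel
  have hfe : ∀ n : ℕ, f (n • e) = n := by
    intro n
    have key : ∀ q, f (n • e) ≤ q ↔ (n : ℤ) ≤ q := by
      intro q
      rw [← hf, ← natCast_zsmul, ← sub_smul, hz]
      omega
    exact le_antisymm ((key _).2 le_rfl) ((key _).1 le_rfl)
  have hSub : ∀ a, Subadditive fun n : ℕ => (f (n • a) : ℝ) := fun a m n => by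
    beta_reduce
    rw [add_smul]; exact_mod_cast hsub _ _
  have hlow : ∀ a, ∀ n : ℕ, (n : ℤ) * (-f (-a)) ≤ f (n • a) := by
    intro a n
    have h1 : f (n • (-a)) ≤ n * f (-a) := by
      rw [← hf]
      have := nsmul_mem_of_add_mem hadd h0 (hfa (-a)) n
      convert this using 1
      rw [smul_sub, mul_smul, natCast_zsmul]
    have h2 := hsub (n • a) (n • (-a))
    have h3 : f (n • a + n • (-a)) = 0 := by simpa using hfe 0
    rw [h3] at h2
    linarith
  have hlim : ∀ a, Tendsto (fun n : ℕ => (f (n • a) : ℝ) / n) atTop (𝓝 (hSub a).lim) := by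
    intro a
    refine (hSub a).tendsto_lim ⟨min 0 (-f (-a) : ℝ), ?_⟩
    rintro _ ⟨n, rfl⟩
    rcases Nat.eq_zero_or_pos n with rfl | hn
    · simp
    · refine (min_le_right _ _).trans ?_
      have hn' : (0 : ℝ) < n := by exact_mod_cast hn
      show (-f (-a) : ℝ) ≤ (f (n • a) : ℝ) / n
      rw [le_div_iff₀ hn']
      have : (((n : ℤ) * (-f (-a)) : ℤ) : ℝ) ≤ f (n • a) := by exact_mod_cast hlow a n
      push_cast at this
      linarith
  refine ⟨AddMonoidHom.mk' (fun a => (hSub a).lim) fun a b => ?_, ?_, ?_⟩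
  · refine tendsto_nhds_unique (hlim (a + b)) ?_
    have h1 := (hlim a).add (hlim b)
    have h2 : Tendsto (fun n : ℕ =>
        (f (n • (a + b)) : ℝ) / n - ((f (n • a) : ℝ) / n + (f (n • b) : ℝ) / n)) atTop (𝓝 0) := by
      refine squeeze_zero_norm (fun n => ?_) tendsto_one_div_atTop_nhds_zero_nat
      rw [← add_div, ← sub_div, norm_div, Real.norm_natCast]
      gcongr
      have e1 : (f (n • (a + b)) : ℝ) ≤ f (n • a) + f (n • b) := by
        rw [smul_add]; exact_mod_cast hsub _ _
      have e2 : (f (n • a) : ℝ) + f (n • b) - 1 ≤ f (n • (a + b)) := by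
        rw [smul_add]; exact_mod_cast hsup _ _
      rw [Real.norm_eq_abs, abs_le]
      constructor <;> linarith
    simpa using h2.add h1
  · refine tendsto_nhds_unique (hlim e) ?_
    refine tendsto_const_nhds.congr' ?_
    filter_upwards [eventually_gt_atTop 0] with n hn
    rw [hfe]
    have : (n : ℝ) ≠ 0 := by positivity
    simp [this]
  · intro a ha
    refine le_of_tendsto' (hlim a) fun n => ?_
    refine div_nonpos_of_nonpos_of_nonneg ?_ (Nat.cast_nonneg n)
    have : f (n • a) ≤ 0 := by
      rw [← hf]; simpa using nsmul_mem_of_add_mem hadd h0 ha n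
    exact_mod_cast this

end Functional

/-- `ℝ` is divisible, so additive maps to `ℝ` extend from subgroups. -/
theorem exists_extend_real {M : Type*} [AddCommGroup M] (A : AddSubgroup M) (φ : A →+ ℝ) :
    ∃ ψ : M →+ ℝ, ∀ a : A, ψ a = φ a := by
  obtain ⟨ψ, hψ⟩ := (Module.Baer.of_divisible ℝ).extension_property_addMonoidHom A.subtype
    A.subtype_injective φ
  exact ⟨ψ, fun a => DFunLike.congr_fun hψ a⟩

section Robbiano
variable {M : Type*} [AddCommGroup M]

/-- A finitely generated group with a nontrivial total preorder has an order unit. -/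
theorem exists_orderUnit {A : AddSubgroup M} (hA : A.FG) {N : Set M}
    (hadd : ∀ a ∈ N, ∀ b ∈ N, a + b ∈ N) (htot : ∀ a ∈ A, a ∈ N ∨ -a ∈ N) {e₀ : M}
    (he₀ : e₀ ∈ A) (he₀N : e₀ ∉ N) :
    ∃ e ∈ A, e ∉ N ∧ ∀ a ∈ A, ∃ m : ℕ, a - m • e ∈ N := by
  classical
  have h0 : (0 : M) ∈ N := by simpa using htot 0 A.zero_mem
  have key : ∀ T : Finset M, (∀ t ∈ T, t ∈ A) →
      ∃ e ∈ A, e ∉ N ∧ ∀ t ∈ T, t - e ∈ N := by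
    intro T
    induction T using Finset.induction_on with
    | empty => exact fun _ => ⟨e₀, he₀, he₀N, by simp⟩
    | insert s T _ ih =>
      intro hT
      obtain ⟨e, heA, heN, he⟩ := ih fun t ht => hT t (Finset.mem_insert_of_mem ht)
      have hs := hT s (Finset.mem_insert_self _ _)
      by_cases hse : s - e ∈ N
      · refine ⟨e, heA, heN, fun t ht => ?_⟩
        rcases Finset.mem_insert.1 ht with rfl | ht
        exacts [hse, he t ht]
      · have h2 : e - s ∈ N := by
          simpa using (htot _ (A.sub_mem hs heA)).resolve_left hse
        refine ⟨s, hs, fun hsN => heN (by simpa using hadd _ h2 _ hsN), fun t ht => ?_⟩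
        rcases Finset.mem_insert.1 ht with rfl | ht
        · simpa using h0
        · simpa using hadd _ (he t ht) _ h2
  obtain ⟨S, hS⟩ := hA
  have hSA : ∀ s ∈ S, s ∈ A := fun s hs => hS ▸ AddSubgroup.subset_closure hs
  obtain ⟨e, heA, heN, he⟩ := key (S ∪ S.image Neg.neg) (by
    intro t ht
    rcases Finset.mem_union.1 ht with ht | ht
    · exact hSA t ht
    · obtain ⟨s, hs, rfl⟩ := Finset.mem_image.1 ht
      exact A.neg_mem (hSA s hs))
  refine ⟨e, heA, heN, fun a ha => ?_⟩
  suffices h : ∃ m : ℕ, a - m • e ∈ N ∧ -a - m • e ∈ N from ⟨h.choose, h.choose_spec.1⟩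
  rw [← hS] at ha
  induction ha using AddSubgroup.closure_induction with
  | mem x hx =>
    refine ⟨1, ?_, ?_⟩
    · simpa using he x (Finset.mem_union_left _ hx)
    · simpa using he (-x) (Finset.mem_union_right _ (Finset.mem_image_of_mem _ hx))
  | zero => exact ⟨0, by simpa using h0⟩
  | add x y _ _ hx hy =>
    obtain ⟨m, hm, hm'⟩ := hx
    obtain ⟨k, hk, hk'⟩ := hy
    refine ⟨m + k, ?_, ?_⟩
    · convert hadd _ hm _ hk using 1
      rw [add_smul]; abel
    · convert hadd _ hm' _ hk' using 1
      rw [add_smul]; abel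
  | neg x _ hx =>
    obtain ⟨m, hm, hm'⟩ := hx
    exact ⟨m, hm', by simpa using hm⟩

/-- Every total preorder on a subgroup `A` of a finitely generated abelian group is lexicographic
for finitely many additive functionals, which can be taken independent on the subgroup. Here `N` is
the set of elements `≤ 0`. By induction on the rank of `A`: the first functional comes from an order
unit, the others from the preorder on the kernel of the first. -/
theorem exists_lex_functionals [Module.Finite ℤ M] (d : ℕ) :
    ∀ A : Submodule ℤ M, Module.finrank ℤ A = d → ∀ N : Set M,
      (∀ a ∈ N, ∀ b ∈ N, a + b ∈ N) → (∀ a ∈ A, a ∈ N ∨ -a ∈ N) →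
      ∃ (k : ℕ) (ξ : Fin k → NR M), (∀ c : Fin k → ℝ, (∀ a ∈ A, ∑ i, c i * ξ i a = 0) → c = 0) ∧
        ∀ a ∈ A, a ∈ N ↔ LexNonpos fun i => ξ i a := by
  induction d using Nat.strong_induction_on with
  | _ d ih =>
  intro A hd N hadd htot
  by_cases hAN : ∀ a ∈ A, a ∈ N
  · exact ⟨0, Fin.elim0, fun c _ => funext fun i => i.elim0,
      fun a ha => ⟨fun _ i => i.elim0, fun _ => hAN a ha⟩⟩
  push Not at hAN
  obtain ⟨e₀, he₀, he₀N⟩ := hAN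
  have hFG : A.toAddSubgroup.FG := (Submodule.fg_iff_addSubgroup_fg A).1 (IsNoetherian.noetherian A)
  obtain ⟨e, heA, heN, hunit⟩ := exists_orderUnit hFG hadd htot he₀ he₀N
  obtain ⟨φ, hφe, hφN⟩ := exists_functional_of_orderUnit (G := A.toAddSubgroup)
    (N := {a | (a : M) ∈ N}) (fun a ha b hb => hadd _ ha _ hb) (fun a => htot _ a.2)
    (e := ⟨e, heA⟩) heN (fun a => hunit _ a.2)
  obtain ⟨ψ, hψ⟩ := exists_extend_real _ φ
  have hψe : ψ e = 1 := by rw [← hφe, ← hψ]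
  have hψN : ∀ a ∈ A, a ∈ N → ψ a ≤ 0 := fun a ha haN => by
    have := hφN ⟨a, ha⟩ haN
    rwa [← hψ] at this
  let g : A →ₗ[ℤ] ℝ := ψ.toIntLinearMap.comp A.subtype
  let A' : Submodule ℤ M := (LinearMap.ker g).map A.subtype
  have hA' : ∀ a, a ∈ A' ↔ a ∈ A ∧ ψ a = 0 := by
    intro a
    simp only [A', g, Submodule.mem_map, LinearMap.mem_ker]
    constructor
    · rintro ⟨b, hb, rfl⟩
      exact ⟨b.2, hb⟩
    · rintro ⟨h1, h2⟩
      exact ⟨⟨a, h1⟩, h2, rfl⟩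
  have hlt : Module.finrank ℤ A' < d := by
    have h1 : Module.finrank ℤ A' = Module.finrank ℤ (LinearMap.ker g) :=
      (Submodule.equivMapOfInjective _ A.subtype_injective _).finrank_eq.symm
    have h2 := Submodule.finrank_quotient_add_finrank (LinearMap.ker g)
    rw [g.quotKerEquivRange.finrank_eq] at h2
    have h3 : 0 < Module.finrank ℤ (LinearMap.range g) := by
      have : Nontrivial (LinearMap.range g) :=
        ⟨⟨⟨g ⟨e, heA⟩, _, rfl⟩, 0, fun h => by
          have h' : ψ e = 0 := congrArg Subtype.val h
          rw [hψe] at h'; exact one_ne_zero h'⟩⟩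
      exact Module.finrank_pos
    omega
  obtain ⟨k, ξ, hind, hlex⟩ := ih _ hlt A' rfl N hadd fun a ha => htot a ((hA' a).1 ha).1
  refine ⟨k + 1, Fin.cons ψ ξ, fun c hc => ?_, fun a ha => ?_⟩
  · have hc' : ∀ a ∈ A, c 0 * ψ a + ∑ i : Fin k, c i.succ * ξ i a = 0 := fun a ha => by
      simpa [Fin.sum_univ_succ] using hc a ha
    have h1 : (fun i => c (Fin.succ i)) = 0 := hind _ fun a ha => by
      simpa [((hA' a).1 ha).2] using hc' a ((hA' a).1 ha).1
    have h2 : c 0 = 0 := by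
      have := hc' e heA
      simpa [hψe, fun i => congrFun h1 i] using this
    ext i
    induction i using Fin.cases with
    | zero => exact h2
    | succ i => exact congrFun h1 i
  · have heq : (fun i => (Fin.cons ψ ξ : Fin (k + 1) → NR M) i a) =
        Fin.cons (ψ a) fun i => ξ i a := by
      ext i; induction i using Fin.cases <;> simp
    rw [heq, lexNonpos_cons]
    constructor
    · intro haN
      rcases (hψN a ha haN).lt_or_eq with h | h
      · exact Or.inl h
      · exact Or.inr ⟨h, (hlex a ((hA' a).2 ⟨ha, h⟩)).1 haN⟩
    · rintro (h | ⟨h, h'⟩)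
      · refine (htot a ha).resolve_right fun hn => ?_
        have := hψN _ (A.neg_mem ha) hn
        rw [map_neg] at this
        linarith
      · exact (hlex a ((hA' a).2 ⟨ha, h⟩)).2 h'

end Robbiano

/-! ### Term cones -/

section TermCone
variable {M : Type*} [AddCommGroup M]

/-- A term cone is the set of terms `t^γ χ^u`, written as pairs `(γ, u)` with `γ ∈ Γ`, that are
`≤ 1` for some total preorder which is compatible with products, restricts to the usual order on
the `t^γ`, and in which every term is bounded by some constant term. -/
structure IsTermCone (Γ : AddSubgroup ℝ) (N : Set (ℝ × M)) : Prop where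
  fst_mem : ∀ a ∈ N, a.1 ∈ Γ
  add_mem : ∀ a ∈ N, ∀ b ∈ N, a + b ∈ N
  total : ∀ a : ℝ × M, a.1 ∈ Γ → a ∈ N ∨ -a ∈ N
  const_mem_iff : ∀ γ ∈ Γ, (γ, (0 : M)) ∈ N ↔ γ ≤ 0
  exists_mem : ∀ u : M, ∃ γ ∈ Γ, (γ, u) ∈ N

/-- The vector of values `r_i γ + ⟨ξ_i, u⟩` of a term `t^γ χ^u` at the rows `w_i = (r_i, ξ_i)`. -/
def rowValue {m : ℕ} (w : Fin m → ℝ × NR M) (a : ℝ × M) : Fin m → ℝ :=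
  fun i => (w i).1 * a.1 + (w i).2 a.2

theorem rowValue_add {m : ℕ} (w : Fin m → ℝ × NR M) (a b : ℝ × M) :
    rowValue w (a + b) = rowValue w a + rowValue w b := by
  ext i; simp [rowValue]; ring

theorem rowValue_neg {m : ℕ} (w : Fin m → ℝ × NR M) (a : ℝ × M) :
    rowValue w (-a) = -rowValue w a := by
  ext i; simp [rowValue]; ring

/-- The set of terms whose vector of values at the rows of `w` is lexicographically nonpositive. -/
def lexCone (Γ : AddSubgroup ℝ) {m : ℕ} (w : Fin m → ℝ × NR M) : Set (ℝ × M) :=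
  {a | a.1 ∈ Γ ∧ LexNonpos (rowValue w a)}

/-- The rows `(1, ξ₀), (0, ξ₁), …, (0, ξ_k)`. -/
def weightRows {k : ℕ} (ξ₀ : NR M) (ξ : Fin k → NR M) : Fin (k + 1) → ℝ × NR M :=
  Fin.cons (1, ξ₀) fun i => (0, ξ i)

theorem rowValue_weightRows {k : ℕ} (ξ₀ : NR M) (ξ : Fin k → NR M) (a : ℝ × M) :
    rowValue (weightRows ξ₀ ξ) a = Fin.cons (a.1 + ξ₀ a.2) fun i => ξ i a.2 := by
  ext i; induction i using Fin.cases <;> simp [rowValue, weightRows]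

/-- A nontrivial subgroup of `ℝ` is unbounded below. -/
theorem exists_mem_lt {Γ : AddSubgroup ℝ} (hΓ : ∃ γ ∈ Γ, γ ≠ 0) (B : ℝ) : ∃ γ ∈ Γ, γ < B := by
  obtain ⟨γ, hγ, hne⟩ := hΓ
  obtain ⟨δ, hδ, hneg⟩ : ∃ δ ∈ Γ, 0 < δ := by
    rcases hne.lt_or_gt with h | h
    exacts [⟨-γ, Γ.neg_mem hγ, by linarith⟩, ⟨γ, hγ, h⟩]
  obtain ⟨n, hn⟩ := Archimedean.arch (-B) hneg
  refine ⟨-((n + 1) • δ), Γ.neg_mem (Γ.nsmul_mem hδ _), ?_⟩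
  rw [succ_nsmul]; linarith

theorem isTermCone_lexCone {Γ : AddSubgroup ℝ} (hΓ : ∃ γ ∈ Γ, γ ≠ 0) {k : ℕ}
    {w : Fin (k + 1) → ℝ × NR M} (hw : 0 < (w 0).1) : IsTermCone Γ (lexCone Γ w) where
  fst_mem a ha := ha.1
  add_mem a ha b hb := ⟨Γ.add_mem ha.1 hb.1, by rw [rowValue_add]; exact ha.2.add hb.2⟩
  total a ha := (LexNonpos.total (rowValue w a)).imp (fun h => ⟨ha, h⟩)
    fun h => ⟨Γ.neg_mem ha, by rwa [rowValue_neg]⟩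
  const_mem_iff γ hγ := by
    constructor
    · intro h
      have := h.2 0 fun j hj => absurd hj (Fin.not_lt_zero j)
      simp only [rowValue, map_zero, add_zero] at this
      exact nonpos_of_mul_nonpos_right this hw
    · intro h
      refine ⟨hγ, fun i hi => ?_⟩
      rcases h.lt_or_eq with h | rfl
      · rcases eq_or_ne i 0 with rfl | hi0
        · simpa [rowValue] using mul_nonpos_of_nonneg_of_nonpos hw.le h.le
        · have := hi 0 (Fin.pos_of_ne_zero hi0)
          simp only [rowValue, map_zero, add_zero] at this
          exact absurd this (mul_neg_of_pos_of_neg hw h).ne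
      · simp [rowValue]
  exists_mem u := by
    obtain ⟨γ, hγ, hlt⟩ := exists_mem_lt hΓ (-(w 0).2 u / (w 0).1)
    rw [lt_div_iff₀ hw] at hlt
    refine ⟨γ, hγ, hγ, fun i hi => ?_⟩
    rcases eq_or_ne i 0 with rfl | hi0
    · simp only [rowValue]; linarith
    · have := hi 0 (Fin.pos_of_ne_zero hi0)
      simp only [rowValue] at this
      linarith

/-- The weight vector of a term cone: its terms have weight `γ + ⟨ξ, u⟩ ≤ 0`. -/
theorem IsTermCone.exists_weight {Γ : AddSubgroup ℝ} (hΓ : ∃ γ ∈ Γ, γ ≠ 0) {N : Set (ℝ × M)}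
    (hN : IsTermCone Γ N) : ∃ ξ : NR M, ∀ a ∈ N, a.1 + ξ a.2 ≤ 0 := by
  obtain ⟨g, hg, hpos⟩ : ∃ δ ∈ Γ, 0 < δ := by
    obtain ⟨γ, hγ, hne⟩ := hΓ
    rcases hne.lt_or_gt with h | h
    exacts [⟨-γ, Γ.neg_mem hγ, by linarith⟩, ⟨γ, hγ, h⟩]
  have hunit : ∀ a : Γ × M, ∃ m : ℕ, ((a - m • ((⟨g, hg⟩ : Γ), (0 : M))).1 : ℝ) ∈ Γ ∧
      (((a - m • ((⟨g, hg⟩ : Γ), (0 : M))).1 : ℝ), (a - m • ((⟨g, hg⟩ : Γ), (0 : M))).2) ∈ N := by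
    rintro ⟨a, u⟩
    obtain ⟨γ, hγ, hmem⟩ := hN.exists_mem u
    obtain ⟨m, hm⟩ := Archimedean.arch (a - γ) hpos
    refine ⟨m, Subtype.property _, ?_⟩
    have h1 : ((a : ℝ) - m • g - γ, (0 : M)) ∈ N :=
      (hN.const_mem_iff _ (Γ.sub_mem (Γ.sub_mem a.2 (Γ.nsmul_mem hg _)) hγ)).2 (by linarith)
    have := hN.add_mem _ hmem _ h1
    simpa using this
  obtain ⟨φ, hφe, hφN⟩ := exists_functional_of_orderUnit (G := Γ × M)
    (N := {a | ((a.1 : ℝ), a.2) ∈ N}) (fun a ha b hb => hN.add_mem _ ha _ hb)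
    (fun a => hN.total (a.1, a.2) a.1.2) (e := (⟨g, hg⟩, 0))
    (fun h => by
      have := (hN.const_mem_iff g hg).1 h
      linarith)
    (fun a => (hunit a).imp fun m h => h.2)
  have hle : ∀ γ : Γ, φ (γ, 0) ≤ γ / g := by
    intro γ
    by_contra hlt
    rw [not_le] at hlt
    obtain ⟨q, hq1, hq2⟩ := exists_rat_btwn hlt
    have hd : (0 : ℝ) < q.den := by exact_mod_cast q.den_pos
    rw [Rat.cast_def, div_lt_div_iff₀ hpos hd] at hq1
    rw [Rat.cast_def, div_lt_iff₀ hd] at hq2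
    have h := hφN (q.den • (γ, 0) - q.num • (⟨g, hg⟩, 0)) (by
      have : ((q.den • (γ : ℝ) - q.num • g : ℝ), (0 : M)) ∈ N :=
        (hN.const_mem_iff _ (Γ.sub_mem (Γ.nsmul_mem γ.2 _) (Γ.zsmul_mem hg _))).2 (by
          simp only [nsmul_eq_mul, zsmul_eq_mul]; linarith)
      simpa using this)
    rw [map_sub, map_nsmul, map_zsmul, hφe] at h
    simp only [nsmul_eq_mul, zsmul_eq_mul] at h
    linarith
  have heq : ∀ γ : Γ, φ (γ, 0) = γ / g := by
    intro γ
    refine le_antisymm (hle γ) ?_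
    have := hle (-γ)
    rw [show ((-γ, 0) : Γ × M) = -(γ, 0) by simp, map_neg] at this
    push_cast at this
    rw [neg_div] at this
    linarith
  refine ⟨g • φ.comp (AddMonoidHom.inr Γ M), fun a ha => ?_⟩
  have h := hφN (⟨a.1, hN.fst_mem a ha⟩, a.2) ha
  have hsplit : ((⟨a.1, hN.fst_mem a ha⟩, a.2) : Γ × M) =
      (⟨a.1, hN.fst_mem a ha⟩, 0) + (0, a.2) := by simp
  rw [hsplit, map_add, heq] at h
  have h2 := mul_nonpos_of_nonneg_of_nonpos hpos.le h
  rw [mul_add, mul_div_cancel₀ _ hpos.ne'] at h2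
  simpa using h2

/-- Every term cone is lexicographic: it compares weights for some `ξ₀ ∈ N_ℝ` and breaks ties by
linearly independent functionals on `M`. -/
theorem IsTermCone.eq_lexCone [Module.Finite ℤ M] {Γ : AddSubgroup ℝ} (hΓ : ∃ γ ∈ Γ, γ ≠ 0)
    {N : Set (ℝ × M)} (hN : IsTermCone Γ N) :
    ∃ (k : ℕ) (ξ₀ : NR M) (ξ : Fin k → NR M), LinearIndependent ℝ ξ ∧
      N = lexCone Γ (weightRows ξ₀ ξ) := by
  obtain ⟨ξ₀, hξ₀⟩ := hN.exists_weight hΓ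
  -- the exponents of the terms of weight zero
  let A : Submodule ℤ M := AddSubgroup.toIntSubmodule (Γ.comap ξ₀)
  have hA : ∀ u, u ∈ A ↔ ξ₀ u ∈ Γ := fun u => Iff.rfl
  obtain ⟨k, ξ, hind, hlex⟩ := exists_lex_functionals _ A rfl {u | (-ξ₀ u, u) ∈ N}
    (fun u hu v hv => by
      have := hN.add_mem _ hu _ hv
      simp only [Set.mem_ofPred_eq, map_add]
      convert this using 1
      exact Prod.ext (by simp; ring) rfl)
    (fun u hu => by
      have := hN.total (-ξ₀ u, u) (Γ.neg_mem hu)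
      simpa using this)
  refine ⟨k, ξ₀, ξ, ?_, ?_⟩
  · rw [Fintype.linearIndependent_iff]
    intro c hc
    exact congrFun (hind c fun a _ => by simpa using DFunLike.congr_fun hc a)
  · ext a
    constructor
    · intro ha
      refine ⟨hN.fst_mem a ha, ?_⟩
      rw [rowValue_weightRows, lexNonpos_cons]
      rcases (hξ₀ a ha).lt_or_eq with h | h
      · exact Or.inl h
      · have h1 : a.1 = -ξ₀ a.2 := by linarith
        refine Or.inr ⟨h, (hlex a.2 ?_).1 ?_⟩
        · rw [hA]
          have := Γ.neg_mem (hN.fst_mem a ha)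
          rwa [h1, neg_neg] at this
        · rw [Set.mem_ofPred_eq, ← h1]; exact ha
    · rintro ⟨haΓ, h⟩
      rw [rowValue_weightRows, lexNonpos_cons] at h
      rcases h with h | ⟨h, h'⟩
      · refine (hN.total a haΓ).resolve_right fun hn => ?_
        have := hξ₀ _ hn
        simp only [Prod.fst_neg, Prod.snd_neg, map_neg] at this
        linarith
      · have h1 : a.1 = -ξ₀ a.2 := by linarith
        have h2 : a.2 ∈ A := by
          rw [hA]
          have := Γ.neg_mem haΓ
          rwa [h1, neg_neg] at this
        have h3 : (-ξ₀ a.2, a.2) ∈ N := (hlex a.2 h2).2 h'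
        rw [← h1] at h3
        exact h3

/-- Finitely many terms can be compared with `1` at a single point of `N_ℝ`. -/
theorem IsTermCone.exists_point [Module.Finite ℤ M] {Γ : AddSubgroup ℝ} (hΓ : ∃ γ ∈ Γ, γ ≠ 0)
    {N : Set (ℝ × M)} (hN : IsTermCone Γ N) {I : Set (ℝ × M)} (hI : I.Finite)
    (hIΓ : ∀ a ∈ I, a.1 ∈ Γ) : ∃ x : NR M, ∀ a ∈ I, a.1 + x a.2 ≤ 0 ↔ a ∈ N := by
  obtain ⟨k, ξ₀, ξ, -, rfl⟩ := hN.eq_lexCone hΓ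
  have h := (hI.eventually_all (l := 𝓝[>] (0 : ℝ))).2 fun a _ =>
    eventually_sum_pow_nonpos_iff (rowValue (weightRows ξ₀ ξ) a)
  obtain ⟨ε, hε⟩ := h.exists
  refine ⟨ξ₀ + ∑ i : Fin k, ε ^ ((i : ℕ) + 1) • ξ i, fun a ha => ?_⟩
  have h1 := hε a ha
  rw [rowValue_weightRows, Fin.sum_univ_succ] at h1
  rw [lexCone, Set.mem_ofPred_eq, and_iff_right (hIΓ a ha), rowValue_weightRows, ← h1]
  simp [add_assoc]

end TermCone

/-! ### Chan–Maclagan preorders -/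

section ChanMaclagan
variable {M : Type*} [AddCommGroup M] {Γ : AddSubgroup ℝ}

/-- The terms `≤ 1` of a preorder on terms. The preorder lives on `Γ × M`, the terms on the larger
group `ℝ × M`, where they can be subtracted without subtypes. -/
def coneOfPreorder (Γ : AddSubgroup ℝ)
    (r : Set.Elem (Γ : Set ℝ) × M → Set.Elem (Γ : Set ℝ) × M → Prop) : Set (ℝ × M) :=
  {a | ∃ h : a.1 ∈ Γ, r (⟨a.1, h⟩, a.2) (⟨0, Γ.zero_mem⟩, 0)}

/-- A Chan–Maclagan preorder is invariant under multiplication by terms, so it is determined by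
the terms `≤ 1`. -/
theorem IsChanMaclagan.iff_sub_mem
    {r : Set.Elem (Γ : Set ℝ) × M → Set.Elem (Γ : Set ℝ) × M → Prop}
    (hr : IsChanMaclagan r) (a b : Set.Elem (Γ : Set ℝ) × M) :
    r a b ↔ ((a.1 : ℝ) - b.1, a.2 - b.2) ∈ coneOfPreorder Γ r := by
  obtain ⟨ξ, le, htot, htrans, hadd, hle⟩ := hr
  have hsub : ∀ u v, le u v ↔ le (u - v) 0 := fun u v =>
    ⟨fun h => by simpa [sub_eq_add_neg] using hadd _ _ (-v) h, fun h => by simpa using hadd _ _ v h⟩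
  have hmem : (a.1 : ℝ) - b.1 ∈ Γ := Γ.sub_mem a.1.2 b.1.2
  have : ((a.1 : ℝ) - b.1, a.2 - b.2) ∈ coneOfPreorder Γ r ↔
      r (⟨(a.1 : ℝ) - b.1, hmem⟩, a.2 - b.2) (⟨0, Γ.zero_mem⟩, 0) :=
    ⟨fun ⟨_, h⟩ => h, fun h => ⟨hmem, h⟩⟩
  rw [this, hle, hle, hsub a.2 b.2]
  simp only [map_sub, map_zero, add_zero]
  refine or_congr ?_ (and_congr ?_ Iff.rfl)
  · constructor <;> intro h <;> linarith
  · constructor <;> intro h <;> linarith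

theorem IsChanMaclagan.isTermCone (hΓ : ∃ γ ∈ Γ, γ ≠ 0)
    {r : Set.Elem (Γ : Set ℝ) × M → Set.Elem (Γ : Set ℝ) × M → Prop} (hr : IsChanMaclagan r) :
    IsTermCone Γ (coneOfPreorder Γ r) := by
  obtain ⟨ξ, le, htot, htrans, hadd, hle⟩ := hr
  have hmem : ∀ a : ℝ × M, a ∈ coneOfPreorder Γ r ↔
      a.1 ∈ Γ ∧ (a.1 + ξ a.2 < 0 ∨ a.1 + ξ a.2 = 0 ∧ le a.2 0) := by
    intro a
    simp only [coneOfPreorder, Set.mem_ofPred_eq, hle, map_zero, add_zero]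
    exact ⟨fun ⟨h, h'⟩ => ⟨h, h'⟩, fun ⟨h, h'⟩ => ⟨h, h'⟩⟩
  refine ⟨fun a ha => ((hmem a).1 ha).1, ?_, ?_, ?_, ?_⟩
  · intro a ha b hb
    rw [hmem] at ha hb ⊢
    refine ⟨Γ.add_mem ha.1 hb.1, ?_⟩
    simp only [Prod.fst_add, Prod.snd_add, map_add]
    rcases ha.2 with h | ⟨h, h'⟩ <;> rcases hb.2 with k | ⟨k, k'⟩
    · left; linarith
    · left; linarith
    · left; linarith
    · right
      refine ⟨by linarith, htrans _ (0 + b.2) _ (hadd _ _ _ h') ?_⟩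
      simpa using k'
  · intro a ha
    rw [hmem, hmem]
    simp only [Prod.fst_neg, Prod.snd_neg, map_neg]
    rcases lt_trichotomy (a.1 + ξ a.2) 0 with h | h | h
    · exact Or.inl ⟨ha, Or.inl h⟩
    · rcases htot a.2 0 with h' | h'
      · exact Or.inl ⟨ha, Or.inr ⟨h, h'⟩⟩
      · refine Or.inr ⟨Γ.neg_mem ha, Or.inr ⟨by linarith, ?_⟩⟩
        simpa using hadd _ _ (-a.2) h'
    · exact Or.inr ⟨Γ.neg_mem ha, Or.inl (by linarith)⟩
  · intro γ hγ
    rw [hmem]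
    have : le 0 0 := (htot 0 0).elim id id
    simp [hγ, this, le_iff_lt_or_eq]
  · intro u
    obtain ⟨γ, hγ, hlt⟩ := exists_mem_lt hΓ (-ξ u)
    exact ⟨γ, hγ, (hmem _).2 ⟨hγ, Or.inl (by show γ + ξ u < 0; linarith)⟩⟩

theorem IsTermCone.exists_isChanMaclagan [Module.Finite ℤ M] (hΓ : ∃ γ ∈ Γ, γ ≠ 0)
    {N : Set (ℝ × M)} (hN : IsTermCone Γ N) :
    ∃ r : Set.Elem (Γ : Set ℝ) × M → Set.Elem (Γ : Set ℝ) × M → Prop,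
      IsChanMaclagan r ∧ coneOfPreorder Γ r = N := by
  obtain ⟨k, ξ₀, ξ, -, hlex⟩ := hN.eq_lexCone hΓ
  refine ⟨fun a b => ((a.1 : ℝ) - b.1, a.2 - b.2) ∈ N,
    ⟨ξ₀, fun u v => (toLex (fun i => ξ i u) : Lex (Fin k → ℝ)) ≤ toLex fun i => ξ i v,
      fun u v => le_total _ _, fun u v w => le_trans, fun u v w h => ?_, fun a b => ?_⟩, ?_⟩
  · beta_reduce at h ⊢
    rw [toLex_le_toLex_iff_lexNonpos] at h ⊢
    convert h using 1
    ext i; simp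
  · beta_reduce
    rw [hlex, lexCone, Set.mem_ofPred_eq, and_iff_right (Γ.sub_mem a.1.2 b.1.2),
      rowValue_weightRows, lexNonpos_cons, toLex_le_toLex_iff_lexNonpos]
    simp only [map_sub]
    refine or_congr ?_ (and_congr ?_ Iff.rfl)
    · constructor <;> intro h <;> linarith
    · constructor <;> intro h <;> linarith
  · ext a
    simp only [coneOfPreorder, Set.mem_ofPred_eq, sub_zero, exists_prop]
    exact ⟨fun h => h.2, fun h => ⟨hN.fst_mem a h, h⟩⟩

/-- Chan–Maclagan preorders correspond to term cones. -/
noncomputable def preorderEquivCone [Module.Finite ℤ M] (hΓ : ∃ γ ∈ Γ, γ ≠ 0) :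
    {r : Set.Elem (Γ : Set ℝ) × M → Set.Elem (Γ : Set ℝ) × M → Prop // IsChanMaclagan r} ≃
      {N : Set (ℝ × M) // IsTermCone Γ N} :=
  Equiv.ofBijective (fun r => ⟨coneOfPreorder Γ r.1, r.2.isTermCone hΓ⟩) <| by
    constructor
    · intro r s h
      ext a b
      have h' : coneOfPreorder Γ r.1 = coneOfPreorder Γ s.1 := congrArg Subtype.val h
      rw [r.2.iff_sub_mem, s.2.iff_sub_mem, h']
    · rintro ⟨N, hN⟩
      obtain ⟨r, hr, rfl⟩ := hN.exists_isChanMaclagan hΓ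
      exact ⟨⟨r, hr⟩, rfl⟩

end ChanMaclagan

/-! ### Prime filters of polyhedral and polytopal sets -/

section Filters
variable {M : Type*} [AddCommGroup M] {Γ : AddSubgroup ℝ}

/-- The half-space where the term `t^γ χ^u` is at most `1`. -/
def halfSpace (a : ℝ × M) : Set (NR M) := {x | a.1 + x a.2 ≤ 0}

theorem isRatPolyhedron_iff {Q : Set (NR M)} : IsRatPolyhedron (Γ : Set ℝ) Q ↔
    ∃ I : Set (ℝ × M), I.Finite ∧ (∀ a ∈ I, a.1 ∈ Γ) ∧ Q = ⋂ a ∈ I, halfSpace a := by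
  classical
  constructor
  · rintro ⟨I, hI, rfl⟩
    refine ⟨(fun p : M × ℝ => (-p.2, p.1)) '' I, I.finite_toSet.image _, ?_, ?_⟩
    · rintro _ ⟨p, hp, rfl⟩
      exact Γ.neg_mem (hI p hp)
    · ext x
      rw [Set.biInter_image]
      simp [halfSpace]
  · rintro ⟨I, hI, hIΓ, rfl⟩
    refine ⟨hI.toFinset.image fun a => (a.2, -a.1), ?_, ?_⟩
    · intro p hp
      obtain ⟨a, ha, rfl⟩ := Finset.mem_image.1 hp
      exact Γ.neg_mem (hIΓ a (hI.mem_toFinset.1 ha))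
    · ext x
      simp only [halfSpace, Set.mem_iInter, Set.mem_ofPred_eq, Finset.mem_image,
        Set.Finite.mem_toFinset]
      constructor
      · rintro h _ ⟨a, ha, rfl⟩
        have := h a ha
        simp only; linarith
      · intro h a ha
        have := h _ ⟨a, ha, rfl⟩
        simp only at this; linarith

theorem isRatPolyhedron_halfSpace {a : ℝ × M} (ha : a.1 ∈ Γ) :
    IsRatPolyhedron (Γ : Set ℝ) (halfSpace a) :=
  isRatPolyhedron_iff.2 ⟨{a}, Set.finite_singleton a, by simpa using ha, by simp⟩

theorem IsRatPolyhedron.isRatPolyhedralSet {Q : Set (NR M)} (hQ : IsRatPolyhedron (Γ : Set ℝ) Q) :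
    IsRatPolyhedralSet (Γ : Set ℝ) Q :=
  ⟨{Q}, Set.finite_singleton Q, by simpa using hQ, by simp⟩

theorem IsBoundedSet.mono {P Q : Set (NR M)} (hQ : IsBoundedSet Q) (h : P ⊆ Q) : IsBoundedSet P :=
  fun u => (hQ u).imp fun _ hB x hx => hB x (h hx)

theorem IsRatPolytopalSet.isRatPolyhedralSet {Γ : Set ℝ} {U : Set (NR M)}
    (h : IsRatPolytopalSet Γ U) : IsRatPolyhedralSet Γ U :=
  let ⟨C, hC, hC', h⟩ := h
  ⟨C, hC, fun Q hQ => (hC' Q hQ).1, h⟩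

theorem IsRatPolyhedralSet.isRatPolytopalSet {Γ : Set ℝ} {U : Set (NR M)}
    (h : IsRatPolyhedralSet Γ U) (hb : IsBoundedSet U) : IsRatPolytopalSet Γ U :=
  let ⟨C, hC, hC', h⟩ := h
  ⟨C, hC, fun Q hQ => ⟨hC' Q hQ, hb.mono (h ▸ Set.subset_sUnion_of_mem hQ)⟩, h⟩

theorem IsRatPolytopalSet.isBoundedSet {Γ : Set ℝ} {U : Set (NR M)}
    (h : IsRatPolytopalSet Γ U) : IsBoundedSet U := by
  obtain ⟨C, hC, hC', rfl⟩ := h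
  intro u
  choose! B hB using fun Q hQ => (hC' Q hQ).2 u
  obtain ⟨D, hD⟩ := (hC.image B).bddAbove
  refine ⟨D, ?_⟩
  rintro x ⟨Q, hQ, hx⟩
  exact (hB Q hQ x hx).trans (hD ⟨Q, hQ, rfl⟩)

/-- Evaluation at `u ∈ M`, as a linear functional on `N_ℝ`. -/
def evalLin (u : M) : NR M →ₗ[ℝ] ℝ where
  toFun x := x u
  map_add' _ _ := rfl
  map_smul' _ _ := rfl

theorem IsRatPolyhedron.isPolyhedron {Γ : Set ℝ} {Q : Set (NR M)} (h : IsRatPolyhedron Γ Q) :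
    IsPolyhedron Q := by
  classical
  obtain ⟨I, -, rfl⟩ := h
  refine ⟨I.image fun p => (evalLin p.1, p.2), ?_⟩
  ext x
  simp only [Set.mem_ofPred_eq, Finset.mem_image]
  constructor
  · rintro h _ ⟨p, hp, rfl⟩
    exact h p hp
  · intro h p hp
    exact h _ ⟨p, hp, rfl⟩

/-- A prime filter of a lattice of sets, given by its members as plain sets. -/
structure IsPrimeFamily {X : Type*} (L : Sublattice (Set X)) (F : Set (Set X)) : Prop where
  subset : ∀ U ∈ F, U ∈ L
  nonempty : F.Nonempty
  mono : ∀ U ∈ F, ∀ V ∈ L, U ⊆ V → V ∈ F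
  inter : ∀ U ∈ F, ∀ V ∈ F, U ∩ V ∈ F
  empty : ∅ ∉ F
  union : ∀ U ∈ L, ∀ V ∈ L, U ∪ V ∈ F → U ∈ F ∨ V ∈ F

theorem IsPrimeFamily.exists_mem_of_sUnion {X : Type*} {L : Sublattice (Set X)} {F : Set (Set X)}
    (hF : IsPrimeFamily L F) (h0 : ∅ ∈ L) {C : Set (Set X)} (hC : C.Finite)
    (hCL : ∀ Q ∈ C, Q ∈ L) (h : ⋃₀ C ∈ F) : ∃ Q ∈ C, Q ∈ F := by
  have hL : ⋃₀ C ∈ L ∧ (⋃₀ C ∈ F → ∃ Q ∈ C, Q ∈ F) := by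
    clear h
    induction C, hC using Set.Finite.induction_on with
    | empty => exact ⟨by simpa using h0, fun h => absurd (by simpa using h) hF.empty⟩
    | @insert Q C _ _ ih =>
      have hQ := hCL Q (Set.mem_insert _ _)
      obtain ⟨h1, h2⟩ := ih fun R hR => hCL R (Set.mem_insert_of_mem _ hR)
      rw [Set.sUnion_insert]
      refine ⟨L.supClosed hQ h1, fun h => ?_⟩
      rcases hF.union _ hQ _ h1 h with h | h
      · exact ⟨Q, Set.mem_insert _ _, h⟩
      · obtain ⟨R, hR, hRF⟩ := h2 h
        exact ⟨R, Set.mem_insert_of_mem _ hR, hRF⟩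
  exact hL.2 h

/-- Prime filters of a lattice of sets containing the empty set are the same as families of sets
with the corresponding properties. -/
def primeFilterEquiv {X : Type*} {L : Sublattice (Set X)} (h0 : ∅ ∈ L) :
    {F : Order.PFilter L // F.IsPrime} ≃ {F : Set (Set X) // IsPrimeFamily L F} where
  toFun F := ⟨Subtype.val '' (F.1 : Set L), by
    obtain ⟨F, hF⟩ := F
    constructor
    · rintro _ ⟨U, -, rfl⟩
      exact U.2
    · exact F.nonempty.image _
    · rintro _ ⟨U, hU, rfl⟩ V hV hle
      exact ⟨⟨V, hV⟩, F.mem_of_le (x := U) hle hU, rfl⟩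
    · rintro _ ⟨U, hU, rfl⟩ _ ⟨V, hV, rfl⟩
      exact ⟨U ⊓ V, Order.PFilter.inf_mem hU hV, rfl⟩
    · rintro ⟨U, hU, hU0⟩
      obtain ⟨V, hV⟩ := hF.compl_ideal.Nonempty
      refine hV (F.mem_of_le (x := U) ?_ hU)
      show (U : Set X) ⊆ V
      rw [hU0]
      exact Set.empty_subset _
    · rintro U hU V hV ⟨W, hW, hWU⟩
      by_contra hcon
      rw [not_or] at hcon
      obtain ⟨Z, hZ, h1, h2⟩ := hF.compl_ideal.Directed ⟨U, hU⟩ (fun h => hcon.1 ⟨_, h, rfl⟩)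
        ⟨V, hV⟩ (fun h => hcon.2 ⟨_, h, rfl⟩)
      refine hZ (F.mem_of_le (x := W) ?_ hW)
      show (W : Set X) ⊆ Z
      rw [hWU]
      exact Set.union_subset h1 h2⟩
  invFun F := ⟨(Order.IsPFilter.of_def (F := {U : L | (U : Set X) ∈ F.1})
      (F.2.nonempty.elim fun U hU => ⟨⟨U, F.2.subset U hU⟩, hU⟩)
      (fun U hU V hV => ⟨U ⊓ V, F.2.inter _ hU _ hV, inf_le_left, inf_le_right⟩)
      (fun {U V} hUV hU => F.2.mono _ hU _ V.2 hUV)).toPFilter,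
    ⟨{ IsLowerSet := fun U V hVU hU hV => hU (F.2.mono _ hV _ U.2 hVU)
       Nonempty := ⟨⟨∅, h0⟩, F.2.empty⟩
       Directed := fun U hU V hV => ⟨U ⊔ V, fun h => (F.2.union _ U.2 _ V.2 h).elim hU hV,
        le_sup_left, le_sup_right⟩ }⟩⟩
  left_inv F := by
    apply Subtype.ext
    apply Order.PFilter.ext
    ext U
    constructor
    · rintro ⟨V, hV, hVU⟩
      obtain rfl : V = U := Subtype.ext hVU
      exact hV
    · exact fun h => ⟨U, h, rfl⟩
  right_inv F := by
    apply Subtype.ext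
    ext U
    exact ⟨fun ⟨V, hV, hVU⟩ => hVU ▸ hV, fun h => ⟨⟨U, F.2.subset U h⟩, h, rfl⟩⟩

theorem mem_primeFilterEquiv {X : Type*} {L : Sublattice (Set X)} (h0 : ∅ ∈ L)
    (F : {F : Order.PFilter L // F.IsPrime}) (U : L) :
    (U : Set X) ∈ (primeFilterEquiv h0 F).1 ↔ U ∈ F.1 :=
  ⟨fun ⟨_, hV, hVU⟩ => Subtype.ext hVU ▸ hV, fun h => ⟨U, h, rfl⟩⟩

theorem empty_mem_polyhedralLattice (Γ : Set ℝ) : (∅ : Set (NR M)) ∈ polyhedralLattice Γ M :=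
  ⟨∅, Set.finite_empty, by simp, by simp⟩

theorem empty_mem_polytopalLattice (Γ : Set ℝ) : (∅ : Set (NR M)) ∈ polytopalLattice Γ M :=
  ⟨∅, Set.finite_empty, by simp, by simp⟩

theorem mem_polyhedralLattice_of_polytopal {Γ : Set ℝ} {U : Set (NR M)}
    (h : U ∈ polytopalLattice Γ M) : U ∈ polyhedralLattice Γ M :=
  IsRatPolytopalSet.isRatPolyhedralSet h

theorem mem_polytopalLattice_iff {Γ : Set ℝ} {U : Set (NR M)} :
    U ∈ polytopalLattice Γ M ↔ U ∈ polyhedralLattice Γ M ∧ IsBoundedSet U :=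
  ⟨fun h => ⟨mem_polyhedralLattice_of_polytopal h, IsRatPolytopalSet.isBoundedSet h⟩,
    fun h => IsRatPolyhedralSet.isRatPolytopalSet h.1 h.2⟩

/-- Every prime filter of polytopal sets is the trace of a prime filter of polyhedral sets, namely
of its upward closure. -/
theorem exists_polyhedral_family {Γ : Set ℝ} {G : Set (Set (NR M))}
    (hG : IsPrimeFamily (polytopalLattice Γ M) G) :
    ∃ F : Set (Set (NR M)), (IsPrimeFamily (polyhedralLattice Γ M) F ∧ ∃ U ∈ F, IsPolytope U) ∧
      {U ∈ F | U ∈ polytopalLattice Γ M} = G := by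
  have hbdd : ∀ W ∈ G, ∀ U ∈ polyhedralLattice Γ M, W ∩ U ∈ polytopalLattice Γ M := by
    intro W hW U hU
    have h := mem_polytopalLattice_iff.1 (hG.subset W hW)
    exact mem_polytopalLattice_iff.2 ⟨(polyhedralLattice Γ M).infClosed h.1 hU,
      h.2.mono Set.inter_subset_left⟩
  refine ⟨{U ∈ polyhedralLattice Γ M | ∃ W ∈ G, W ⊆ U}, ⟨⟨?_, ?_, ?_, ?_, ?_, ?_⟩, ?_⟩, ?_⟩
  · exact fun U hU => hU.1
  · obtain ⟨W, hW⟩ := hG.nonempty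
    exact ⟨W, mem_polyhedralLattice_of_polytopal (hG.subset W hW), W, hW, subset_rfl⟩
  · rintro U ⟨-, W, hW, hWU⟩ V hV hUV
    exact ⟨hV, W, hW, hWU.trans hUV⟩
  · rintro U ⟨hU, W, hW, hWU⟩ V ⟨hV, Z, hZ, hZV⟩
    exact ⟨(polyhedralLattice Γ M).infClosed hU hV, W ∩ Z, hG.inter W hW Z hZ,
      Set.inter_subset_inter hWU hZV⟩
  · rintro ⟨-, W, hW, hWU⟩
    rw [Set.subset_empty_iff.1 hWU] at hW
    exact hG.empty hW
  · rintro U hU V hV ⟨-, W, hW, hWU⟩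
    have h : W ∩ U ∪ W ∩ V = W := by
      rw [← Set.inter_union_distrib_left]
      exact Set.inter_eq_left.2 hWU
    rcases hG.union (W ∩ U) (hbdd W hW U hU) (W ∩ V) (hbdd W hW V hV) (h.symm ▸ hW) with h | h
    · exact Or.inl ⟨hU, _, h, Set.inter_subset_right⟩
    · exact Or.inr ⟨hV, _, h, Set.inter_subset_right⟩
  · obtain ⟨W, hW⟩ := hG.nonempty
    obtain ⟨C, hC, hCQ, rfl⟩ := hG.subset W hW
    have hsub : ∀ Q ∈ C, Q ∈ polytopalLattice Γ M := fun Q hQ =>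
      ⟨{Q}, Set.finite_singleton Q, by simpa using hCQ Q hQ, by simp⟩
    obtain ⟨Q, hQ, hQG⟩ := hG.exists_mem_of_sUnion (empty_mem_polytopalLattice Γ) hC hsub hW
    exact ⟨Q, ⟨mem_polyhedralLattice_of_polytopal (hsub Q hQ), Q, hQG, subset_rfl⟩,
      (hCQ Q hQ).1.isPolyhedron, (hCQ Q hQ).2⟩
  · ext U
    constructor
    · rintro ⟨⟨-, W, hW, hWU⟩, hU⟩
      exact hG.mono W hW U hU hWU
    · intro hU
      exact ⟨⟨mem_polyhedralLattice_of_polytopal (hG.subset U hU), U, hU, subset_rfl⟩,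
        hG.subset U hU⟩

theorem IsPrimeFamily.polytopal {Γ : Set ℝ} {F : Set (Set (NR M))}
    (hF : IsPrimeFamily (polyhedralLattice Γ M) F) (hb : ∃ U ∈ F, IsPolytope U) :
    IsPrimeFamily (polytopalLattice Γ M) {U ∈ F | U ∈ polytopalLattice Γ M} where
  subset U hU := hU.2
  nonempty := by
    obtain ⟨U, hU, hUb⟩ := hb
    exact ⟨U, hU, mem_polytopalLattice_iff.2 ⟨hF.subset U hU, hUb.2⟩⟩
  mono U hU V hV hUV := ⟨hF.mono U hU.1 V (mem_polyhedralLattice_of_polytopal hV) hUV, hV⟩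
  inter U hU V hV := ⟨hF.inter U hU.1 V hV.1, (polytopalLattice Γ M).infClosed hU.2 hV.2⟩
  empty h := hF.empty h.1
  union U hU V hV h := (hF.union U (mem_polyhedralLattice_of_polytopal hU) V
    (mem_polyhedralLattice_of_polytopal hV) h.1).imp (fun h => ⟨h, hU⟩) fun h => ⟨h, hV⟩

/-- A prime filter of polyhedral sets that contains a polytope is the upward closure of its
polytopal members. -/
theorem mem_iff_of_polytopal {Γ : Set ℝ} {F : Set (Set (NR M))}
    (hF : IsPrimeFamily (polyhedralLattice Γ M) F) (hb : ∃ U ∈ F, IsPolytope U) (U : Set (NR M)) :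
    U ∈ F ↔ U ∈ polyhedralLattice Γ M ∧ ∃ W ∈ {U ∈ F | U ∈ polytopalLattice Γ M}, W ⊆ U := by
  constructor
  · intro hU
    obtain ⟨W, hW, hWb⟩ := hb
    refine ⟨hF.subset U hU, W ∩ U, ⟨hF.inter W hW U hU, mem_polytopalLattice_iff.2 ⟨?_, ?_⟩⟩,
      Set.inter_subset_right⟩
    · exact hF.subset _ (hF.inter W hW U hU)
    · exact hWb.2.mono Set.inter_subset_left
  · rintro ⟨hU, W, hW, hWU⟩
    exact hF.mono W hW.1 U hU hWU

/-- Prime filters of polyhedral sets containing a polytope, as families of sets. -/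
def polyhedralFilterEquiv (Γ : Set ℝ) (M : Type*) [AddCommGroup M] :
    PolyhedralPrimeFilter Γ M ≃ {F : Set (Set (NR M)) //
      IsPrimeFamily (polyhedralLattice Γ M) F ∧ ∃ U ∈ F, IsPolytope U} where
  toFun F := ⟨(primeFilterEquiv (empty_mem_polyhedralLattice Γ) ⟨F.1, F.2.1⟩).1,
    (primeFilterEquiv (empty_mem_polyhedralLattice Γ) ⟨F.1, F.2.1⟩).2, by
      obtain ⟨U, hU, hb⟩ := F.2.2
      exact ⟨U, (mem_primeFilterEquiv _ _ _).2 hU, hb⟩⟩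
  invFun F := ⟨((primeFilterEquiv (empty_mem_polyhedralLattice Γ)).symm ⟨F.1, F.2.1⟩).1,
    ((primeFilterEquiv (empty_mem_polyhedralLattice Γ)).symm ⟨F.1, F.2.1⟩).2, by
      obtain ⟨U, hU, hb⟩ := F.2.2
      exact ⟨⟨U, F.2.1.subset U hU⟩, hU, hb⟩⟩
  left_inv F := by
    apply Subtype.ext
    have := (primeFilterEquiv (empty_mem_polyhedralLattice (M := M) Γ)).symm_apply_apply
      ⟨F.1, F.2.1⟩
    have h := congrArg Subtype.val this
    exact h
  right_inv F := by
    apply Subtype.ext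
    have := (primeFilterEquiv (empty_mem_polyhedralLattice (M := M) Γ)).apply_symm_apply
      ⟨F.1, F.2.1⟩
    have h := congrArg Subtype.val this
    exact h

theorem mem_polyhedralFilterEquiv {Γ : Set ℝ} (F : PolyhedralPrimeFilter Γ M)
    (U : polyhedralLattice Γ M) : (U : Set (NR M)) ∈ (polyhedralFilterEquiv Γ M F).1 ↔ U ∈ F.1 :=
  mem_primeFilterEquiv (empty_mem_polyhedralLattice Γ) ⟨F.1, F.2.1⟩ U

/-- Restriction of prime filters from polyhedral to polytopal sets. -/
noncomputable def polyhedralFilterEquivPolytopal (Γ : Set ℝ) (M : Type*) [AddCommGroup M] :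
    PolyhedralPrimeFilter Γ M ≃ PolytopalPrimeFilter Γ M :=
  ((polyhedralFilterEquiv Γ M).trans
    (Equiv.ofBijective (fun F => (⟨_, F.2.1.polytopal F.2.2⟩ :
      {G : Set (Set (NR M)) // IsPrimeFamily (polytopalLattice Γ M) G})) (by
      constructor
      · intro F F' h
        have h' : {U ∈ F.1 | U ∈ polytopalLattice Γ M} = {U ∈ F'.1 | U ∈ polytopalLattice Γ M} :=
          congrArg Subtype.val h
        apply Subtype.ext
        ext U
        rw [mem_iff_of_polytopal F.2.1 F.2.2, mem_iff_of_polytopal F'.2.1 F'.2.2, h']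
      · rintro ⟨G, hG⟩
        obtain ⟨F, hF, h⟩ := exists_polyhedral_family hG
        exact ⟨⟨F, hF⟩, Subtype.ext h⟩))).trans
    (primeFilterEquiv (empty_mem_polytopalLattice Γ)).symm

theorem mem_polyhedralFilterEquivPolytopal {Γ : Set ℝ} (F : PolyhedralPrimeFilter Γ M)
    (V : polytopalLattice Γ M) :
    V ∈ (polyhedralFilterEquivPolytopal Γ M F).1 ↔ ∃ U ∈ F.1, (U : Set (NR M)) = V := by
  rw [← mem_primeFilterEquiv (empty_mem_polytopalLattice Γ)]
  simp only [polyhedralFilterEquivPolytopal, Equiv.trans_apply, Equiv.apply_symm_apply]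
  constructor
  · rintro ⟨h, -⟩
    exact ⟨⟨V, mem_polyhedralLattice_of_polytopal V.2⟩, (mem_polyhedralFilterEquiv F _).1 h, rfl⟩
  · rintro ⟨U, hU, hUV⟩
    exact ⟨hUV ▸ (mem_polyhedralFilterEquiv F U).2 hU, V.2⟩

end Filters

/-! ### Prime filters and term cones -/

section FilterCone
variable {M : Type*} [AddCommGroup M] {Γ : AddSubgroup ℝ}

/-- The terms whose half-space belongs to a family of sets. -/
def coneOfFamily (Γ : AddSubgroup ℝ) (F : Set (Set (NR M))) : Set (ℝ × M) :=
  {a | a.1 ∈ Γ ∧ halfSpace a ∈ F}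

/-- The polyhedral sets that contain a polyhedron cut out by finitely many terms of `N`. -/
def familyOfCone (Γ : AddSubgroup ℝ) (N : Set (ℝ × M)) : Set (Set (NR M)) :=
  {U | U ∈ polyhedralLattice (Γ : Set ℝ) M ∧
    ∃ I : Set (ℝ × M), I.Finite ∧ I ⊆ N ∧ ⋂ a ∈ I, halfSpace a ⊆ U}

theorem IsPrimeFamily.univ_mem {F : Set (Set (NR M))}
    (hF : IsPrimeFamily (polyhedralLattice (Γ : Set ℝ) M) F) : Set.univ ∈ F := by
  obtain ⟨U, hU⟩ := hF.nonempty
  exact hF.mono U hU _ (IsRatPolyhedron.isRatPolyhedralSet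
    (isRatPolyhedron_iff.2 ⟨∅, Set.finite_empty, by simp, by simp⟩)) (Set.subset_univ U)

theorem halfSpace_mem_polyhedralLattice {a : ℝ × M} (ha : a.1 ∈ Γ) :
    halfSpace a ∈ polyhedralLattice (Γ : Set ℝ) M :=
  (isRatPolyhedron_halfSpace ha).isRatPolyhedralSet

theorem IsPrimeFamily.isTermCone {F : Set (Set (NR M))} (hΓ : ∃ γ ∈ Γ, γ ≠ 0)
    (hF : IsPrimeFamily (polyhedralLattice (Γ : Set ℝ) M) F) (hb : ∃ U ∈ F, IsPolytope U) :
    IsTermCone Γ (coneOfFamily Γ F) where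
  fst_mem a ha := ha.1
  add_mem a ha b hb := by
    have h : (a + b).1 ∈ Γ := Γ.add_mem ha.1 hb.1
    refine ⟨h, hF.mono _ (hF.inter _ ha.2 _ hb.2) _ (halfSpace_mem_polyhedralLattice h) ?_⟩
    rintro x ⟨hxa, hxb⟩
    simp only [halfSpace, Set.mem_ofPred_eq, Prod.fst_add, Prod.snd_add, map_add] at hxa hxb ⊢
    linarith
  total a ha := by
    have h : halfSpace a ∪ halfSpace (-a) = Set.univ := by
      ext x
      simp only [halfSpace, Set.mem_union, Set.mem_ofPred_eq, Prod.fst_neg, Prod.snd_neg, map_neg,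
        Set.mem_univ, iff_true]
      rcases le_total (a.1 + x a.2) 0 with h | h
      · exact Or.inl h
      · right; linarith
    exact (hF.union _ (halfSpace_mem_polyhedralLattice ha) _
      (halfSpace_mem_polyhedralLattice (a := -a) (Γ.neg_mem ha)) (h ▸ hF.univ_mem)).imp
      (fun h => ⟨ha, h⟩) fun h => ⟨Γ.neg_mem ha, h⟩
  const_mem_iff γ hγ := by
    constructor
    · rintro ⟨-, h⟩
      by_contra hlt
      apply hF.empty
      convert h
      ext x
      simpa [halfSpace] using hlt
    · intro h
      refine ⟨hγ, ?_⟩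
      convert hF.univ_mem
      ext x
      simpa [halfSpace] using h
  exists_mem u := by
    obtain ⟨U, hU, hUb⟩ := hb
    obtain ⟨B, hB⟩ := hUb.2 u
    obtain ⟨γ, hγ, hlt⟩ := exists_mem_lt hΓ (-B)
    refine ⟨γ, hγ, hγ, hF.mono U hU _ (halfSpace_mem_polyhedralLattice hγ) fun x hx => ?_⟩
    have := (le_abs_self _).trans (hB x hx)
    simp only [halfSpace, Set.mem_ofPred_eq]
    linarith

theorem IsPrimeFamily.biInter_mem {F : Set (Set (NR M))}
    (hF : IsPrimeFamily (polyhedralLattice (Γ : Set ℝ) M) F) {I : Set (ℝ × M)} (hI : I.Finite)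
    (h : I ⊆ coneOfFamily Γ F) : ⋂ a ∈ I, halfSpace a ∈ F := by
  induction I, hI using Set.Finite.induction_on with
  | empty => simpa using hF.univ_mem
  | insert _ _ ih =>
    rw [Set.biInter_insert]
    exact hF.inter _ (h (Set.mem_insert _ _)).2 _ (ih ((Set.subset_insert _ _).trans h))

/-- A prime filter is determined by the half-spaces in it. -/
theorem IsPrimeFamily.familyOfCone_coneOfFamily {F : Set (Set (NR M))}
    (hF : IsPrimeFamily (polyhedralLattice (Γ : Set ℝ) M) F) :
    familyOfCone Γ (coneOfFamily Γ F) = F := by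
  ext U
  constructor
  · rintro ⟨hU, I, hI, hIF, hIU⟩
    exact hF.mono _ (hF.biInter_mem hI hIF) U hU hIU
  · intro hU
    have hUL := hF.subset U hU
    obtain ⟨C, hC, hCQ, rfl⟩ := hUL
    obtain ⟨Q, hQ, hQF⟩ := hF.exists_mem_of_sUnion (empty_mem_polyhedralLattice (Γ : Set ℝ)) hC
      (fun Q hQ => (hCQ Q hQ).isRatPolyhedralSet) hU
    obtain ⟨I, hI, hIΓ, rfl⟩ := isRatPolyhedron_iff.1 (hCQ Q hQ)
    refine ⟨hF.subset _ hU, I, hI, fun a ha => ⟨hIΓ a ha, ?_⟩, Set.subset_sUnion_of_mem hQ⟩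
    exact hF.mono _ hQF _ (halfSpace_mem_polyhedralLattice (hIΓ a ha))
      (Set.biInter_subset_of_mem ha)

variable [Module.Finite ℤ M]

/-- The polyhedral sets given by a term cone form a prime filter. For the union property, evaluate
the finitely many terms involved at a single point of `N_ℝ` that compares them with `1` in the same
way as the term cone does. -/
theorem IsTermCone.isPrimeFamily (hΓ : ∃ γ ∈ Γ, γ ≠ 0) {N : Set (ℝ × M)} (hN : IsTermCone Γ N) :
    IsPrimeFamily (polyhedralLattice (Γ : Set ℝ) M) (familyOfCone Γ N) where
  subset U hU := hU.1
  nonempty := ⟨Set.univ, IsRatPolyhedron.isRatPolyhedralSet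
    (isRatPolyhedron_iff.2 ⟨∅, Set.finite_empty, by simp, by simp⟩),
    ∅, Set.finite_empty, Set.empty_subset _, Set.subset_univ _⟩
  mono U hU V hV hUV := let ⟨_, I, hI, hIN, hIU⟩ := hU; ⟨hV, I, hI, hIN, hIU.trans hUV⟩
  inter := by
    rintro U ⟨hU, I, hI, hIN, hIU⟩ V ⟨hV, J, hJ, hJN, hJV⟩
    refine ⟨(polyhedralLattice (Γ : Set ℝ) M).infClosed hU hV, I ∪ J, hI.union hJ,
      Set.union_subset hIN hJN, ?_⟩
    rw [Set.biInter_union]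
    exact Set.inter_subset_inter hIU hJV
  empty := by
    rintro ⟨-, I, hI, hIN, hI0⟩
    obtain ⟨x, hx⟩ := hN.exists_point hΓ hI fun a ha => hN.fst_mem a (hIN ha)
    exact hI0 (Set.mem_iInter₂.2 fun a ha => (hx a ha).2 (hIN ha))
  union := by
    rintro U hU V hV ⟨-, I, hI, hIN, hIUV⟩
    have hpieces : ∀ W ∈ polyhedralLattice (Γ : Set ℝ) M, ∃ J : Set (ℝ × M), J.Finite ∧
        (∀ a ∈ J, a.1 ∈ Γ) ∧ ∀ x ∈ W, ∃ K ⊆ J, x ∈ ⋂ a ∈ K, halfSpace a ∧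
          ⋂ a ∈ K, halfSpace a ⊆ W := by
      rintro W ⟨C, hC, hCQ, rfl⟩
      choose! J hJ hJΓ hJQ using fun Q hQ => isRatPolyhedron_iff.1 (hCQ Q hQ)
      refine ⟨⋃ Q ∈ C, J Q, hC.biUnion hJ, fun a ha => ?_, fun x hx => ?_⟩
      · obtain ⟨Q, hQ, ha⟩ := Set.mem_iUnion₂.1 ha
        exact hJΓ Q hQ a ha
      · obtain ⟨Q, hQ, hx⟩ := hx
        exact ⟨J Q, Set.subset_biUnion_of_mem hQ, hJQ Q hQ ▸ hx,
          hJQ Q hQ ▸ Set.subset_sUnion_of_mem hQ⟩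
    obtain ⟨J, hJ, hJΓ, hJU⟩ := hpieces U hU
    obtain ⟨J', hJ', hJΓ', hJV⟩ := hpieces V hV
    -- a point where all terms that cut out the pieces of `U` and `V` compare with `1` as in `N`
    obtain ⟨x, hx⟩ := hN.exists_point hΓ (hI.union (hJ.union hJ')) (by
      rintro a (ha | ha | ha)
      exacts [hN.fst_mem a (hIN ha), hJΓ a ha, hJΓ' a ha])
    have hxUV := hIUV (Set.mem_iInter₂.2 fun a ha => (hx a (Or.inl ha)).2 (hIN ha))
    rcases hxUV with h | h
    · obtain ⟨K, hKJ, hxK, hKU⟩ := hJU x h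
      exact Or.inl ⟨hU, K, hJ.subset hKJ,
        fun a ha => (hx a (Or.inr (Or.inl (hKJ ha)))).1 (Set.mem_iInter₂.1 hxK a ha), hKU⟩
    · obtain ⟨K, hKJ, hxK, hKU⟩ := hJV x h
      exact Or.inr ⟨hV, K, hJ'.subset hKJ,
        fun a ha => (hx a (Or.inr (Or.inr (hKJ ha)))).1 (Set.mem_iInter₂.1 hxK a ha), hKU⟩

theorem IsTermCone.coneOfFamily_familyOfCone (hΓ : ∃ γ ∈ Γ, γ ≠ 0) {N : Set (ℝ × M)}
    (hN : IsTermCone Γ N) : coneOfFamily Γ (familyOfCone Γ N) = N := by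
  ext a
  constructor
  · rintro ⟨ha, -, I, hI, hIN, hIa⟩
    obtain ⟨x, hx⟩ := hN.exists_point hΓ (hI.insert a) (by
      rintro b (rfl | hb)
      exacts [ha, hN.fst_mem b (hIN hb)])
    exact (hx a (Set.mem_insert _ _)).1
      (hIa (Set.mem_iInter₂.2 fun b hb => (hx b (Set.mem_insert_of_mem _ hb)).2 (hIN hb)))
  · intro ha
    exact ⟨hN.fst_mem a ha, halfSpace_mem_polyhedralLattice (hN.fst_mem a ha), {a},
      Set.finite_singleton a, by simpa using ha, by simp⟩

/-- The terms of a term cone bound all coordinates, so some of them cut out a polytope. -/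
theorem IsTermCone.exists_polytope {N : Set (ℝ × M)} (hN : IsTermCone Γ N) :
    ∃ U ∈ familyOfCone Γ N, IsPolytope U := by
  obtain ⟨S, hS⟩ := (Module.Finite.iff_addGroup_fg (G := M)).1 inferInstance
  choose g hg hgN using hN.exists_mem
  let I : Set (ℝ × M) := (fun u => (g u, u)) '' (S : Set M) ∪ (fun u => (g (-u), -u)) '' (S : Set M)
  have hI : I.Finite := (S.finite_toSet.image _).union (S.finite_toSet.image _)
  have hIN : I ⊆ N := by
    rintro _ (⟨u, -, rfl⟩ | ⟨u, -, rfl⟩)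
    exacts [hgN u, hgN (-u)]
  have hrat : IsRatPolyhedron (Γ : Set ℝ) (⋂ a ∈ I, halfSpace a) :=
    isRatPolyhedron_iff.2 ⟨I, hI, fun a ha => hN.fst_mem a (hIN ha), rfl⟩
  refine ⟨⋂ a ∈ I, halfSpace a, ⟨hrat.isRatPolyhedralSet, I, hI, hIN, subset_rfl⟩,
    hrat.isPolyhedron, fun u => ?_⟩
  have hu : u ∈ AddSubgroup.closure (S : Set M) := hS ▸ AddSubgroup.mem_top u
  induction hu using AddSubgroup.closure_induction with
  | mem u hu =>
    refine ⟨max (-g u) (-g (-u)), fun x hx => ?_⟩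
    have h1 : g u + x u ≤ 0 := Set.mem_iInter₂.1 hx _ (Or.inl ⟨u, hu, rfl⟩)
    have h2 : g (-u) + x (-u) ≤ 0 := Set.mem_iInter₂.1 hx _ (Or.inr ⟨u, hu, rfl⟩)
    rw [map_neg] at h2
    exact abs_le'.2 ⟨le_max_of_le_left (by linarith), le_max_of_le_right (by linarith)⟩
  | zero => exact ⟨0, fun x _ => by simp⟩
  | add u v _ _ hu hv =>
    obtain ⟨B, hB⟩ := hu
    obtain ⟨B', hB'⟩ := hv
    refine ⟨B + B', fun x hx => ?_⟩
    rw [map_add]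
    exact (abs_add_le _ _).trans (add_le_add (hB x hx) (hB' x hx))
  | neg u _ hu => simpa using hu

/-- Prime filters of polyhedral sets containing a polytope correspond to term cones. -/
def filterEquivCone (hΓ : ∃ γ ∈ Γ, γ ≠ 0) :
    PolyhedralPrimeFilter (Γ : Set ℝ) M ≃ {N : Set (ℝ × M) // IsTermCone Γ N} :=
  (polyhedralFilterEquiv (Γ : Set ℝ) M).trans
    { toFun := fun F => ⟨coneOfFamily Γ F.1, F.2.1.isTermCone hΓ F.2.2⟩
      invFun := fun N => ⟨familyOfCone Γ N.1, N.2.isPrimeFamily hΓ, N.2.exists_polytope⟩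
      left_inv := fun F => Subtype.ext F.2.1.familyOfCone_coneOfFamily
      right_inv := fun N => Subtype.ext (N.2.coneOfFamily_familyOfCone hΓ) }

theorem mem_filterEquivCone_symm (hΓ : ∃ γ ∈ Γ, γ ≠ 0) (N : {N : Set (ℝ × M) // IsTermCone Γ N})
    (U : polyhedralLattice (Γ : Set ℝ) M) : U ∈ ((filterEquivCone hΓ).symm N).1 ↔
      ∃ I : Set (ℝ × M), I.Finite ∧ I ⊆ N.1 ∧ ⋂ a ∈ I, halfSpace a ⊆ (U : Set (NR M)) := by
  rw [← mem_polyhedralFilterEquiv]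
  simp only [filterEquivCone, Equiv.symm_trans_apply, Equiv.apply_symm_apply]
  exact ⟨fun h => h.2, fun h => ⟨U.2, h⟩⟩

end FilterCone

/-! ### Tropical arithmetic -/

section Tropical

theorem texp_add (a b : ℝ) : texp (a + b) = texp a * texp b := rfl

theorem texp_zero : texp 0 = 1 := rfl

theorem texp_ne_zero (a : ℝ) : texp a ≠ 0 := fun h => by
  have := congrArg Tropical.untrop h
  exact WithTop.coe_ne_top this

theorem tlog_texp (a : ℝ) : tlog (texp a) = a := rfl

theorem texp_tlog {x : Trop} (hx : x ≠ 0) : texp (tlog x) = x := by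
  induction x using Tropical.tropRec with
  | h X =>
    induction X using WithTop.recTopCoe with
    | top => exact absurd rfl hx
    | coe a => rfl

theorem canLE_texp {a b : ℝ} : CanLE (texp a) (texp b) ↔ a ≤ b := by
  rw [CanLE, Tropical.add_eq_left_iff, ← Tropical.untrop_le_iff]
  exact WithTop.coe_le_coe

theorem canLE_total_trop (x y : Trop) : CanLE x y ∨ CanLE y x := by
  rw [CanLE, CanLE, Tropical.add_eq_left_iff, Tropical.add_eq_left_iff]
  exact le_total y x

end Tropical

/-! ### Idempotent semirings and their topology -/

section Idempotent
variable {A : Type*} [CommSemiring A]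

theorem CanLE.trans {a b c : A} (h : CanLE a b) (h' : CanLE b c) : CanLE a c := by
  unfold CanLE at *
  rw [← h', add_assoc, h]

theorem CanLE.antisymm {a b : A} (h : CanLE a b) (h' : CanLE b a) : a = b := by
  unfold CanLE at *
  rw [← h, add_comm, h']

theorem CanLE.add {a b c : A} (h : CanLE a c) (h' : CanLE b c) : CanLE (a + b) c := by
  unfold CanLE at *
  rw [← add_assoc, h, h']

theorem CanLE.mul_right {a b : A} (h : CanLE a b) (c : A) : CanLE (a * c) (b * c) := by
  unfold CanLE at *
  rw [← add_mul, h]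

theorem canLE_zero_left (a : A) : CanLE 0 a := add_zero a

theorem add_self_of_one (h1 : (1 : A) + 1 = 1) (a : A) : a + a = a := by
  rw [← mul_one a, ← mul_add, h1]

theorem canLE_sum {ι : Type*} {s : Finset ι} {a : ι → A} {c : A} (h : ∀ i ∈ s, CanLE (a i) c) :
    CanLE (∑ i ∈ s, a i) c := by
  classical
  induction s using Finset.induction_on with
  | empty => exact canLE_zero_left c
  | insert i s hi ih =>
    rw [Finset.sum_insert hi]
    exact (h i (Finset.mem_insert_self _ _)).add
      (ih fun j hj => h j (Finset.mem_insert_of_mem hj))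

theorem canLE_sum_of_mem (h1 : (1 : A) + 1 = 1) {ι : Type*} {s : Finset ι} (a : ι → A) {i : ι}
    (hi : i ∈ s) : CanLE (a i) (∑ i ∈ s, a i) := by
  classical
  rw [CanLE, ← Finset.add_sum_erase s a hi, add_comm, ← add_assoc, add_self_of_one h1]

/-- In a totally ordered idempotent semiring a nonempty sum is bounded by one of its terms. -/
theorem exists_sum_canLE (h1 : (1 : A) + 1 = 1) (htot : ∀ a b : A, CanLE a b ∨ CanLE b a)
    {ι : Type*} {s : Finset ι} (hs : s.Nonempty) (a : ι → A) :
    ∃ i ∈ s, CanLE (∑ i ∈ s, a i) (a i) := by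
  classical
  induction hs using Finset.Nonempty.cons_induction with
  | singleton i => exact ⟨i, by simp, by simpa [CanLE] using add_self_of_one h1 (a i)⟩
  | cons i s hi hs ih =>
    obtain ⟨j, hj, hle⟩ := ih
    rw [Finset.sum_cons]
    rcases htot (a i) (a j) with h | h
    · exact ⟨j, by simp [hj], h.add hle⟩
    · exact ⟨i, by simp, CanLE.add (add_self_of_one h1 _) (hle.trans h)⟩

/-- In a totally ordered idempotent semiring, a set is open if it is a neighbourhood of `0` or does
not contain `0`, where the sets `{x | x < c}` with `c ≠ 0` are the basic neighbourhoods of `0`. -/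
theorem isOpen_semifieldTopology_iff [Nontrivial A] (htot : ∀ a b : A, CanLE a b ∨ CanLE b a)
    {U : Set A} : IsOpen[semifieldTopology A] U ↔
      (0 ∈ U → ∃ c : A, c ≠ 0 ∧ ∀ x, CanLE x c → x ≠ c → x ∈ U) := by
  constructor
  · intro hU
    change TopologicalSpace.GenerateOpen _ U at hU
    induction hU with
    | basic V hV =>
      rintro h0
      rcases hV with ⟨a, ha, rfl⟩ | ⟨b, hb, rfl⟩
      · exact absurd h0.symm ha
      · exact ⟨b, hb, fun x hx hne => ⟨hx, hne⟩⟩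
    | univ => exact fun _ => ⟨1, one_ne_zero, fun _ _ _ => trivial⟩
    | inter V W _ _ ihV ihW =>
      rintro ⟨hV, hW⟩
      obtain ⟨c, hc, hcV⟩ := ihV hV
      obtain ⟨d, hd, hdW⟩ := ihW hW
      have key : ∀ {c d : A}, CanLE c d → ∀ x, CanLE x c → x ≠ c → CanLE x d ∧ x ≠ d := by
        intro c d hcd x hxc hne
        refine ⟨hxc.trans hcd, ?_⟩
        rintro rfl
        exact hne (hxc.antisymm hcd)
      rcases htot c d with h | h
      · exact ⟨c, hc, fun x hx hne => ⟨hcV x hx hne, hdW x (key h x hx hne).1 (key h x hx hne).2⟩⟩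
      · exact ⟨d, hd, fun x hx hne => ⟨hcV x (key h x hx hne).1 (key h x hx hne).2, hdW x hx hne⟩⟩
    | sUnion C _ ih =>
      rintro ⟨V, hV, h0⟩
      obtain ⟨c, hc, hcV⟩ := ih V hV h0
      exact ⟨c, hc, fun x hx hne => ⟨V, hV, hcV x hx hne⟩⟩
  · intro h
    let _ := semifieldTopology A
    have hsing : ∀ a : A, a ≠ 0 → IsOpen ({a} : Set A) := fun a ha =>
      TopologicalSpace.isOpen_generateFrom_of_mem (Or.inl ⟨a, ha, rfl⟩)
    rw [isOpen_iff_forall_mem_open]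
    intro x hx
    by_cases hx0 : x = 0
    · subst hx0
      obtain ⟨c, hc, hcU⟩ := h hx
      exact ⟨{x | CanLE x c ∧ x ≠ c}, fun x hx => hcU x hx.1 hx.2,
        TopologicalSpace.isOpen_generateFrom_of_mem (Or.inr ⟨c, hc, rfl⟩),
        canLE_zero_left c, hc.symm⟩
    · exact ⟨{x}, Set.singleton_subset_iff.2 hx, hsing x hx0, rfl⟩

end Idempotent

/-! ### Prime congruences and terms -/

section Prime
variable {M : Type*} [AddCommGroup M] {S : Subsemiring Trop}

/-- The value group of a subsemifield, as a subgroup of `ℝ`. -/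
def valueSubgroup (hS : IsSubsemifield S) : AddSubgroup ℝ where
  carrier := valueGroup S
  zero_mem' := S.one_mem
  add_mem' ha hb := S.mul_mem ha hb
  neg_mem' := by
    intro a ha
    obtain ⟨y, hy, hxy⟩ := hS.inv _ ha (texp_ne_zero a)
    have hy0 : y ≠ 0 := by
      rintro rfl
      rw [mul_zero] at hxy
      exact zero_ne_one hxy
    have h : a + tlog y = 0 := by
      have h1 := congrArg tlog hxy
      rw [← texp_tlog hy0, ← texp_add, tlog_texp] at h1
      exact h1
    show texp (-a) ∈ S
    rw [show -a = tlog y by linarith, texp_tlog hy0]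
    exact hy

theorem mem_valueSubgroup (hS : IsSubsemifield S) {γ : ℝ} :
    γ ∈ valueSubgroup hS ↔ texp γ ∈ S := Iff.rfl

theorem valueSubgroup_nontrivial (hS : IsSubsemifield S) : ∃ γ ∈ valueSubgroup hS, γ ≠ 0 := by
  obtain ⟨x, hx, h0, h1⟩ := hS.ne_bool
  refine ⟨tlog x, ?_, fun h => h1 ?_⟩
  · rw [mem_valueSubgroup, texp_tlog h0]; exact hx
  · rw [← texp_tlog h0, h, texp_zero]

theorem tlog_mem (hS : IsSubsemifield S) {x : S} (hx : x ≠ 0) : tlog x ∈ valueSubgroup hS := by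
  rw [mem_valueSubgroup, texp_tlog (by simpa using hx)]
  exact x.2

/-- The term `t^γ χ^u` for `γ ∈ Γ`. -/
noncomputable def term (hS : IsSubsemifield S) (a : ℝ × M) (ha : a.1 ∈ valueSubgroup hS) :
    AddMonoidAlgebra S M :=
  AddMonoidAlgebra.single a.2 (⟨texp a.1, ha⟩ : S)

variable (hS : IsSubsemifield S)

theorem term_mul {a b : ℝ × M} (ha : a.1 ∈ valueSubgroup hS) (hb : b.1 ∈ valueSubgroup hS) :
    term hS a ha * term hS b hb = term hS (a + b) ((valueSubgroup hS).add_mem ha hb) := by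
  rw [term, term, AddMonoidAlgebra.single_mul_single]
  rfl

theorem term_zero : term hS (0 : ℝ × M) (valueSubgroup hS).zero_mem = 1 := rfl

theorem term_mul_neg {a : ℝ × M} (ha : a.1 ∈ valueSubgroup hS) :
    term hS a ha * term hS (-a) ((valueSubgroup hS).neg_mem ha) = 1 := by
  rw [term_mul, ← term_zero hS]
  congr 1
  exact add_neg_cancel a

theorem single_eq_term {M : Type*} {x : S} (hx : x ≠ 0) (u : M) :
    AddMonoidAlgebra.single u x = term hS (tlog x, u) (tlog_mem hS hx) := by
  rw [term]
  congr 1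
  exact Subtype.ext (texp_tlog (by simpa using hx)).symm

theorem eq_sum_terms {M : Type*} (f : AddMonoidAlgebra S M) :
    f = ∑ u ∈ f.coeff.support, AddMonoidAlgebra.single u (f.coeff u) :=
  (AddMonoidAlgebra.sum_coeff_single f).symm

theorem one_add_one_algebra : (1 : AddMonoidAlgebra S M) + 1 = 1 := by
  rw [AddMonoidAlgebra.one_def, ← AddMonoidAlgebra.single_add]
  congr 1
  exact Subtype.ext (Tropical.add_self 1)

theorem one_add_one_quotient (P : RingCon (AddMonoidAlgebra S M)) : (1 : P.Quotient) + 1 = 1 :=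
  congrArg (fun f : AddMonoidAlgebra S M => (f : P.Quotient)) one_add_one_algebra

/-- The cone of terms that are at most `1` modulo `P`. -/
def coneOfPrime (P : RingCon (AddMonoidAlgebra S M)) : Set (ℝ × M) :=
  {a | ∃ h : a.1 ∈ valueSubgroup hS, PLE P (term hS a h) 1}

/-- Every term of `f` is bounded by a term of `g`, for the preorder on terms given by `N`. -/
def TermLE (N : Set (ℝ × M)) (f g : AddMonoidAlgebra S M) : Prop :=
  ∀ u ∈ f.coeff.support, ∃ v ∈ g.coeff.support,
    (tlog (f.coeff u) - tlog (g.coeff v), u - v) ∈ N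

variable {hS} {P : RingCon (AddMonoidAlgebra S M)}

/-- Terms are units, so comparing two of them amounts to comparing their quotient with `1`. -/
theorem term_ple_iff {a b : ℝ × M} (ha : a.1 ∈ valueSubgroup hS) (hb : b.1 ∈ valueSubgroup hS) :
    PLE P (term hS a ha) (term hS b hb) ↔ a - b ∈ coneOfPrime hS P := by
  have hb' := (valueSubgroup hS).neg_mem hb
  have hab : (a - b).1 ∈ valueSubgroup hS := (valueSubgroup hS).sub_mem ha hb
  have e1 : term hS a ha * term hS (-b) hb' = term hS (a - b) hab := by
    rw [term_mul]; congr 1; exact (sub_eq_add_neg a b).symm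
  have e2 : term hS (a - b) hab * term hS b hb = term hS a ha := by
    rw [term_mul]; congr 1; exact sub_add_cancel a b
  constructor
  · intro h
    have := CanLE.mul_right h (term hS (-b) hb' : AddMonoidAlgebra S M)
    rw [← RingCon.coe_mul, ← RingCon.coe_mul, e1, term_mul_neg] at this
    exact ⟨hab, this⟩
  · rintro ⟨_, h⟩
    have := CanLE.mul_right h (term hS b hb : AddMonoidAlgebra S M)
    rw [← RingCon.coe_mul, ← RingCon.coe_mul, e2, one_mul] at this
    exact this

theorem IsPrimeCon.nontrivial (hP : IsPrimeCon P) : Nontrivial P.Quotient := by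
  refine ⟨1, 0, ?_⟩
  intro h
  apply hP.ne_top
  rw [eq_top_iff]
  intro f g _
  have key : ∀ f : AddMonoidAlgebra S M, (f : P.Quotient) = 0 := fun f => by
    rw [← mul_one (f : P.Quotient), h, mul_zero]
  exact (RingCon.eq P).1 ((key f).trans (key g).symm)

theorem IsPrimeCon.term_ne_zero (hP : IsPrimeCon P) {a : ℝ × M} (ha : a.1 ∈ valueSubgroup hS) :
    (term hS a ha : P.Quotient) ≠ 0 := by
  have := hP.nontrivial
  intro h
  have h1 : (term hS a ha : P.Quotient) * (term hS (-a) ((valueSubgroup hS).neg_mem ha) :) = 1 := by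
    rw [← RingCon.coe_mul, term_mul_neg]; rfl
  rw [h, zero_mul] at h1
  exact zero_ne_one h1

theorem coe_eq_sum (P : RingCon (AddMonoidAlgebra S M)) (f : AddMonoidAlgebra S M) :
    (f : P.Quotient) =
      ∑ u ∈ f.coeff.support, ((AddMonoidAlgebra.single u (f.coeff u) : AddMonoidAlgebra S M) :
        P.Quotient) := by
  conv_lhs => rw [eq_sum_terms f]
  exact map_sum P.mk' _ _

/-- A prime congruence compares polynomials by comparing their terms. -/
theorem IsPrimeCon.ple_iff (hP : IsPrimeCon P) (f g : AddMonoidAlgebra S M) :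
    PLE P f g ↔ TermLE (coneOfPrime hS P) f g := by
  have h1 := one_add_one_quotient P
  have hterm : ∀ (f : AddMonoidAlgebra S M), ∀ u ∈ f.coeff.support,
      ∃ h : tlog (f.coeff u) ∈ valueSubgroup hS,
        AddMonoidAlgebra.single u (f.coeff u) = term hS (tlog (f.coeff u), u) h :=
    fun f u hu => ⟨tlog_mem hS (Finsupp.mem_support_iff.1 hu),
      single_eq_term hS (Finsupp.mem_support_iff.1 hu) u⟩
  constructor
  · intro h u hu
    obtain ⟨hu', hfu⟩ := hterm f u hu
    have hle : CanLE ((term hS (tlog (f.coeff u), u) hu' : AddMonoidAlgebra S M) : P.Quotient)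
        (g : P.Quotient) := by
      refine CanLE.trans ?_ h
      rw [coe_eq_sum P f, ← hfu]
      exact canLE_sum_of_mem h1
        (fun u => ((AddMonoidAlgebra.single u (f.coeff u) : AddMonoidAlgebra S M) : P.Quotient)) hu
    rcases g.coeff.support.eq_empty_or_nonempty with hg | hg
    · rw [coe_eq_sum P g, hg, Finset.sum_empty, CanLE, zero_add] at hle
      exact absurd hle (hP.term_ne_zero hu')
    · obtain ⟨v, hv, hgv⟩ := exists_sum_canLE h1 hP.total hg
        fun u => ((AddMonoidAlgebra.single u (g.coeff u) : AddMonoidAlgebra S M) : P.Quotient)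
      rw [← coe_eq_sum] at hgv
      obtain ⟨hv', hgv'⟩ := hterm g v hv
      rw [hgv'] at hgv
      exact ⟨v, hv, (term_ple_iff hu' hv').1 (hle.trans hgv)⟩
  · intro h
    rw [PLE, coe_eq_sum P f]
    refine canLE_sum fun u hu => ?_
    obtain ⟨v, hv, huv⟩ := h u hu
    obtain ⟨hu', hfu⟩ := hterm f u hu
    obtain ⟨hv', hgv⟩ := hterm g v hv
    have h2 := (term_ple_iff (P := P) (a := (tlog (f.coeff u), u))
      (b := (tlog (g.coeff v), v)) hu' hv').2 huv
    rw [hfu]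
    refine CanLE.trans h2 ?_
    rw [coe_eq_sum P g, ← hgv]
    exact canLE_sum_of_mem h1
      (fun u => ((AddMonoidAlgebra.single u (g.coeff u) : AddMonoidAlgebra S M) : P.Quotient)) hv

/-- A prime congruence is determined by its cone of terms. -/
theorem IsPrimeCon.rel_iff (hP : IsPrimeCon P) (f g : AddMonoidAlgebra S M) :
    P f g ↔ TermLE (coneOfPrime hS P) f g ∧ TermLE (coneOfPrime hS P) g f := by
  rw [← hP.ple_iff, ← hP.ple_iff]
  constructor
  · intro h
    have h' : (f : P.Quotient) = g := (RingCon.eq P).2 h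
    unfold PLE
    rw [h']
    exact ⟨add_self_of_one (one_add_one_quotient P) _, add_self_of_one (one_add_one_quotient P) _⟩
  · rintro ⟨h, h'⟩
    exact (RingCon.eq P).1 (h.antisymm h')

/-- Modulo a prime every nonzero polynomial is equal to one of its terms. -/
theorem IsPrimeCon.exists_eq_term (hS : IsSubsemifield S) (hP : IsPrimeCon P) {q : P.Quotient}
    (hq : q ≠ 0) : ∃ (a : ℝ × M) (ha : a.1 ∈ valueSubgroup hS), q = term hS a ha := by
  obtain ⟨f, rfl⟩ := P.mk'_surjective q
  change (f : P.Quotient) ≠ 0 at hq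
  rcases f.coeff.support.eq_empty_or_nonempty with hf | hf
  · rw [coe_eq_sum P f, hf] at hq
    exact absurd rfl hq
  · obtain ⟨v, hv, hfv⟩ := exists_sum_canLE (one_add_one_quotient P) hP.total hf
      fun u => ((AddMonoidAlgebra.single u (f.coeff u) : AddMonoidAlgebra S M) : P.Quotient)
    refine ⟨(tlog (f.coeff v), v), tlog_mem hS (Finsupp.mem_support_iff.1 hv), ?_⟩
    rw [← single_eq_term hS (Finsupp.mem_support_iff.1 hv)]
    refine CanLE.antisymm ?_ ?_
    · change CanLE (f : P.Quotient) _
      rw [coe_eq_sum P f]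
      exact hfv
    · change CanLE _ (f : P.Quotient)
      conv_rhs => rw [coe_eq_sum P f]
      exact canLE_sum_of_mem (one_add_one_quotient P)
        (fun u => ((AddMonoidAlgebra.single u (f.coeff u) : AddMonoidAlgebra S M) : P.Quotient)) hv

end Prime

/-! ### Continuity of the map to the residue semifield -/

section Continuity
variable {M : Type*} [AddCommGroup M] {S : Subsemiring Trop} {P : RingCon (AddMonoidAlgebra S M)}

theorem nontrivial_subsemiring : Nontrivial S :=
  ⟨0, 1, fun h => zero_ne_one (congrArg Subtype.val h)⟩

theorem canLE_total_subsemiring (x y : S) : CanLE x y ∨ CanLE y x :=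
  (canLE_total_trop (x : Trop) y).imp (fun h => Subtype.ext h) fun h => Subtype.ext h

/-- The canonical homomorphism from a semiring to its total semiring of fractions. For
`Q = S[M] / P` it induces the map to `κ(P)`; stating its properties for a general `Q` keeps the
semiring structure of the quotient out of unification. -/
noncomputable def fracMap (Q : Type*) [CommSemiring Q] : Q →+* Localization (cancellable Q) :=
  algebraMap Q (Localization (cancellable Q))

theorem fracMap_injective (Q : Type*) [CommSemiring Q] : Function.Injective (fracMap Q) := by
  intro x y h
  obtain ⟨c, hc⟩ :=
    (IsLocalization.eq_iff_exists (cancellable Q) (Localization (cancellable Q))).1 h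
  exact c.2.left hc

theorem exists_mul_fracMap_eq {Q : Type*} [CommSemiring Q] (b : Localization (cancellable Q)) :
    ∃ q r : Q, IsRegular r ∧ b * fracMap Q r = fracMap Q q := by
  obtain ⟨⟨q, r⟩, h⟩ := IsLocalization.surj (cancellable Q) b
  exact ⟨q, r, r.2, h⟩

theorem toKappa_eq_fracMap (P : RingCon (AddMonoidAlgebra S M)) (f : AddMonoidAlgebra S M) :
    toKappa P f = fracMap P.Quotient f := rfl

/-- Modulo a prime, all nonzero fractions are fractions of terms, hence terms. -/
theorem IsPrimeCon.exists_toKappa_eq (hS : IsSubsemifield S) (hP : IsPrimeCon P) {b : Kappa P}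
    (hb : b ≠ 0) : ∃ (a : ℝ × M) (ha : a.1 ∈ valueSubgroup hS), b = toKappa P (term hS a ha) := by
  have := hP.nontrivial
  obtain ⟨q, r, hreg, h⟩ := exists_mul_fracMap_eq b
  have hr : r ≠ 0 := by
    rintro rfl
    have := hreg.left (show (0 : P.Quotient) * 1 = 0 * 0 by rw [zero_mul, zero_mul])
    exact one_ne_zero this
  obtain ⟨a', ha', rfl⟩ := hP.exists_eq_term hS hr
  have hunit : fracMap P.Quotient (term hS a' ha') *
      fracMap P.Quotient (term hS (-a') ((valueSubgroup hS).neg_mem ha')) = 1 := by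
    rw [← map_mul, ← RingCon.coe_mul, term_mul_neg]
    exact map_one _
  have hq : q ≠ 0 := by
    rintro rfl
    apply hb
    rw [map_zero] at h
    rw [← mul_one b, ← hunit, ← mul_assoc, h, zero_mul]
  obtain ⟨a, ha, rfl⟩ := hP.exists_eq_term hS hq
  refine ⟨a + -a', (valueSubgroup hS).add_mem ha ((valueSubgroup hS).neg_mem ha'), ?_⟩
  rw [← mul_one b, ← hunit, ← mul_assoc, h, ← term_mul hS ha ((valueSubgroup hS).neg_mem ha'),
    toKappa_eq_fracMap, RingCon.coe_mul, map_mul]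

/-- The map to the residue semifield of a prime is continuous iff every term strictly bounds all
sufficiently small constants. -/
theorem IsPrimeCon.continuous_iff (hS : IsSubsemifield S) (hP : IsPrimeCon P) :
    @Continuous _ _ (algebraTopology S (AddMonoidAlgebra S M)) (semifieldTopology (Kappa P))
      (toKappa P) ↔
    ∀ (a : ℝ × M) (ha : a.1 ∈ valueSubgroup hS), ∃ c : S, c ≠ 0 ∧ ∀ x : S, CanLE x c → x ≠ c →
      PLE P (AddMonoidAlgebra.single 0 x) (term hS a ha) ∧
        ((AddMonoidAlgebra.single 0 x : AddMonoidAlgebra S M) : P.Quotient) ≠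
          (term hS a ha : P.Quotient) := by
  have hnt := nontrivial_subsemiring (S := S)
  have hinj := fracMap_injective P.Quotient
  have hle : ∀ f g : AddMonoidAlgebra S M,
      CanLE (toKappa P f) (toKappa P g) ∧ toKappa P f ≠ toKappa P g ↔
        PLE P f g ∧ (f : P.Quotient) ≠ g := by
    intro f g
    rw [CanLE, toKappa_eq_fracMap, toKappa_eq_fracMap, ← map_add, hinj.eq_iff, hinj.ne_iff]
    rfl
  let _ : TopologicalSpace S := semifieldTopology S
  rw [algebraTopology, continuous_coinduced_dom]
  refine continuous_generateFrom_iff.trans ?_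
  have hopen := fun U : Set S => isOpen_semifieldTopology_iff canLE_total_subsemiring (U := U)
  have h0 : toKappa P (AddMonoidAlgebra.single 0 0) = 0 := by
    rw [AddMonoidAlgebra.single_zero]
    exact map_zero (fracMap P.Quotient)
  constructor
  · intro h a ha
    have hne : toKappa P (term hS a ha) ≠ 0 := by
      intro h
      rw [toKappa_eq_fracMap, ← map_zero (fracMap P.Quotient), hinj.eq_iff] at h
      exact hP.term_ne_zero ha h
    obtain ⟨c, hc, hc'⟩ := (hopen _).1 (h _ (Or.inr ⟨_, hne, rfl⟩)) (by
      show CanLE (toKappa P (AddMonoidAlgebra.single 0 0)) _ ∧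
        toKappa P (AddMonoidAlgebra.single 0 0) ≠ _
      rw [h0]
      exact ⟨canLE_zero_left _, hne.symm⟩)
    exact ⟨c, hc, fun x hx hne => (hle _ _).1 (hc' x hx hne)⟩
  · rintro h U (⟨b, hb, rfl⟩ | ⟨b, hb, rfl⟩)
    · refine (hopen _).2 fun hmem => absurd ?_ hb
      have : toKappa P (AddMonoidAlgebra.single 0 0) = b := hmem
      rw [← this, h0]
    · obtain ⟨a, ha, rfl⟩ := hP.exists_toKappa_eq hS hb
      obtain ⟨c, hc, hc'⟩ := h a ha
      exact (hopen _).2 fun _ => ⟨c, hc, fun x hx hne => (hle _ _).2 (hc' x hx hne)⟩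

theorem canLE_subsemiring_texp (hS : IsSubsemifield S) {a b : ℝ} (ha : a ∈ valueSubgroup hS)
    (hb : b ∈ valueSubgroup hS) : CanLE (⟨texp a, ha⟩ : S) ⟨texp b, hb⟩ ↔ a ≤ b := by
  rw [← canLE_texp]
  exact Subtype.ext_iff

/-- Constants are ordered modulo any congruence at least as they are in `S`. -/
theorem const_mem_coneOfPrime (hS : IsSubsemifield S) {γ : ℝ} (hγ : γ ∈ valueSubgroup hS)
    (h : γ ≤ 0) : (γ, (0 : M)) ∈ coneOfPrime hS P := by
  refine ⟨hγ, ?_⟩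
  have h1 := (canLE_subsemiring_texp hS hγ (valueSubgroup hS).zero_mem).2 h
  have h2 : (term hS (0 : ℝ × M) (valueSubgroup hS).zero_mem) + term hS (γ, 0) hγ =
      term hS (0 : ℝ × M) (valueSubgroup hS).zero_mem := by
    simp only [term]
    rw [Prod.snd_zero, ← AddMonoidAlgebra.single_add]
    exact congrArg _ h1
  rw [term_zero] at h2
  exact congrArg (fun f : AddMonoidAlgebra S M => (f : P.Quotient)) h2

theorem add_mem_coneOfPrime (hS : IsSubsemifield S) {a b : ℝ × M}
    (ha : a ∈ coneOfPrime hS P) (hb : b ∈ coneOfPrime hS P) : a + b ∈ coneOfPrime hS P := by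
  obtain ⟨ha, h⟩ := ha
  obtain ⟨hb, h'⟩ := hb
  refine ⟨(valueSubgroup hS).add_mem ha hb, ?_⟩
  rw [← term_mul hS ha hb]
  have h1 := CanLE.mul_right h (term hS b hb : P.Quotient)
  rw [← RingCon.coe_mul, ← RingCon.coe_mul, one_mul] at h1
  exact h1.trans h'

/-- Modulo a prime in `Cont_S S[M]` every term strictly bounds some constant. -/
theorem IsPrimeCon.exists_const_lt (hS : IsSubsemifield S) (hP : IsPrimeCon P)
    (hc : @Continuous _ _ (algebraTopology S (AddMonoidAlgebra S M)) (semifieldTopology (Kappa P))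
      (toKappa P)) {a : ℝ × M} (ha : a.1 ∈ valueSubgroup hS) :
    ∃ B : ℝ, ∀ γ ∈ valueSubgroup hS,
      γ < B → (γ, (0 : M)) - a ∈ coneOfPrime hS P ∧ a - (γ, (0 : M)) ∉ coneOfPrime hS P := by
  obtain ⟨c, hc0, hc⟩ := (hP.continuous_iff hS).1 hc a ha
  have hc0' : (c : Trop) ≠ 0 := by simpa using hc0
  refine ⟨tlog c, fun γ hγ hlt => ?_⟩
  have hcγ : CanLE (⟨texp γ, hγ⟩ : S) c := by
    refine Subtype.ext ?_
    show (c : Trop) + texp γ = c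
    rw [← texp_tlog hc0']
    exact canLE_texp.2 hlt.le
  have hne : (⟨texp γ, hγ⟩ : S) ≠ c := by
    intro h
    have : texp γ = c := congrArg Subtype.val h
    rw [← this, tlog_texp] at hlt
    exact lt_irrefl _ hlt
  obtain ⟨h1, h2⟩ := hc _ hcγ hne
  have h1' : PLE P (term hS (γ, (0 : M)) hγ) (term hS a ha) := h1
  refine ⟨(term_ple_iff _ _).1 h1', fun h3 => h2 ?_⟩
  have h3' : PLE P (term hS a ha) (term hS (γ, (0 : M)) hγ) := (term_ple_iff _ _).2 h3
  exact CanLE.antisymm h1' h3'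

theorem IsPrimeCon.mem_or_neg_mem (hS : IsSubsemifield S) (hP : IsPrimeCon P) {a : ℝ × M}
    (ha : a.1 ∈ valueSubgroup hS) : a ∈ coneOfPrime hS P ∨ -a ∈ coneOfPrime hS P := by
  have h0 := (valueSubgroup hS).zero_mem
  rcases hP.total (term hS a ha) (term hS (0 : ℝ × M) h0) with h | h
  · left
    have := (term_ple_iff ha h0).1 h
    rwa [sub_zero] at this
  · right
    have := (term_ple_iff h0 ha).1 h
    rwa [zero_sub] at this

/-- If a constant `t^γ` with `γ > 0` were at most `1`, then all constants would be equal, and none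
would be strictly bounded by `1`. -/
theorem IsPrimeCon.const_mem_iff (hS : IsSubsemifield S) (hP : IsPrimeCon P)
    (hc : @Continuous _ _ (algebraTopology S (AddMonoidAlgebra S M)) (semifieldTopology (Kappa P))
      (toKappa P)) {γ : ℝ} (hγ : γ ∈ valueSubgroup hS) :
    (γ, (0 : M)) ∈ coneOfPrime hS P ↔ γ ≤ 0 := by
  refine ⟨fun h => ?_, const_mem_coneOfPrime hS hγ⟩
  by_contra hpos
  rw [not_le] at hpos
  obtain ⟨B, hB⟩ := hP.exists_const_lt hS hc (a := 0) (valueSubgroup hS).zero_mem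
  obtain ⟨δ, hδ, hlt⟩ := exists_mem_lt (valueSubgroup_nontrivial hS) (min B 0)
  have hB' := (hB δ hδ (hlt.trans_le (min_le_left _ _))).2
  have hδ0 : δ < 0 := hlt.trans_le (min_le_right _ _)
  obtain ⟨k, hk⟩ := Archimedean.arch (-δ) hpos
  have h0 : (0 : ℝ × M) ∈ coneOfPrime hS P :=
    const_mem_coneOfPrime hS (valueSubgroup hS).zero_mem le_rfl
  have h1 : k • (γ, (0 : M)) ∈ coneOfPrime hS P :=
    nsmul_mem_of_add_mem (fun a ha b hb => add_mem_coneOfPrime hS ha hb) h0 h k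
  have hmem : -δ - k • γ ∈ valueSubgroup hS := (valueSubgroup hS).sub_mem
    ((valueSubgroup hS).neg_mem hδ) ((valueSubgroup hS).nsmul_mem hγ k)
  have h2 : (-δ - k • γ, (0 : M)) ∈ coneOfPrime hS P :=
    const_mem_coneOfPrime hS hmem (sub_nonpos.2 hk)
  have h3 := add_mem_coneOfPrime hS h1 h2
  have h4 : k • (γ, (0 : M)) + (-δ - k • γ, (0 : M)) = 0 - (δ, (0 : M)) :=
    Prod.ext (by simp) (by simp)
  rw [h4] at h3
  exact hB' h3

theorem isTermCone_coneOfPrime (hS : IsSubsemifield S) (hP : IsPrimeCon P)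
    (hc : @Continuous _ _ (algebraTopology S (AddMonoidAlgebra S M)) (semifieldTopology (Kappa P))
      (toKappa P)) : IsTermCone (valueSubgroup hS) (coneOfPrime hS P) where
  fst_mem := fun _ ⟨h, _⟩ => h
  add_mem _ ha _ hb := add_mem_coneOfPrime hS ha hb
  total _ ha := hP.mem_or_neg_mem hS ha
  const_mem_iff _ hγ := hP.const_mem_iff hS hc hγ
  exists_mem u := by
    obtain ⟨B, hB⟩ := hP.exists_const_lt hS hc (a := (0, -u)) (valueSubgroup hS).zero_mem
    obtain ⟨γ, hγ, hlt⟩ := exists_mem_lt (valueSubgroup_nontrivial hS) B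
    have h := (hB γ hγ hlt).1
    have h1 : (γ, (0 : M)) - (0, -u) = (γ, u) := Prod.ext (by simp) (by simp)
    rw [h1] at h
    exact ⟨γ, hγ, h⟩

/-- A prime whose terms `≤ 1` form a term cone lies in `Cont_S S[M]`. -/
theorem mem_contSpec_of_isTermCone (hS : IsSubsemifield S) (hP : IsPrimeCon P)
    (hN : IsTermCone (valueSubgroup hS) (coneOfPrime hS P)) :
    P ∈ ContSpec S (AddMonoidAlgebra S M) := by
  have hconst : ∀ {γ δ : ℝ} (hγ : γ ∈ valueSubgroup hS) (hδ : δ ∈ valueSubgroup hS),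
      PLE P (term hS (γ, (0 : M)) hγ) (term hS (δ, (0 : M)) hδ) ↔ γ ≤ δ := by
    intro γ δ hγ hδ
    rw [term_ple_iff]
    simp only [Prod.mk_sub_mk, sub_zero]
    rw [hN.const_mem_iff _ ((valueSubgroup hS).sub_mem hγ hδ), sub_nonpos]
  have hrefl : ∀ q : P.Quotient, CanLE q q := add_self_of_one (one_add_one_quotient P)
  refine ⟨hP, ?_, (hP.continuous_iff hS).2 fun a ha => ?_⟩
  · have hinf : Infinite (valueSubgroup hS) := by
      refine Set.Infinite.to_subtype (s := (valueSubgroup hS : Set ℝ))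
        (Set.infinite_of_not_bddBelow ?_)
      rintro ⟨B, hB⟩
      obtain ⟨γ, hγ, hlt⟩ := exists_mem_lt (valueSubgroup_nontrivial hS) B
      exact absurd (hB hγ) (not_le.2 hlt)
    refine Infinite.of_injective
      (fun γ : valueSubgroup hS => (term hS ((γ : ℝ), (0 : M)) γ.2 : P.Quotient)) ?_
    intro γ δ h
    change (term hS ((γ : ℝ), (0 : M)) γ.2 : P.Quotient) = term hS ((δ : ℝ), (0 : M)) δ.2 at h
    refine Subtype.ext (le_antisymm ((hconst γ.2 δ.2).1 ?_) ((hconst δ.2 γ.2).1 ?_))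
    · show CanLE _ _
      rw [h]; exact hrefl _
    · show CanLE _ _
      rw [h]; exact hrefl _
  · obtain ⟨δ, hδ, hmem⟩ := hN.exists_mem (-a.2)
    have hδa : δ + a.1 ∈ valueSubgroup hS := (valueSubgroup hS).add_mem hδ ha
    have hle : PLE P (term hS (δ + a.1, (0 : M)) hδa) (term hS a ha) := by
      rw [term_ple_iff]
      convert hmem using 1
      exact Prod.ext (by simp) (by simp)
    refine ⟨⟨texp (δ + a.1), hδa⟩, fun h => texp_ne_zero _ (congrArg Subtype.val h),
      fun x hx hne => ?_⟩
    rcases eq_or_ne x 0 with rfl | hx0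
    · rw [AddMonoidAlgebra.single_zero]
      exact ⟨canLE_zero_left _, (hP.term_ne_zero ha).symm⟩
    · have hx0' : (x : Trop) ≠ 0 := by simpa using hx0
      rw [single_eq_term hS hx0]
      have hxe : x = ⟨texp (tlog x), tlog_mem hS hx0⟩ := Subtype.ext (texp_tlog hx0').symm
      rw [hxe, canLE_subsemiring_texp hS (tlog_mem hS hx0) hδa] at hx
      have h1 := (hconst (tlog_mem hS hx0) hδa).2 hx
      refine ⟨CanLE.trans h1 hle, fun h => hne ?_⟩
      have h2 : PLE P (term hS (δ + a.1, (0 : M)) hδa)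
          (term hS (tlog x, (0 : M)) (tlog_mem hS hx0)) := by
        unfold PLE
        rw [h]
        exact hle
      rw [hxe]
      exact Subtype.ext (congrArg texp (le_antisymm hx ((hconst hδa (tlog_mem hS hx0)).1 h2)))

end Continuity

/-! ### Primes defined by matrices -/

section Realization
variable {M : Type*} [AddCommGroup M] {S : Subsemiring Trop} {m : ℕ}

/-- The tropical semifield of the lexicographically ordered group `ℝᵐ`. -/
abbrev LexTrop (m : ℕ) : Type := Tropical (WithTop (Lex (Fin m → ℝ))ᵒᵈ)

/-- The element of the tropical semifield of `ℝᵐ` with exponent `v`. -/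
def lexp (v : Fin m → ℝ) : LexTrop m :=
  Tropical.trop ((OrderDual.toDual (toLex v) : (Lex (Fin m → ℝ))ᵒᵈ) : WithTop (Lex (Fin m → ℝ))ᵒᵈ)

theorem lexp_add (v w : Fin m → ℝ) : lexp (v + w) = lexp v * lexp w := rfl

theorem lexp_zero : lexp (0 : Fin m → ℝ) = 1 := rfl

theorem lexp_add_eq_iff {v w : Fin m → ℝ} : lexp v + lexp w = lexp v ↔ LexNonpos (w - v) := by
  rw [Tropical.add_eq_left_iff, ← Tropical.untrop_le_iff, ← toLex_le_toLex_iff_lexNonpos]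
  exact WithTop.coe_le_coe

theorem LexTrop.mul_left_cancel {x y z : LexTrop m} (hx : x ≠ 0) (h : x * y = x * z) : y = z := by
  induction x using Tropical.tropRec with
  | h X =>
    induction X using WithTop.recTopCoe with
    | top => exact absurd rfl hx
    | coe a =>
      have h1 := congrArg Tropical.untrop h
      rw [Tropical.untrop_mul, Tropical.untrop_mul] at h1
      exact Tropical.untrop_injective (WithTop.add_left_cancel WithTop.coe_ne_top h1)

/-- The homomorphism `t^γ ↦ γ v₀` of tropical semifields for a vector `v₀` that is
lexicographically nonnegative. -/
noncomputable def lexScalar (S : Subsemiring Trop) (v₀ : Fin m → ℝ) (hv₀ : LexNonpos (-v₀)) :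
    S →+* LexTrop m := by
  classical
  exact
  { toFun := fun x => if x = 0 then 0 else lexp (tlog x • v₀)
    map_zero' := if_pos rfl
    map_one' := by
      have h1 : (1 : S) ≠ 0 := fun h => one_ne_zero (congrArg Subtype.val h)
      rw [if_neg h1]
      have : tlog ((1 : S) : Trop) = 0 := rfl
      rw [this, zero_smul, lexp_zero]
    map_mul' := fun x y => by
      rcases eq_or_ne x 0 with rfl | hx
      · simp
      rcases eq_or_ne y 0 with rfl | hy
      · simp
      have hx' : (x : Trop) ≠ 0 := by simpa using hx
      have hy' : (y : Trop) ≠ 0 := by simpa using hy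
      have h : ((x * y : S) : Trop) = texp (tlog x + tlog y) := by
        rw [texp_add, texp_tlog hx', texp_tlog hy']; rfl
      have hxy : x * y ≠ 0 := fun h0 => texp_ne_zero _ (h.symm.trans (congrArg Subtype.val h0))
      rw [if_neg hx, if_neg hy, if_neg hxy, h, tlog_texp, add_smul, lexp_add]
    map_add' := fun x y => by
      have key : ∀ x y : S, CanLE y x → (if x + y = 0 then 0 else lexp (tlog (x + y : S) • v₀)) =
          (if x = 0 then 0 else lexp (tlog x • v₀)) +
            (if y = 0 then 0 else lexp (tlog y • v₀)) := by
        intro x y hle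
        have hle' : x + y = x := hle
        rw [hle']
        rcases eq_or_ne x 0 with rfl | hx
        · rw [zero_add] at hle'
          simp [hle']
        rcases eq_or_ne y 0 with rfl | hy
        · simp
        have hx' : (x : Trop) ≠ 0 := by simpa using hx
        have hy' : (y : Trop) ≠ 0 := by simpa using hy
        have h1 : tlog y ≤ tlog x := by
          rw [← canLE_texp, texp_tlog hx', texp_tlog hy']
          exact congrArg Subtype.val hle'
        rw [if_neg hx, if_neg hy, eq_comm, lexp_add_eq_iff, ← sub_smul]
        intro i hi
        have hv : ∀ j, (∀ k < j, v₀ k = 0) → 0 ≤ v₀ j := fun j hj => by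
          have := hv₀ j fun k hk => by simp [hj k hk]
          simpa using this
        rcases (sub_nonpos.2 h1).lt_or_eq with h2 | h2
        · have : 0 ≤ v₀ i := hv i fun k hk => by
            have := hi k hk
            simpa [h2.ne] using this
          simpa using mul_nonpos_of_nonpos_of_nonneg h2.le this
        · simp [h2]
      rcases canLE_total_subsemiring x y with h | h
      · rw [add_comm x y, key y x h, add_comm]
      · exact key x y h }

theorem lexScalar_texp {v₀ : Fin m → ℝ} (hv₀ : LexNonpos (-v₀)) {γ : ℝ} (h : texp γ ∈ S) :
    lexScalar S v₀ hv₀ ⟨texp γ, h⟩ = lexp (γ • v₀) := by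
  classical
  have h1 : (⟨texp γ, h⟩ : S) ≠ 0 := fun h0 => texp_ne_zero _ (congrArg Subtype.val h0)
  have h2 : lexScalar S v₀ hv₀ ⟨texp γ, h⟩ = if (⟨texp γ, h⟩ : S) = 0 then 0
    else lexp (tlog (texp γ) • v₀) := rfl
  rw [h2, if_neg h1, tlog_texp]

/-- The valuation of `S[M]` with values in the tropical semifield of `ℝᵐ` given by `m` rows. -/
noncomputable def rowValuation (w : Fin m → ℝ × NR M) (hw : LexNonpos (-fun i => (w i).1)) :
    AddMonoidAlgebra S M →+* LexTrop m :=
  AddMonoidAlgebra.liftNCRingHom (lexScalar S (fun i => (w i).1) hw)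
    { toFun := fun u => lexp fun i => (w i).2 u.toAdd
      map_one' := by
        rw [← lexp_zero]; congr 1; ext i; simp
      map_mul' := fun u v => by
        rw [← lexp_add]; congr 1; ext i; simp }
    fun _ _ => Commute.all _ _

theorem rowValuation_term (hS : IsSubsemifield S) (w : Fin m → ℝ × NR M)
    (hw : LexNonpos (-fun i => (w i).1)) {a : ℝ × M} (ha : a.1 ∈ valueSubgroup hS) :
    rowValuation w hw (term hS a ha) = lexp (rowValue w a) := by
  rw [rowValuation, term, AddMonoidAlgebra.liftNCRingHom_single]
  refine (congrArg (· * _) (lexScalar_texp hw ha)).trans ?_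
  show lexp _ * lexp _ = _
  rw [← lexp_add]
  congr 1
  ext i
  simp [rowValue, mul_comm]

/-- The congruence of polynomials with the same lexicographic value is prime. -/
theorem isPrimeCon_ker_rowValuation (w : Fin m → ℝ × NR M) (hw : LexNonpos (-fun i => (w i).1)) :
    IsPrimeCon (RingCon.ker (rowValuation (S := S) w hw)) := by
  set v := rowValuation (S := S) w hw
  have hrel : ∀ f g : AddMonoidAlgebra S M,
      ((f : (RingCon.ker v).Quotient) = g) ↔ v f = v g := fun f g => by
    rw [RingCon.eq, RingCon.ker_apply]
  refine ⟨fun h => ?_, fun a b => ?_, fun a b c ha h => ?_⟩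
  · have : RingCon.ker v 0 1 := h ▸ trivial
    rw [RingCon.ker_apply, map_zero, map_one] at this
    exact zero_ne_one this
  · obtain ⟨f, rfl⟩ := RingCon.mk'_surjective _ a
    obtain ⟨g, rfl⟩ := RingCon.mk'_surjective _ b
    rcases le_total (v f) (v g) with h | h
    · right
      exact (hrel (f + g) f).2 (by rw [map_add, Tropical.add_eq_left h])
    · left
      exact (hrel (g + f) g).2 (by rw [map_add, Tropical.add_eq_left h])
  · obtain ⟨f, rfl⟩ := RingCon.mk'_surjective _ a
    obtain ⟨g, rfl⟩ := RingCon.mk'_surjective _ b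
    obtain ⟨k, rfl⟩ := RingCon.mk'_surjective _ c
    have h1 := (hrel (f * g) (f * k)).1 h
    rw [map_mul, map_mul] at h1
    refine (hrel g k).2 (LexTrop.mul_left_cancel ?_ h1)
    intro h0
    exact ha ((hrel f 0).2 (h0.trans (map_zero v).symm))

theorem coneOfPrime_ker_rowValuation (hS : IsSubsemifield S) (w : Fin m → ℝ × NR M)
    (hw : LexNonpos (-fun i => (w i).1)) :
    coneOfPrime hS (RingCon.ker (rowValuation (S := S) w hw)) = lexCone (valueSubgroup hS) w := by
  set v := rowValuation (S := S) w hw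
  have key : ∀ (a : ℝ × M) (ha : a.1 ∈ valueSubgroup hS),
      PLE (RingCon.ker v) (term hS a ha) 1 ↔ LexNonpos (rowValue w a) := by
    intro a ha
    have h1 : PLE (RingCon.ker v) (term hS a ha) 1 ↔ v (1 + term hS a ha) = v 1 := by
      rw [← RingCon.ker_apply, ← RingCon.eq]
      rfl
    rw [h1, map_add, map_one, rowValuation_term, ← lexp_zero, lexp_add_eq_iff, sub_zero]
  ext a
  exact ⟨fun ⟨ha, h⟩ => ⟨ha, (key a ha).1 h⟩, fun ⟨ha, h⟩ => ⟨ha, (key a ha).2 h⟩⟩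

/-- The prime with a lexicographic term cone is defined by the corresponding matrix. -/
theorem IsPrimeCon.isDefinedBy (hS : IsSubsemifield S) {P : RingCon (AddMonoidAlgebra S M)}
    (hP : IsPrimeCon P) {m : ℕ} {w : Fin m → ℝ × NR M}
    (hw : coneOfPrime hS P = lexCone (valueSubgroup hS) w) : IsDefinedBy P w := by
  have key : ∀ f g : AddMonoidAlgebra S M,
      TermLE (coneOfPrime hS P) f g ↔ matrixValue w f ≤ matrixValue w g := by
    intro f g
    rw [matrixValue, Finset.sup_le_iff]
    refine forall₂_congr fun u hu => ?_
    rw [matrixValue, Finset.le_sup_iff (WithBot.bot_lt_coe _)]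
    refine exists_congr fun v => and_congr_right fun hv => ?_
    rw [WithBot.coe_le_coe, toLex_le_toLex_iff_lexNonpos, hw, lexCone, Set.mem_ofPred_eq,
      and_iff_right ((valueSubgroup hS).sub_mem (tlog_mem hS (Finsupp.mem_support_iff.1 hu))
        (tlog_mem hS (Finsupp.mem_support_iff.1 hv)))]
    refine iff_of_eq (congrArg _ ?_)
    ext i
    simp only [rowValue, Pi.sub_apply, map_sub]
    ring
  intro f g
  rw [hP.rel_iff (hS := hS), key, key]
  exact ⟨fun h => le_antisymm h.1 h.2, fun h => ⟨h.le, h.ge⟩⟩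

variable [Module.Finite ℤ M]

/-- The points of `Cont_S S[M]` correspond to term cones. -/
noncomputable def contSpecEquivCone (hS : IsSubsemifield S) :
    ContSpec S (AddMonoidAlgebra S M) ≃
      {N : Set (ℝ × M) // IsTermCone (valueSubgroup hS) N} :=
  Equiv.ofBijective (fun P => ⟨coneOfPrime hS P.1, isTermCone_coneOfPrime hS P.2.1 P.2.2.2⟩) <| by
    constructor
    · intro P P' h
      have h' : coneOfPrime hS P.1 = coneOfPrime hS P'.1 := congrArg Subtype.val h
      apply Subtype.ext
      ext f g
      rw [P.2.1.rel_iff (hS := hS), P'.2.1.rel_iff (hS := hS), h']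
    · rintro ⟨N, hN⟩
      obtain ⟨k, ξ₀, ξ, -, rfl⟩ := hN.eq_lexCone (valueSubgroup_nontrivial hS)
      have hw : LexNonpos (-fun i => (weightRows ξ₀ ξ i).1) := by
        intro i _
        induction i using Fin.cases <;> simp [weightRows]
      have hcone := coneOfPrime_ker_rowValuation hS (weightRows ξ₀ ξ) hw
      exact ⟨⟨_, mem_contSpec_of_isTermCone hS (isPrimeCon_ker_rowValuation _ hw)
        (hcone.symm ▸ hN)⟩, Subtype.ext hcone⟩

end Realization

/-! ### The filter of a prime -/

section FilterOfPrime
variable {M : Type*} [AddCommGroup M] {S : Subsemiring Trop}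

theorem evalAt_term (hS : IsSubsemifield S) {a : ℝ × M} (ha : a.1 ∈ valueSubgroup hS) (x : NR M) :
    evalAt (term hS a ha) x = texp (a.1 + x a.2) := by
  rw [evalAt, term, AddMonoidAlgebra.coeff_single, Finsupp.sum_single_index]
  · rw [texp_add]
  · exact zero_mul _

/-- The filter `F_P` consists of the polyhedral sets containing a polyhedron cut out by finitely
many terms that are at most `1` modulo `P`. -/
theorem IsPrimeCon.mem_filterOfPrime_iff (hS : IsSubsemifield S)
    {P : RingCon (AddMonoidAlgebra S M)} (hP : IsPrimeCon P)
    (U : polyhedralLattice (valueGroup S) M) : U ∈ filterOfPrime P ↔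
      ∃ I : Set (ℝ × M), I.Finite ∧ I ⊆ coneOfPrime hS P ∧
        ⋂ a ∈ I, halfSpace a ⊆ (U : Set (NR M)) := by
  classical
  constructor
  · rintro ⟨f₀, fs, hfs, hU⟩
    have hle : ∀ f ∈ fs, TermLE (coneOfPrime hS P) f f₀ := fun f hf => (hP.ple_iff _ _).1 (hfs f hf)
    choose! v hv hvP using hle
    refine ⟨⋃ f ∈ fs, (fun u => (tlog (f.coeff u) - tlog (f₀.coeff (v f u)), u - v f u)) ''
      (f.coeff.support : Set M), ?_, ?_, ?_⟩
    · exact fs.finite_toSet.biUnion fun f _ => f.coeff.support.finite_toSet.image _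
    · intro a ha
      obtain ⟨f, hf, u, hu, rfl⟩ := Set.mem_iUnion₂.1 ha
      exact hvP f hf u hu
    · refine subset_trans (fun x hx => ?_) hU
      intro f hf
      refine canLE_sum fun u hu => ?_
      have h1 : tlog (f.coeff u) - tlog (f₀.coeff (v f u)) + x (u - v f u) ≤ 0 :=
        Set.mem_iInter₂.1 hx _ (Set.mem_iUnion₂.2 ⟨f, hf, u, hu, rfl⟩)
      have h2 : ∀ (f : AddMonoidAlgebra S M), ∀ u ∈ f.coeff.support,
          (f.coeff u : Trop) * texp (x u) = texp (tlog (f.coeff u) + x u) := by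
        intro f u hu
        have : (f.coeff u : Trop) ≠ 0 := by simpa using Finsupp.mem_support_iff.1 hu
        rw [texp_add, texp_tlog this]
      refine CanLE.trans (b := (f₀.coeff (v f u) : Trop) * texp (x (v f u))) ?_
        (canLE_sum_of_mem (Tropical.add_self 1) _ (hv f hf u hu))
      beta_reduce
      rw [h2 f u hu, h2 f₀ _ (hv f hf u hu), canLE_texp]
      rw [map_sub] at h1
      linarith
  · rintro ⟨I, hI, hIP, hIU⟩
    have hIΓ : ∀ a ∈ I, a.1 ∈ valueSubgroup hS := fun a ha => (hIP ha).1
    refine ⟨1, hI.toFinset.attach.image fun a => term hS a.1 (hIΓ _ (hI.mem_toFinset.1 a.2)),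
      ?_, subset_trans ?_ hIU⟩
    · intro f hf
      obtain ⟨⟨a, ha⟩, -, rfl⟩ := Finset.mem_image.1 hf
      obtain ⟨h, hle⟩ := hIP (hI.mem_toFinset.1 ha)
      exact hle
    · intro x hx
      refine Set.mem_iInter₂.2 fun a ha => ?_
      have := hx _ (Finset.mem_image.2 ⟨⟨a, hI.mem_toFinset.2 ha⟩, Finset.mem_attach _ _, rfl⟩)
      rw [evalAt_term, ← term_zero hS, evalAt_term, canLE_texp] at this
      simpa [halfSpace] using this

end FilterOfPrime

/-! ### Relative interiors of convex sets -/

section RelativeInterior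
variable {V : Type*} [AddCommGroup V] [Module ℝ V] [TopologicalSpace V]

theorem mem_intrinsicInterior_iff_exists_isOpen {P : Set V} {x : V} :
    x ∈ intrinsicInterior ℝ P ↔
      x ∈ P ∧ ∃ U, IsOpen U ∧ x ∈ U ∧ U ∩ affineSpan ℝ P ⊆ P := by
  rw [mem_intrinsicInterior]
  constructor
  · rintro ⟨y, hy, rfl⟩
    refine ⟨interior_subset (s := Subtype.val ⁻¹' P) hy, ?_⟩
    obtain ⟨W, hW, hWo, hyW⟩ := mem_interior.1 hy
    obtain ⟨U, hU, rfl⟩ := isOpen_induced_iff.1 hWo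
    exact ⟨U, hU, hyW, fun z hz => hW (a := ⟨z, hz.2⟩) hz.1⟩
  · rintro ⟨hx, U, hU, hxU, hUP⟩
    refine ⟨⟨x, subset_affineSpan ℝ P hx⟩, mem_interior.2
      ⟨_, ?_, hU.preimage continuous_subtype_val, hxU⟩, rfl⟩
    exact fun z hz => hUP ⟨hz, z.2⟩

variable [IsTopologicalAddGroup V] [ContinuousSMul ℝ V]

/-- A segment from a point of a convex set to a relative interior point stays in the relative
interior, except possibly at its start. -/
theorem add_smul_mem_intrinsicInterior {P : Set V} (hP : Convex ℝ P) {x z : V}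
    (hx : x ∈ intrinsicInterior ℝ P) (hz : z ∈ P) {s : ℝ} (hs : 0 < s) (hs1 : s ≤ 1) :
    (1 - s) • z + s • x ∈ intrinsicInterior ℝ P := by
  rw [mem_intrinsicInterior_iff_exists_isOpen] at hx ⊢
  obtain ⟨hxP, U, hU, hxU, hUP⟩ := hx
  refine ⟨hP hz hxP (by linarith) hs.le (by ring),
    (fun q => s⁻¹ • (q - (1 - s) • z)) ⁻¹' U, hU.preimage (by fun_prop), ?_, ?_⟩
  · simpa [smul_smul, inv_mul_cancel₀ hs.ne'] using hxU
  · rintro q ⟨hq, hqP⟩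
    have hline : s⁻¹ • (q - (1 - s) • z) = AffineMap.lineMap z q s⁻¹ := by
      rw [AffineMap.lineMap_apply_module']
      match_scalars <;> field_simp
      ring
    have hmem : s⁻¹ • (q - (1 - s) • z) ∈ P := hUP ⟨hq, by
      rw [hline]
      exact AffineMap.lineMap_mem _ (subset_affineSpan ℝ P hz) hqP⟩
    have := hP hz hmem (by linarith : 0 ≤ 1 - s) hs.le (by ring)
    rwa [smul_smul, mul_inv_cancel₀ hs.ne', one_smul, add_sub_cancel] at this

/-- A segment that ends in a relative interior point can be prolonged beyond it. -/
theorem exists_add_smul_sub_mem {P : Set V} {x y : V} (hx : x ∈ intrinsicInterior ℝ P)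
    (hy : y ∈ P) : ∃ t : ℝ, 0 < t ∧ x + t • (x - y) ∈ P := by
  obtain ⟨hxP, U, hU, hxU, hUP⟩ := mem_intrinsicInterior_iff_exists_isOpen.1 hx
  have hc : Continuous fun t : ℝ => x + t • (x - y) := by fun_prop
  have h : ∀ᶠ t : ℝ in 𝓝[>] 0, x + t • (x - y) ∈ U :=
    (hc.tendsto' 0 x (by simp)).mono_left nhdsWithin_le_nhds (hU.mem_nhds hxU)
  obtain ⟨t, htU, ht⟩ := (h.and self_mem_nhdsWithin).exists
  refine ⟨t, ht, hUP ⟨htU, ?_⟩⟩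
  have : x + t • (x - y) = AffineMap.lineMap y x (1 + t) := by
    rw [AffineMap.lineMap_apply_module']; module
  rw [this]
  exact AffineMap.lineMap_mem _ (subset_affineSpan ℝ P hy) (subset_affineSpan ℝ P hxP)

/-- A linear functional that attains its maximum over `P` at a relative interior point is constant
on `P`. -/
theorem eq_of_mem_intrinsicInterior {P : Set V} {l : V →ₗ[ℝ] ℝ} {x y : V}
    (hx : x ∈ intrinsicInterior ℝ P) (hmax : ∀ y ∈ P, l y ≤ l x) (hy : y ∈ P) : l y = l x := by
  refine (hmax y hy).antisymm ?_
  obtain ⟨t, ht, hmem⟩ := exists_add_smul_sub_mem hx hy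
  have := hmax _ hmem
  rw [map_add, map_smul, map_sub, smul_eq_mul] at this
  have h2 : t * (l x - l y) ≤ 0 := by linarith
  linarith [nonpos_of_mul_nonpos_right h2 ht]

theorem intrinsicInterior_nonempty_of_convex [T2Space V] [FiniteDimensional ℝ V] {P : Set V}
    (hP : Convex ℝ P) (hne : P.Nonempty) : (intrinsicInterior ℝ P).Nonempty := by
  let e : V ≃L[ℝ] _ := toEuclidean
  have h : (intrinsicInterior ℝ (e '' P)).Nonempty :=
    (hne.image e).intrinsicInterior (hP.linear_image e.toLinearEquiv.toLinearMap)
  have h2 := (e.toContinuousAffineEquiv).intrinsicInterior_image P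
  rw [show e.toContinuousAffineEquiv '' P = e '' P from rfl] at h2
  rw [h2] at h
  exact h.of_image

end RelativeInterior

/-! ### Topology of the space of functionals -/

section TopologyNR
variable {M : Type*} [AddCommGroup M]

/-- The inclusion of `N_ℝ` in the space of all functions on `M`. -/
def coeFnLin (M : Type*) [AddCommGroup M] : NR M →ₗ[ℝ] (M → ℝ) where
  toFun x := x
  map_add' _ _ := rfl
  map_smul' _ _ := rfl

instance : IsTopologicalAddGroup (NR M) := topologicalAddGroup_induced (coeFnLin M)

instance : ContinuousSMul ℝ (NR M) := continuousSMul_induced (coeFnLin M)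

instance : T2Space (NR M) :=
  (Topology.IsEmbedding.mk (Topology.IsInducing.mk rfl) DFunLike.coe_injective :
    Topology.IsEmbedding (fun x : NR M => (x : M → ℝ))).t2Space

instance [Module.Finite ℤ M] : FiniteDimensional ℝ (NR M) := by
  obtain ⟨s, hs⟩ := Module.Finite.fg_top (R := ℤ) (M := M)
  refine FiniteDimensional.of_injective (LinearMap.pi fun u : s => evalLin (u : M)) fun x y h => ?_
  have : (x.toIntLinearMap) = y.toIntLinearMap := by
    refine LinearMap.ext_on hs fun u hu => ?_
    exact congrFun h ⟨u, hu⟩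
  ext u
  exact LinearMap.congr_fun this u

end TopologyNR

/-! ### Cones over polyhedra -/

section ConeOver
variable {M : Type*} [AddCommGroup M]

theorem IsPolyhedron.convex {P : Set (NR M)} (hP : IsPolyhedron P) : Convex ℝ P := by
  obtain ⟨I, rfl⟩ := hP
  intro x hx y hy a b ha hb hab p hp
  rw [map_add, map_smul, map_smul, smul_eq_mul, smul_eq_mul]
  calc a * p.1 x + b * p.1 y ≤ a * p.2 + b * p.2 :=
        add_le_add (mul_le_mul_of_nonneg_left (hx p hp) ha) (mul_le_mul_of_nonneg_left (hy p hp) hb)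
    _ = p.2 := by rw [← add_mul, hab, one_mul]

theorem coneOver_mono {P Q : Set (NR M)} (h : P ⊆ Q) : coneOver P ⊆ coneOver Q :=
  closure_mono fun _ ⟨r, hr, x, hx, e⟩ => ⟨r, hr, x, h hx, e⟩

theorem mk_one_mem_coneOver {P : Set (NR M)} {x : NR M} (hx : x ∈ P) :
    ((1 : ℝ), x) ∈ coneOver P :=
  subset_closure ⟨1, zero_le_one, x, hx, by rw [one_smul]⟩

theorem fst_nonneg_of_mem_coneOver {P : Set (NR M)} {w : ℝ × NR M} (hw : w ∈ coneOver P) :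
    0 ≤ w.1 := by
  refine closure_minimal ?_ (isClosed_le continuous_const continuous_fst) hw
  rintro _ ⟨r, hr, x, hx, rfl⟩
  exact hr

variable [Module.Finite ℤ M]

/-- A linear inequality between `w.1` and `w.2` that holds on `{1} × P` holds on the cone. -/
theorem le_of_mem_coneOver {P : Set (NR M)} {l : NR M →ₗ[ℝ] ℝ} {c : ℝ} (h : ∀ x ∈ P, l x ≤ c)
    {w : ℝ × NR M} (hw : w ∈ coneOver P) : l w.2 ≤ w.1 * c := by
  have hl := l.continuous_of_finiteDimensional
  have hcl : IsClosed {w : ℝ × NR M | l w.2 ≤ w.1 * c} :=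
    isClosed_le (hl.comp continuous_snd) (by fun_prop)
  refine closure_minimal ?_ hcl hw
  rintro _ ⟨r, hr, x, hx, rfl⟩
  simpa using mul_le_mul_of_nonneg_left (h x hx) hr

theorem sub_smul_mem_vectorSpan_of_mem_coneOver {P : Set (NR M)} {x₀ : NR M} (hx₀ : x₀ ∈ P)
    {w : ℝ × NR M} (hw : w ∈ coneOver P) : w.2 - w.1 • x₀ ∈ vectorSpan ℝ P := by
  have hcl : IsClosed {w : ℝ × NR M | w.2 - w.1 • x₀ ∈ vectorSpan ℝ P} :=
    (Submodule.closed_of_finiteDimensional (vectorSpan ℝ P)).preimage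
      (f := fun w : ℝ × NR M => w.2 - w.1 • x₀) (by fun_prop)
  refine closure_minimal ?_ hcl hw
  rintro _ ⟨r, hr, x, hx, rfl⟩
  simp only [Set.mem_ofPred_eq, ← smul_sub]
  exact Submodule.smul_mem _ _ (vsub_mem_vectorSpan ℝ hx hx₀)

/-- The cone over a non-empty polyhedron is cut out by the homogenized inequalities. -/
theorem coneOver_eq {I : Finset ((NR M →ₗ[ℝ] ℝ) × ℝ)}
    (hne : {x : NR M | ∀ p ∈ I, p.1 x ≤ p.2}.Nonempty) :
    coneOver {x : NR M | ∀ p ∈ I, p.1 x ≤ p.2} =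
      {w | 0 ≤ w.1 ∧ ∀ p ∈ I, p.1 w.2 ≤ w.1 * p.2} := by
  refine Set.Subset.antisymm (fun w hw => ⟨fst_nonneg_of_mem_coneOver hw, fun p hp =>
    le_of_mem_coneOver (fun x (hx : ∀ p ∈ I, p.1 x ≤ p.2) => hx p hp) hw⟩) ?_
  rintro ⟨r, x⟩ ⟨hr, hx⟩
  obtain ⟨x₀, hx₀⟩ := hne
  -- approximate `(r, x)` by its translates along `(1, x₀)`
  have hc : Continuous fun ε : ℝ => (r + ε, x + ε • x₀) := by fun_prop
  have hlim : Tendsto (fun ε : ℝ => (r + ε, x + ε • x₀)) (𝓝[>] 0) (𝓝 (r, x)) :=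
    (hc.tendsto' 0 (r, x) (by simp)).mono_left nhdsWithin_le_nhds
  refine mem_closure_of_tendsto hlim (eventually_mem_nhdsWithin.mono fun ε hε => ?_)
  have hε : 0 < ε := hε
  have hpos : 0 < r + ε := by have : 0 ≤ r := hr; linarith
  refine ⟨r + ε, hpos.le, (r + ε)⁻¹ • (x + ε • x₀), fun p hp => ?_, ?_⟩
  · rw [map_smul, smul_eq_mul, inv_mul_le_iff₀ hpos, map_add, map_smul, smul_eq_mul, add_mul]
    exact add_le_add (hx p hp) (mul_le_mul_of_nonneg_left (hx₀ p hp) hε.le)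
  · rw [smul_smul, mul_inv_cancel₀ hpos.ne', one_smul]

/-- The cone over a non-empty face is cut out by the homogenized equation of the face. -/
theorem mem_coneOver_of_face {P F : Set (NR M)} (hP : IsPolyhedron P) {l : NR M →ₗ[ℝ] ℝ} {c : ℝ}
    (hF : F = {x ∈ P | l x = c}) (hne : F.Nonempty) {w : ℝ × NR M} (hw : w ∈ coneOver P)
    (hlw : l w.2 = w.1 * c) : w ∈ coneOver F := by
  classical
  obtain ⟨I, rfl⟩ := hP
  have hF' : F = {x | ∀ p ∈ I ∪ {(l, c), (-l, -c)}, p.1 x ≤ p.2} := by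
    rw [hF]
    ext x
    simp only [Set.mem_ofPred_eq, Finset.mem_union, Finset.mem_insert, Finset.mem_singleton]
    constructor
    · rintro ⟨h, h'⟩ p (hp | rfl | rfl)
      · exact h p hp
      · exact h'.le
      · simpa using h'.ge
    · intro h
      refine ⟨fun p hp => h p (Or.inl hp), (h (l, c) (by simp)).antisymm ?_⟩
      simpa using h (-l, -c) (by simp)
  have hPne : {x : NR M | ∀ p ∈ I, p.1 x ≤ p.2}.Nonempty := by
    rw [hF] at hne
    exact hne.mono fun x hx => hx.1
  rw [coneOver_eq hPne] at hw
  rw [hF'] at hne ⊢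
  rw [coneOver_eq hne]
  refine ⟨hw.1, fun p hp => ?_⟩
  simp only [Finset.mem_union, Finset.mem_insert, Finset.mem_singleton] at hp
  rcases hp with hp | rfl | rfl
  · exact hw.2 p hp
  · exact hlw.le
  · simpa using hlw.ge

/-- The linear span of the cone over `P` has dimension at most `dim P + 1`. -/
theorem finrank_span_coneOver_le {P : Set (NR M)} (hP : P.Nonempty) :
    Module.finrank ℝ (Submodule.span ℝ (coneOver P)) ≤
      Module.finrank ℝ (vectorSpan ℝ P) + 1 := by
  obtain ⟨x₀, hx₀⟩ := hP
  have hle : Submodule.span ℝ (coneOver P) ≤ (vectorSpan ℝ P).map (LinearMap.inr ℝ ℝ (NR M)) ⊔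
      Submodule.span ℝ {((1 : ℝ), x₀)} := by
    refine Submodule.span_le.2 fun w hw => ?_
    refine Submodule.mem_sup.2 ⟨(0, w.2 - w.1 • x₀), ⟨_,
      sub_smul_mem_vectorSpan_of_mem_coneOver hx₀ hw, rfl⟩, w.1 • (1, x₀),
      Submodule.smul_mem _ _ (Submodule.mem_span_singleton_self _), ?_⟩
    ext <;> simp
  refine (Submodule.finrank_mono hle).trans
    ((Submodule.finrank_add_le_finrank_add_finrank _ _).trans (add_le_add (Submodule.finrank_map_le _ _) ?_))
  simpa using finrank_span_le_card (R := ℝ) ({((1 : ℝ), x₀)} : Set (ℝ × NR M))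

end ConeOver

/-! ### The term cone of a flag -/

section Adapted
variable {M : Type*} [AddCommGroup M]

theorem IsFaceOf.subset {F P : Set (NR M)} (h : IsFaceOf F P) : F ⊆ P := by
  obtain ⟨l, c, -, rfl⟩ := h
  exact fun x hx => hx.1

theorem PolyFlag.cell_mono (F : PolyFlag M) : Monotone F.cell :=
  Fin.monotone_iff_le_succ.2 fun j => (F.face j).subset

theorem PolyFlag.coneOver_subset_prevCone (F : PolyFlag M) {i j : Fin (F.length + 1)}
    (h : j < i) : coneOver (F.cell j) ⊆ F.prevCone i := by
  induction i using Fin.cases with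
  | zero => exact absurd h (Fin.not_lt_zero j)
  | succ i => exact coneOver_mono (F.cell_mono (Fin.le_castSucc_iff.2 h))

/-- The pairing of `ℝ × N_ℝ` with the term `t^γ χ^u`. -/
def termPairing (a : ℝ × M) : ℝ × NR M →ₗ[ℝ] ℝ where
  toFun w := w.1 * a.1 + w.2 a.2
  map_add' v w := by simp; ring
  map_smul' c w := by simp; ring

variable [Module.Finite ℤ M]

/-- The cone `C_{i-1}` is the face of `C_i` cut out by a linear functional. -/
theorem PolyFlag.exists_functional (F : PolyFlag M) (i : Fin (F.length + 1)) :
    ∃ L : ℝ × NR M →ₗ[ℝ] ℝ, (∀ w ∈ coneOver (F.cell i), L w ≤ 0) ∧ (∀ w ∈ F.prevCone i, L w = 0) ∧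
      ∀ w ∈ coneOver (F.cell i), L w = 0 → w ∈ F.prevCone i := by
  induction i using Fin.cases with
  | zero =>
    -- `cell 0` is a point, and the cone over it is a ray on which the first coordinate is injective
    obtain ⟨x₀, hx₀⟩ := F.nonempty 0
    refine ⟨-LinearMap.fst ℝ ℝ (NR M), fun w hw => ?_, fun w hw => ?_, fun w hw h => ?_⟩
    · simpa using fst_nonneg_of_mem_coneOver hw
    · rw [show w = 0 from hw, map_zero]
    · have h0 : vectorSpan ℝ (F.cell 0) = ⊥ := Submodule.finrank_eq_zero.1 (F.dim 0)
      have h1 := sub_smul_mem_vectorSpan_of_mem_coneOver hx₀ hw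
      have h2 : w.1 = 0 := by simpa using h
      rw [h0, Submodule.mem_bot, h2, zero_smul, sub_zero] at h1
      exact Prod.ext h2 h1
  | succ j =>
    obtain ⟨l, c, hle, hF⟩ := F.face j
    refine ⟨l.comp (LinearMap.snd ℝ ℝ (NR M)) - c • LinearMap.fst ℝ ℝ (NR M),
      fun w hw => ?_, fun w hw => ?_, fun w hw h => ?_⟩
    · have := le_of_mem_coneOver hle hw
      simp only [LinearMap.sub_apply, LinearMap.comp_apply, LinearMap.snd_apply,
        LinearMap.smul_apply, LinearMap.fst_apply, smul_eq_mul]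
      linarith
    · have hw : w ∈ coneOver (F.cell j.castSucc) := hw
      rw [hF] at hw
      have h1 := le_of_mem_coneOver (fun x hx => hx.2.le) hw
      have h2 := le_of_mem_coneOver (l := -l) (c := -c) (fun x hx => by simpa using hx.2.ge) hw
      simp only [LinearMap.neg_apply] at h2
      simp only [LinearMap.sub_apply, LinearMap.comp_apply, LinearMap.snd_apply,
        LinearMap.smul_apply, LinearMap.fst_apply, smul_eq_mul]
      linarith
    · refine mem_coneOver_of_face (F.polyhedron _) hF (F.nonempty _) hw ?_
      simp only [LinearMap.sub_apply, LinearMap.comp_apply, LinearMap.snd_apply,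
        LinearMap.smul_apply, LinearMap.fst_apply, smul_eq_mul] at h
      linarith

/-- The functionals of `PolyFlag.exists_functional` are triangular on adapted points. -/
theorem PolyFlag.exists_triangular (F : PolyFlag M) (i : Fin (F.length + 1)) :
    ∃ L : ℝ × NR M →ₗ[ℝ] ℝ, ∀ w, F.IsAdapted w → L (w i) < 0 ∧ ∀ j < i, L (w j) = 0 := by
  obtain ⟨L, h1, h2, h3⟩ := F.exists_functional i
  exact ⟨L, fun w hw => ⟨(h1 _ (hw i).1).lt_of_ne fun h => (hw i).2 (h3 _ (hw i).1 h),
    fun j hj => h2 _ (F.coneOver_subset_prevCone hj (hw j).1)⟩⟩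

theorem PolyFlag.IsAdapted.linearIndependent {F : PolyFlag M}
    {w : Fin (F.length + 1) → ℝ × NR M} (hw : F.IsAdapted w) : LinearIndependent ℝ w := by
  rw [Fintype.linearIndependent_iff]
  intro c hc
  by_contra! hne
  -- apply the functional that belongs to the last nonzero coefficient
  obtain ⟨i, hi, hmax⟩ := (Finset.univ.filter fun i => c i ≠ 0).exists_max_image id
    (hne.imp fun i hi => by simpa using hi)
  obtain ⟨L, hL⟩ := F.exists_triangular i
  have h := congrArg L hc
  rw [map_sum, map_zero, Finset.sum_eq_single i] at h
  · rw [map_smul, smul_eq_mul, mul_eq_zero] at h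
    exact h.elim (by simpa using hi) (hL w hw).1.ne
  · intro j _ hj
    rcases hj.lt_or_gt with hj | hj
    · rw [map_smul, (hL w hw).2 j hj, smul_zero]
    · have : c j = 0 := by
        by_contra hcj
        exact (hmax j (by simpa using hcj)).not_gt hj
      rw [this, zero_smul, map_zero]
  · simp

/-- Adapted points span the cones of the flag: they are independent, and the dimension of the
`i`-th cone is at most `i + 1`. -/
theorem PolyFlag.IsAdapted.span_eq {F : PolyFlag M} {w : Fin (F.length + 1) → ℝ × NR M}
    (hw : F.IsAdapted w) (i : Fin (F.length + 1)) :
    Submodule.span ℝ (w '' Set.Iic i) = Submodule.span ℝ (coneOver (F.cell i)) := by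
  refine Submodule.eq_of_le_of_finrank_le (Submodule.span_mono ?_) ?_
  · rintro _ ⟨j, hj, rfl⟩
    exact coneOver_mono (F.cell_mono hj) (hw j).1
  · refine (finrank_span_coneOver_le (F.nonempty i)).trans ?_
    have hli : LinearIndependent ℝ fun j : Set.Iic i => w j :=
      hw.linearIndependent.comp _ Subtype.val_injective
    have := finrank_span_eq_card hli
    rw [F.dim, Set.image_eq_range, this]
    simp

theorem PolyFlag.IsAdapted.fst_pos {F : PolyFlag M} {w : Fin (F.length + 1) → ℝ × NR M}
    (hw : F.IsAdapted w) : 0 < (w 0).1 := by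
  obtain ⟨x₀, hx₀⟩ := F.nonempty 0
  refine (fst_nonneg_of_mem_coneOver (hw 0).1).lt_of_ne fun h => (hw 0).2 ?_
  have h0 : vectorSpan ℝ (F.cell 0) = ⊥ := Submodule.finrank_eq_zero.1 (F.dim 0)
  have h1 := sub_smul_mem_vectorSpan_of_mem_coneOver hx₀ (hw 0).1
  rw [h0, Submodule.mem_bot, ← h, zero_smul, sub_zero] at h1
  exact Prod.ext h.symm h1

/-- Each adapted point is, up to a positive factor and the span of the previous ones, determined by
the flag. -/
theorem PolyFlag.IsAdapted.exists_eq_smul_add {F : PolyFlag M}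
    {w w' : Fin (F.length + 1) → ℝ × NR M} (hw : F.IsAdapted w) (hw' : F.IsAdapted w')
    (i : Fin (F.length + 1)) :
    ∃ a : ℝ, 0 < a ∧ ∃ z ∈ Submodule.span ℝ (w '' Set.Iio i), w' i = a • w i + z := by
  have h : w' i ∈ Submodule.span ℝ (w '' Set.Iic i) := by
    rw [hw.span_eq]
    exact Submodule.subset_span (hw' i).1
  rw [← Set.Iio_insert, Set.image_insert_eq, Submodule.mem_span_insert] at h
  obtain ⟨a, z, hz, h⟩ := h
  obtain ⟨L, hL⟩ := F.exists_triangular i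
  have hLz : L z = 0 := by
    refine Submodule.span_induction (p := fun z _ => L z = 0) ?_ (map_zero L) ?_ ?_ hz
    · rintro _ ⟨j, hj, rfl⟩
      exact (hL w hw).2 j hj
    · intro x y _ _ hx hy
      rw [map_add, hx, hy, add_zero]
    · intro c x _ hx
      rw [map_smul, hx, smul_zero]
  have h1 := (hL w' hw').1
  rw [h, map_add, hLz, add_zero, map_smul, smul_eq_mul] at h1
  exact ⟨a, pos_of_mul_neg_left h1 (hL w hw).1.le, z, hz, h⟩

/-- The lexicographic sign of a term at adapted points does not depend on their choice, since two
choices differ by a triangular matrix with positive diagonal. -/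
theorem PolyFlag.IsAdapted.lexCone_subset {F : PolyFlag M}
    {w w' : Fin (F.length + 1) → ℝ × NR M} (hw : F.IsAdapted w) (hw' : F.IsAdapted w')
    (Γ : AddSubgroup ℝ) : lexCone Γ w ⊆ lexCone Γ w' := by
  rintro a ⟨haΓ, ha⟩
  refine ⟨haΓ, fun i hi => ?_⟩
  have hz0 : ∀ j : Fin (F.length + 1), (∀ m < j, rowValue w a m = 0) →
      ∀ z ∈ Submodule.span ℝ (w '' Set.Iio j), termPairing a z = 0 := by
    intro j hj z hz
    refine Submodule.span_induction (p := fun z _ => termPairing a z = 0) ?_ (map_zero _) ?_ ?_ hz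
    · rintro _ ⟨m, hm, rfl⟩
      exact hj m hm
    · intro x y _ _ hx hy
      rw [map_add, hx, hy, add_zero]
    · intro c x _ hx
      rw [map_smul, hx, smul_zero]
  have hval : ∀ j : Fin (F.length + 1), (∀ m < j, rowValue w a m = 0) →
      ∃ c : ℝ, 0 < c ∧ rowValue w' a j = c * rowValue w a j := by
    intro j hj
    obtain ⟨c, hc, z, hz, h⟩ := hw.exists_eq_smul_add hw' j
    refine ⟨c, hc, ?_⟩
    have := congrArg (termPairing a) h
    rw [map_add, hz0 j hj z hz, add_zero, map_smul] at this
    exact this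
  have hzero : ∀ j < i, rowValue w a j = 0 := by
    intro j
    induction j using WellFoundedLT.induction with
    | ind j ih =>
      intro hj
      obtain ⟨c, hc, h⟩ := hval j fun m hm => ih m hm (hm.trans hj)
      rw [hi j hj, eq_comm, mul_eq_zero] at h
      exact h.resolve_left hc.ne'
  obtain ⟨c, hc, h⟩ := hval i hzero
  rw [h]
  exact mul_nonpos_of_nonneg_of_nonpos hc.le (ha i hzero)

theorem PolyFlag.IsAdapted.lexCone_eq {F : PolyFlag M}
    {w w' : Fin (F.length + 1) → ℝ × NR M} (hw : F.IsAdapted w) (hw' : F.IsAdapted w')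
    (Γ : AddSubgroup ℝ) : lexCone Γ w = lexCone Γ w' :=
  (hw.lexCone_subset hw' Γ).antisymm (hw'.lexCone_subset hw Γ)

/-- Points in the relative interiors of the cells are adapted, as the relative interior of a cell is
disjoint from its proper faces. -/
theorem PolyFlag.isAdapted_of_mem_intrinsicInterior (F : PolyFlag M)
    {x : Fin (F.length + 1) → NR M} (hx : ∀ i, x i ∈ intrinsicInterior ℝ (F.cell i)) :
    F.IsAdapted fun i => (1, x i) := by
  intro i
  refine ⟨mk_one_mem_coneOver (intrinsicInterior_subset (hx i)), ?_⟩
  induction i using Fin.cases with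
  | zero => exact fun h => one_ne_zero (congrArg Prod.fst (h : ((1 : ℝ), x 0) = 0))
  | succ j =>
    intro hmem
    have hmem : ((1 : ℝ), x j.succ) ∈ coneOver (F.cell j.castSucc) := hmem
    obtain ⟨l, c, hle, hF⟩ := F.face j
    -- the supporting functional of the face would be constant on the larger cell
    have hge := le_of_mem_coneOver (l := -l) (c := -c) (fun y hy => by
      rw [hF] at hy
      simpa using hy.2.ge) hmem
    simp only [LinearMap.neg_apply, one_mul, neg_le_neg_iff] at hge
    have heq : F.cell j.castSucc = F.cell j.succ := by
      rw [hF]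
      refine Set.Subset.antisymm (fun y hy => hy.1) fun y hy => ⟨hy, (hle y hy).antisymm ?_⟩
      rwa [eq_of_mem_intrinsicInterior (hx j.succ) (fun y hy => (hle y hy).trans hge) hy]
    have h1 := F.dim j.succ
    rw [← heq, F.dim] at h1
    simp at h1

theorem PolyFlag.exists_forall_mem_intrinsicInterior (F : PolyFlag M) :
    ∃ x : Fin (F.length + 1) → NR M, ∀ i, x i ∈ intrinsicInterior ℝ (F.cell i) :=
  ⟨_, fun i =>
    (intrinsicInterior_nonempty_of_convex (F.polyhedron i).convex (F.nonempty i)).some_mem⟩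

theorem PolyFlag.exists_isAdapted (F : PolyFlag M) : ∃ w, F.IsAdapted w :=
  F.exists_forall_mem_intrinsicInterior.elim fun _ hx =>
    ⟨_, F.isAdapted_of_mem_intrinsicInterior hx⟩

/-- The term cone of a flag: the terms with lexicographically nonpositive values at some, or
equivalently any, adapted points. -/
def flagCone (Γ : AddSubgroup ℝ) (F : PolyFlag M) : Set (ℝ × M) :=
  lexCone Γ F.exists_isAdapted.choose

theorem PolyFlag.IsAdapted.flagCone_eq {F : PolyFlag M} {w : Fin (F.length + 1) → ℝ × NR M}
    (hw : F.IsAdapted w) (Γ : AddSubgroup ℝ) : flagCone Γ F = lexCone Γ w :=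
  F.exists_isAdapted.choose_spec.lexCone_eq hw Γ

theorem isTermCone_flagCone {Γ : AddSubgroup ℝ} (hΓ : ∃ γ ∈ Γ, γ ≠ 0) (F : PolyFlag M) :
    IsTermCone Γ (flagCone Γ F) :=
  isTermCone_lexCone hΓ F.exists_isAdapted.choose_spec.fst_pos

end Adapted

/-! ### Rational neighbourhoods of flags -/

section Neighbourhood
variable {M : Type*} [AddCommGroup M]

theorem rowValue_mk_one {m : ℕ} (x : Fin m → NR M) (a : ℝ × M) (i : Fin m) :
    rowValue (fun i => (1, x i)) a i = a.1 + x i a.2 := by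
  simp [rowValue]

variable [Module.Finite ℤ M] {Γ : AddSubgroup ℝ}

/-- If finitely many terms belong to the term cone of a flag, then they are `≤ 1` at suitable
points in the relative interiors of the cells. -/
theorem exists_mem_intrinsicInterior_of_subset_flagCone {F : PolyFlag M} {I : Set (ℝ × M)}
    (hI : I.Finite) (h : I ⊆ flagCone Γ F) (i : Fin (F.length + 1)) :
    ∃ y ∈ intrinsicInterior ℝ (F.cell i), ∀ a ∈ I, a.1 + y a.2 ≤ 0 := by
  obtain ⟨x, hx⟩ := F.exists_forall_mem_intrinsicInterior
  have hlex : ∀ a ∈ I, ∀ i, (∀ j < i, a.1 + x j a.2 = 0) → a.1 + x i a.2 ≤ 0 := by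
    intro a ha i hi
    have h1 := h ha
    rw [(F.isAdapted_of_mem_intrinsicInterior hx).flagCone_eq Γ] at h1
    have h2 := h1.2 i
    simp only [rowValue_mk_one] at h2
    exact h2 hi
  suffices H : ∃ y ∈ intrinsicInterior ℝ (F.cell i), ∀ a ∈ I, a.1 + y a.2 ≤ 0 ∧
      (a.1 + y a.2 = 0 → ∀ j ≤ i, a.1 + x j a.2 = 0) from
    H.imp fun y hy => ⟨hy.1, fun a ha => (hy.2 a ha).1⟩
  induction i using Fin.induction with
  | zero =>
    refine ⟨x 0, hx 0, fun a ha => ⟨hlex a ha 0 fun j hj => absurd hj (Fin.not_lt_zero j), ?_⟩⟩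
    intro h0 j hj
    rwa [Fin.le_zero_iff.1 hj]
  | succ i ih =>
    obtain ⟨y, hy, hyI⟩ := ih
    -- move `y` slightly towards the relative interior of the next cell
    have hev : ∀ a ∈ I, ∀ᶠ ε : ℝ in 𝓝[>] 0, a.1 + y a.2 < 0 →
        (1 - ε) * (a.1 + y a.2) + ε * (a.1 + x i.succ a.2) < 0 := by
      intro a _
      by_cases hneg : a.1 + y a.2 < 0
      · have hc : Continuous fun ε : ℝ =>
            (1 - ε) * (a.1 + y a.2) + ε * (a.1 + x i.succ a.2) := by fun_prop
        have hlim : Tendsto (fun ε : ℝ =>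
            (1 - ε) * (a.1 + y a.2) + ε * (a.1 + x i.succ a.2)) (𝓝[>] 0) (𝓝 (a.1 + y a.2)) :=
          (hc.tendsto' 0 _ (by simp)).mono_left nhdsWithin_le_nhds
        exact (hlim.eventually_lt_const hneg).mono fun ε h _ => h
      · exact Eventually.of_forall fun ε h => absurd h hneg
    have hle : ∀ᶠ ε : ℝ in 𝓝[>] 0, ε ≤ 1 :=
      nhdsWithin_le_nhds (Iic_mem_nhds zero_lt_one)
    obtain ⟨ε, ⟨hε, hε1⟩, hε0⟩ :=
      (((hI.eventually_all.2 hev).and hle).and self_mem_nhdsWithin).exists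
    have hε0 : 0 < ε := hε0
    refine ⟨(1 - ε) • y + ε • x i.succ,
      add_smul_mem_intrinsicInterior (F.polyhedron _).convex (hx _)
        ((F.face i).subset (intrinsicInterior_subset hy)) hε0 hε1, fun a ha => ?_⟩
    have hval : a.1 + ((1 - ε) • y + ε • x i.succ) a.2 =
        (1 - ε) * (a.1 + y a.2) + ε * (a.1 + x i.succ a.2) := by
      have : ((1 - ε) • y + ε • x i.succ) a.2 = (1 - ε) * y a.2 + ε * x i.succ a.2 := rfl
      rw [this]; ring
    rw [hval]
    rcases (hyI a ha).1.lt_or_eq with hneg | h0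
    · have := hε a ha hneg
      exact ⟨this.le, fun h => absurd h this.ne⟩
    · have hj := (hyI a ha).2 h0
      have hnp := hlex a ha i.succ fun j hlt => hj j (Fin.le_castSucc_iff.2 hlt)
      rw [h0, mul_zero, zero_add]
      refine ⟨mul_nonpos_of_nonneg_of_nonpos hε0.le hnp, fun hz j hle => ?_⟩
      rcases hle.lt_or_eq with hlt | rfl
      · exact hj j (Fin.le_castSucc_iff.2 hlt)
      · exact (mul_eq_zero.1 hz).resolve_left hε0.ne'

/-- The `Γ`-rational neighbourhoods of a flag are the polyhedra defined by terms of its term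
cone. -/
theorem isRatNhd_iff {F : PolyFlag M} {I : Set (ℝ × M)} (hI : I.Finite)
    (hIΓ : ∀ a ∈ I, a.1 ∈ Γ) :
    IsRatNhd (Γ : Set ℝ) F (⋂ a ∈ I, halfSpace a) ↔ I ⊆ flagCone Γ F := by
  constructor
  · rintro ⟨-, h⟩ a ha
    choose y hy using h
    rw [(F.isAdapted_of_mem_intrinsicInterior fun i => (hy i).2).flagCone_eq Γ]
    refine ⟨hIΓ a ha, fun i _ => ?_⟩
    rw [rowValue_mk_one]
    exact Set.mem_iInter₂.1 (hy i).1 a ha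
  · intro h
    refine ⟨isRatPolyhedron_iff.2 ⟨I, hI, hIΓ, rfl⟩, fun i => ?_⟩
    obtain ⟨y, hy, hyI⟩ := exists_mem_intrinsicInterior_of_subset_flagCone hI h i
    exact ⟨y, Set.mem_iInter₂.2 hyI, hy⟩

theorem locEquiv_iff_flagCone_eq {F F' : PolyFlag M} :
    LocEquiv (Γ : Set ℝ) F F' ↔ flagCone Γ F = flagCone Γ F' := by
  constructor
  · intro h
    have key : ∀ a : ℝ × M, a.1 ∈ Γ → (a ∈ flagCone Γ F ↔ a ∈ flagCone Γ F') := by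
      intro a ha
      have := h (⋂ b ∈ ({a} : Set (ℝ × M)), halfSpace b)
      rwa [isRatNhd_iff (Set.finite_singleton a) (by simpa using ha),
        isRatNhd_iff (Set.finite_singleton a) (by simpa using ha), Set.singleton_subset_iff,
        Set.singleton_subset_iff] at this
    ext a
    exact ⟨fun ha => (key a ha.1).1 ha, fun ha => (key a ha.1).2 ha⟩
  · intro h Q
    by_cases hQ : IsRatPolyhedron (Γ : Set ℝ) Q
    · obtain ⟨I, hI, hIΓ, rfl⟩ := isRatPolyhedron_iff.1 hQ
      rw [isRatNhd_iff hI hIΓ, isRatNhd_iff hI hIΓ, h]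
    · exact iff_of_false (fun h => hQ h.1) fun h => hQ h.1

end Neighbourhood

/-! ### Flags of orthants -/

section Orthant
variable {M : Type*} [AddCommGroup M] {ι : Type*}

/-- The orthant with vertex `ξ₀` spanned by the basis vectors `b j`, `j ∈ T`. -/
def orthant (b : Module.Basis ι ℝ (NR M)) (ξ₀ : NR M) (T : Set ι) : Set (NR M) :=
  {x | ∀ j, 0 ≤ b.coord j (x - ξ₀) ∧ (j ∉ T → b.coord j (x - ξ₀) = 0)}

variable (b : Module.Basis ι ℝ (NR M)) (ξ₀ : NR M) (T : Set ι)

theorem self_mem_orthant : ξ₀ ∈ orthant b ξ₀ T := fun j => by simp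

theorem add_basis_mem_orthant {T : Set ι} {i : ι} (hi : i ∈ T) : ξ₀ + b i ∈ orthant b ξ₀ T := by
  classical
  intro j
  rw [add_sub_cancel_left, Module.Basis.coord_apply, Module.Basis.repr_self,
    Finsupp.single_apply]
  split_ifs with h
  · exact ⟨zero_le_one, fun hj => absurd (h ▸ hi) hj⟩
  · exact ⟨le_rfl, fun _ => rfl⟩

theorem containsNoLine_orthant : ContainsNoLine (orthant b ξ₀ T) := by
  intro x v h
  refine b.ext_elem fun j => ?_
  rw [map_zero, Finsupp.zero_apply]
  by_contra hne
  have h1 := (h (-(b.coord j (x - ξ₀) + 1) / b.repr v j) j).1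
  rw [add_sub_right_comm, map_add, map_smul, Module.Basis.coord_apply b j v, smul_eq_mul,
    div_mul_cancel₀ _ hne] at h1
  linarith

theorem isFaceOf_orthant_insert {T : Set ι} {i : ι} (hi : i ∉ T) :
    IsFaceOf (orthant b ξ₀ T) (orthant b ξ₀ (insert i T)) := by
  refine ⟨-b.coord i, -b.coord i ξ₀, fun x hx => ?_, Set.ext fun x => ⟨fun hx => ⟨fun j =>
    ⟨(hx j).1, fun hj => (hx j).2 fun h => hj (Or.inr h)⟩, ?_⟩, fun hx j => ⟨(hx.1 j).1,
      fun hj => ?_⟩⟩⟩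
  · have := (hx i).1
    rw [map_sub] at this
    rw [LinearMap.neg_apply]
    linarith
  · have := (hx i).2 hi
    rw [map_sub] at this
    rw [LinearMap.neg_apply]
    linarith
  · rcases eq_or_ne j i with rfl | hji
    · have := hx.2
      rw [LinearMap.neg_apply] at this
      rw [map_sub]
      linarith
    · exact (hx.1 j).2 fun h => h.elim hji hj

theorem vectorSpan_orthant : vectorSpan ℝ (orthant b ξ₀ T) = Submodule.span ℝ (b '' T) := by
  refine le_antisymm (Submodule.span_le.2 ?_) (Submodule.span_le.2 ?_)
  · rintro _ ⟨x, hx, y, hy, rfl⟩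
    rw [SetLike.mem_coe, Module.Basis.mem_span_image]
    intro j hj
    by_contra hjT
    refine Finsupp.mem_support_iff.1 hj ?_
    have h1 := (hx j).2 hjT
    have h2 := (hy j).2 hjT
    rw [map_sub, Module.Basis.coord_apply, Module.Basis.coord_apply] at h1 h2
    change b.repr (x - y) j = 0
    rw [map_sub, Finsupp.sub_apply]
    linarith
  · rintro _ ⟨j, hj, rfl⟩
    have := vsub_mem_vectorSpan ℝ (add_basis_mem_orthant b ξ₀ hj) (self_mem_orthant b ξ₀ T)
    rwa [vsub_eq_sub, add_sub_cancel_left] at this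

theorem finrank_vectorSpan_orthant [Finite ι] :
    Module.finrank ℝ (vectorSpan ℝ (orthant b ξ₀ T)) = T.ncard := by
  classical
  have := Fintype.ofFinite T
  rw [vectorSpan_orthant, Set.image_eq_range,
    finrank_span_eq_card (b := fun j : T => b j)
      (b.linearIndependent.comp _ Subtype.val_injective), ← Nat.card_eq_fintype_card]
  rfl

/-- Linear inequalities for an orthant, together with their homogenizations. -/
theorem exists_orthant_eq [Finite ι] : ∃ I : Finset ((NR M →ₗ[ℝ] ℝ) × ℝ),
    orthant b ξ₀ T = {x | ∀ p ∈ I, p.1 x ≤ p.2} ∧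
    ∀ w : ℝ × NR M, (∀ p ∈ I, p.1 w.2 ≤ w.1 * p.2) ↔ ∀ j, 0 ≤ b.coord j (w.2 - w.1 • ξ₀) ∧
      (j ∉ T → b.coord j (w.2 - w.1 • ξ₀) = 0) := by
  classical
  have := Fintype.ofFinite ι
  let I : Finset ((NR M →ₗ[ℝ] ℝ) × ℝ) :=
    Finset.univ.image (fun j => (-b.coord j, -b.coord j ξ₀)) ∪
      (Finset.univ.filter (· ∉ T)).image fun j => (b.coord j, b.coord j ξ₀)
  have key : ∀ w : ℝ × NR M, (∀ p ∈ I, p.1 w.2 ≤ w.1 * p.2) ↔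
      ∀ j, 0 ≤ b.coord j (w.2 - w.1 • ξ₀) ∧ (j ∉ T → b.coord j (w.2 - w.1 • ξ₀) = 0) := by
    intro w
    simp only [map_sub, map_smul, smul_eq_mul]
    constructor
    · intro h j
      have h1 := h (-b.coord j, -b.coord j ξ₀)
        (Finset.mem_union_left _ (Finset.mem_image_of_mem _ (Finset.mem_univ j)))
      simp only [LinearMap.neg_apply] at h1
      refine ⟨by linarith, fun hj => ?_⟩
      have h2 := h (b.coord j, b.coord j ξ₀)
        (Finset.mem_union_right _ (Finset.mem_image_of_mem _ (by simpa using hj)))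
      simp only at h2
      linarith
    · intro h p hp
      rcases Finset.mem_union.1 hp with hp | hp
      · obtain ⟨j, -, rfl⟩ := Finset.mem_image.1 hp
        have := (h j).1
        simp only [LinearMap.neg_apply]
        linarith
      · obtain ⟨j, hj, rfl⟩ := Finset.mem_image.1 hp
        have := (h j).2 (by simpa using hj)
        simp only
        linarith
  refine ⟨I, Set.ext fun x => ?_, key⟩
  have := key (1, x)
  simp only [one_smul, one_mul] at this
  exact this.symm

theorem isPolyhedron_orthant [Finite ι] : IsPolyhedron (orthant b ξ₀ T) :=
  (exists_orthant_eq b ξ₀ T).imp fun _ h => h.1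

variable [Module.Finite ℤ M]

theorem mem_coneOver_orthant_iff [Finite ι] {w : ℝ × NR M} :
    w ∈ coneOver (orthant b ξ₀ T) ↔ 0 ≤ w.1 ∧ ∀ j, 0 ≤ b.coord j (w.2 - w.1 • ξ₀) ∧
      (j ∉ T → b.coord j (w.2 - w.1 • ξ₀) = 0) := by
  obtain ⟨I, hI, hI'⟩ := exists_orthant_eq b ξ₀ T
  have hne : (orthant b ξ₀ T).Nonempty := ⟨ξ₀, self_mem_orthant b ξ₀ T⟩
  rw [hI] at hne
  rw [hI, coneOver_eq hne, Set.mem_ofPred_eq, hI']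

/-- The cone over an orthant is generated by `(1, ξ₀)` and the vectors `(0, b j)` for `j ∈ T`. -/
theorem isSimplicial_coneOver_orthant [Finite ι] : ∃ C : PointedCone ℝ (ℝ × NR M),
    C.IsSimplicial ∧ (C : Set (ℝ × NR M)) = coneOver (orthant b ξ₀ T) := by
  classical
  have := Fintype.ofFinite ι
  let g : Option ι → ℝ × NR M := fun o => o.elim (1, ξ₀) fun j => (0, b j)
  have hg : LinearIndependent ℝ g := by
    rw [Fintype.linearIndependent_iff]
    intro c hc
    rw [Fintype.sum_option] at hc
    have h1 := congrArg Prod.fst hc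
    have h2 := congrArg Prod.snd hc
    simp only [g, Option.elim, Prod.fst_add, Prod.snd_add, Prod.fst_sum, Prod.snd_sum,
      Prod.smul_fst, Prod.smul_snd, smul_eq_mul, mul_one, mul_zero, Finset.sum_const_zero,
      add_zero, Prod.fst_zero, Prod.snd_zero] at h1 h2
    rw [h1, zero_smul, zero_add] at h2
    have h3 := Fintype.linearIndependent_iff.1 b.linearIndependent _ h2
    rintro (_ | j)
    exacts [h1, h3 j]
  let s : Set (Option ι) := {o | ∀ j, o = some j → j ∈ T}
  refine ⟨PointedCone.hull ℝ (g '' s), ⟨g '' s, Set.toFinite _,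
    hg.linearIndepOn_id.mono (Set.image_subset_range _ _), rfl⟩, ?_⟩
  ext w
  rw [mem_coneOver_orthant_iff]
  constructor
  · intro hw
    refine Submodule.span_induction (p := fun w _ => 0 ≤ w.1 ∧ ∀ j,
      0 ≤ b.coord j (w.2 - w.1 • ξ₀) ∧ (j ∉ T → b.coord j (w.2 - w.1 • ξ₀) = 0)) ?_ ?_ ?_ ?_ hw
    · rintro _ ⟨o, ho, rfl⟩
      rcases o with _ | i
      · simp [g]
      · refine ⟨le_rfl, fun j => ?_⟩
        have := add_basis_mem_orthant b ξ₀ (ho i rfl) j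
        simpa [g] using this
    · simp
    · rintro x y _ _ ⟨hx1, hx⟩ ⟨hy1, hy⟩
      refine ⟨add_nonneg hx1 hy1, fun j => ?_⟩
      have : (x + y).2 - (x + y).1 • ξ₀ = (x.2 - x.1 • ξ₀) + (y.2 - y.1 • ξ₀) := by
        rw [Prod.fst_add, Prod.snd_add]; module
      rw [this, map_add]
      exact ⟨add_nonneg (hx j).1 (hy j).1, fun hj => by
        rw [(hx j).2 hj, (hy j).2 hj, add_zero]⟩
    · rintro ⟨c, hc⟩ x _ ⟨hx1, hx⟩
      have hsm : (⟨c, hc⟩ : {c : ℝ // 0 ≤ c}) • x = c • x := rfl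
      rw [hsm]
      refine ⟨mul_nonneg hc hx1, fun j => ?_⟩
      have : (c • x).2 - (c • x).1 • ξ₀ = c • (x.2 - x.1 • ξ₀) := by
        rw [Prod.smul_fst, Prod.smul_snd, smul_eq_mul]; module
      rw [this, map_smul, smul_eq_mul]
      exact ⟨mul_nonneg hc (hx j).1, fun hj => by rw [(hx j).2 hj, mul_zero]⟩
  · rintro ⟨hw1, hw⟩
    have hsum : w = w.1 • g none + ∑ j, b.coord j (w.2 - w.1 • ξ₀) • g (some j) := by
      have h := b.sum_repr (w.2 - w.1 • ξ₀)
      refine Prod.ext ?_ ?_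
      · simp [g, Prod.fst_sum]
      · simp only [g, Option.elim, Prod.snd_add, Prod.snd_sum, Prod.smul_snd,
          Module.Basis.coord_apply]
        rw [h]; module
    rw [SetLike.mem_coe, hsum]
    refine add_mem ?_ (sum_mem fun j _ => ?_)
    · exact Submodule.smul_mem _ (⟨w.1, hw1⟩ : {c : ℝ // 0 ≤ c})
        (PointedCone.subset_hull ⟨none, fun j h => by simp at h, rfl⟩)
    · by_cases hj : j ∈ T
      · refine Submodule.smul_mem _ (⟨_, (hw j).1⟩ : {c : ℝ // 0 ≤ c})
          (PointedCone.subset_hull ⟨some j, fun i h => ?_, rfl⟩)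
        rwa [← Option.some_injective _ h]
      · rw [(hw j).2 hj, zero_smul]
        exact zero_mem _

/-- The flag of the orthants spanned by the first `i` vectors of an injective sequence of basis
vectors. -/
def orthantFlag [Finite ι] {k : ℕ} {e : Fin k → ι} (he : Function.Injective e) : PolyFlag M where
  length := k
  cell i := orthant b ξ₀ (e '' {m | m.castSucc < i})
  polyhedron i := isPolyhedron_orthant b ξ₀ _
  nonempty i := ⟨ξ₀, self_mem_orthant b ξ₀ _⟩
  noLine i := containsNoLine_orthant b ξ₀ _
  face j := by
    have h1 : e '' {m | m.castSucc < j.succ} =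
        insert (e j) (e '' {m | m.castSucc < j.castSucc}) := by
      rw [← Set.image_insert_eq]
      congr 1
      ext m
      simp only [Set.mem_ofPred_eq, Set.mem_insert_iff, Fin.lt_def, Fin.ext_iff, Fin.val_castSucc,
        Fin.val_succ]
      omega
    rw [h1]
    refine isFaceOf_orthant_insert b ξ₀ ?_
    rintro ⟨m, hm, hmj⟩
    rw [he hmj] at hm
    exact lt_irrefl j.castSucc hm
  dim i := by
    rw [finrank_vectorSpan_orthant, Set.ncard_image_of_injective _ he]
    have : {m : Fin k | m.castSucc < i} = Set.range (Fin.castLE (Nat.lt_succ_iff.1 i.2)) := by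
      ext m
      simp only [Set.mem_ofPred_eq, Set.mem_range, Fin.lt_def, Fin.val_castSucc]
      exact ⟨fun h => ⟨⟨m, h⟩, rfl⟩, fun ⟨x, hx⟩ => hx ▸ x.2⟩
    rw [this, ← Set.image_univ, Set.ncard_image_of_injective _ (Fin.castLE_injective _),
      Set.ncard_univ, Nat.card_fin]

theorem isAdapted_orthantFlag [Finite ι] {k : ℕ} {e : Fin k → ι} (he : Function.Injective e) :
    (orthantFlag b ξ₀ he).IsAdapted (weightRows ξ₀ fun i => b (e i)) := by
  intro i
  change weightRows ξ₀ (fun i => b (e i)) i ∈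
    coneOver (orthant b ξ₀ (e '' {m | m.castSucc < i})) \ (orthantFlag b ξ₀ he).prevCone i
  induction i using Fin.cases with
  | zero =>
    refine ⟨mk_one_mem_coneOver (self_mem_orthant b ξ₀ _), fun h => one_ne_zero (α := ℝ) ?_⟩
    exact congrArg Prod.fst (h : ((1 : ℝ), ξ₀) = 0)
  | succ j =>
    change ((0 : ℝ), b (e j)) ∈ _ \ coneOver (orthant b ξ₀ (e '' {m | m.castSucc < j.castSucc}))
    refine ⟨(mem_coneOver_orthant_iff b ξ₀ _).2 ⟨le_rfl, fun m => ?_⟩, fun h => ?_⟩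
    · have := add_basis_mem_orthant b ξ₀ (T := e '' {m | m.castSucc < j.succ}) (i := e j)
        ⟨j, Fin.castSucc_lt_succ, rfl⟩ m
      simpa using this
    · have := (((mem_coneOver_orthant_iff b ξ₀ _).1 h).2 (e j)).2 (by
        rintro ⟨m, hm, hmj⟩
        rw [he hmj] at hm
        exact lt_irrefl j.castSucc hm)
      simp at this

/-- Every term cone comes from a flag of orthants: extend the independent functionals that describe
it lexicographically to a basis. -/
theorem exists_isSimplicial_flagCone_eq {Γ : AddSubgroup ℝ} (hΓ : ∃ γ ∈ Γ, γ ≠ 0)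
    {N : Set (ℝ × M)} (hN : IsTermCone Γ N) :
    ∃ F : PolyFlag M, F.IsSimplicial ∧ flagCone Γ F = N := by
  obtain ⟨k, ξ₀, ξ, hξ, rfl⟩ := hN.eq_lexCone hΓ
  let b := Module.Basis.extend hξ.linearIndepOn_id
  have hfin : Finite (hξ.linearIndepOn_id.extend (Set.subset_univ _)) :=
    Module.Finite.finite_basis b
  let e : Fin k → hξ.linearIndepOn_id.extend (Set.subset_univ _) := fun i =>
    ⟨ξ i, hξ.linearIndepOn_id.subset_extend _ ⟨i, rfl⟩⟩
  have he : Function.Injective e := fun i j h => hξ.injective (congrArg Subtype.val h)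
  have hbe : (fun i => b (e i)) = ξ := funext fun i => Module.Basis.extend_apply_self _ _
  refine ⟨orthantFlag b ξ₀ he, fun i => isSimplicial_coneOver_orthant b ξ₀ _, ?_⟩
  have h := isAdapted_orthantFlag b ξ₀ he
  exact (h.flagCone_eq Γ).trans (congrArg (fun η => lexCone Γ (weightRows ξ₀ η)) hbe)

/-- Local equivalence classes of flags correspond to term cones. -/
noncomputable def flagEquivCone {Γ : AddSubgroup ℝ} (hΓ : ∃ γ ∈ Γ, γ ≠ 0) :
    Quotient (flagSetoid (Γ : Set ℝ) M) ≃ {N : Set (ℝ × M) // IsTermCone Γ N} :=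
  Equiv.ofBijective
    (Quotient.lift (fun F => ⟨flagCone Γ F, isTermCone_flagCone hΓ F⟩) fun _ _ h =>
      Subtype.ext (locEquiv_iff_flagCone_eq.1 h))
    ⟨by
      rintro ⟨F⟩ ⟨F'⟩ h
      exact Quotient.sound (locEquiv_iff_flagCone_eq.2 (congrArg Subtype.val h)), fun N => by
      obtain ⟨F, -, hF⟩ := exists_isSimplicial_flagCone_eq hΓ N.2
      exact ⟨Quotient.mk _ F, Subtype.ext hF⟩⟩

end Orthant
end TropCont

theorem theoremB (S : Subsemiring Trop) (hS : IsSubsemifield S)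
    {M : Type*} [AddCommGroup M] (n : ℕ) (hM : Nonempty (M ≃+ (Fin n → ℤ))) :
    ∃ (α : Quotient (flagSetoid (valueGroup S) M) ≃ ContSpec S (AddMonoidAlgebra S M))
      (β : ContSpec S (AddMonoidAlgebra S M) ≃ PolyhedralPrimeFilter (valueGroup S) M)
      (δ : PolyhedralPrimeFilter (valueGroup S) M ≃ PolytopalPrimeFilter (valueGroup S) M)
      (ε : ContSpec S (AddMonoidAlgebra S M) ≃
        {r : valueGroup S × M → valueGroup S × M → Prop // IsChanMaclagan r}),
      -- a flag goes to the prime of any locally equivalent flag whose flag of cones is simplicial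
      (∀ F : PolyFlag M,
        (∃ F' : PolyFlag M, LocEquiv (valueGroup S) F F' ∧ F'.IsSimplicial) ∧
        ∀ F' : PolyFlag M, LocEquiv (valueGroup S) F F' → F'.IsSimplicial →
          IsPrimeOfFlag F' (α (Quotient.mk (flagSetoid (valueGroup S) M) F)).1) ∧
      -- a prime `P` goes to the filter `F_P`
      (∀ P : ContSpec S (AddMonoidAlgebra S M),
        ((β P).1 : Set (polyhedralLattice (valueGroup S) M)) = filterOfPrime P.1) ∧
      -- a filter goes to the set of its polytopal members
      (∀ (F : PolyhedralPrimeFilter (valueGroup S) M) (V : polytopalLattice (valueGroup S) M),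
        V ∈ (δ F).1 ↔ ∃ U ∈ F.1, (U : Set (NR M)) = V) ∧
      -- a prime `P` goes to the relation `≤_P` on terms
      (∀ (P : ContSpec S (AddMonoidAlgebra S M)) (a b : valueGroup S × M),
        (ε P).1 a b ↔ PLE P.1 (termOf a) (termOf b)) := by
  obtain ⟨eM⟩ := hM
  have : Module.Finite ℤ M := Module.Finite.equiv eM.toIntLinearEquiv.symm
  have hΓ := valueSubgroup_nontrivial hS
  refine ⟨(flagEquivCone hΓ).trans (contSpecEquivCone hS).symm,
    (contSpecEquivCone hS).trans (filterEquivCone hΓ).symm,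
    polyhedralFilterEquivPolytopal (valueSubgroup hS) M,
    (contSpecEquivCone hS).trans (preorderEquivCone hΓ).symm, fun F => ⟨?_, ?_⟩, fun P => ?_,
    mem_polyhedralFilterEquivPolytopal, fun P a b => ?_⟩
  · obtain ⟨F', hF', h⟩ := exists_isSimplicial_flagCone_eq hΓ (isTermCone_flagCone hΓ F)
    exact ⟨F', (locEquiv_iff_flagCone_eq (Γ := valueSubgroup hS)).2 h.symm, hF'⟩
  · intro F' h _
    refine ⟨F'.exists_isAdapted, fun w hw => ?_⟩
    set P := (contSpecEquivCone hS).symm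
      (flagEquivCone hΓ (Quotient.mk (flagSetoid (valueSubgroup hS : Set ℝ) M) F)) with hPdef
    have hP : coneOfPrime hS P.1 = flagCone (valueSubgroup hS) F :=
      congrArg Subtype.val ((contSpecEquivCone hS).apply_symm_apply
        (flagEquivCone hΓ (Quotient.mk (flagSetoid (valueSubgroup hS : Set ℝ) M) F)))
    refine IsPrimeCon.isDefinedBy hS P.2.1 ?_
    rw [hP, locEquiv_iff_flagCone_eq.1 h, hw.flagCone_eq]
  · ext U
    rw [IsPrimeCon.mem_filterOfPrime_iff hS P.2.1]
    exact mem_filterEquivCone_symm hΓ (contSpecEquivCone hS P) U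
  · have h1 := ((preorderEquivCone hΓ).symm (contSpecEquivCone hS P)).2.iff_sub_mem a b
    have h2 : coneOfPreorder (valueSubgroup hS)
        ((preorderEquivCone hΓ).symm (contSpecEquivCone hS P)).1 = coneOfPrime hS P.1 :=
      congrArg Subtype.val ((preorderEquivCone hΓ).apply_symm_apply (contSpecEquivCone hS P))
    rw [h2] at h1
    have h3 : PLE P.1 (term hS ((a.1 : ℝ), a.2) a.1.2) (term hS ((b.1 : ℝ), b.2) b.1.2) ↔
        ((a.1 : ℝ), a.2) - ((b.1 : ℝ), b.2) ∈ coneOfPrime hS P.1 := term_ple_iff _ _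
    exact h1.trans h3.symm
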